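/- Let $K$ be a field, $A$ a unital associative $K$-algebra, and $S$ an inverse monoid with set of idempotents $E(S)$ and natural partial order $s\le t\iff s=et$ for some $e\in E(S)$. Let $\theta$ be a unital action of $S$ on $A$: a monoid homomorphism $s\mapsto\theta_s$ from $S$ to the symmetric inverse monoid of partial bijections of $A$ (so $\theta_1=\mathrm{id}_A$) such that $\operatorname{ran}\theta_s=1_sA$ for a central idempotent $1_s\in A$, and $\theta_s:1_{s^{-1}}A\to 1_sA$ is an isomorphism of $K$-algebras, for every $s\in S$. Let $L=\bigoplus_{s\in S}1_sA\,\delta_s$ be the $K$-algebra with product $a\delta_s\cdot b\delta_t=a\theta_s(1_{s^{-1}}b)\delta_{st}$, and let the crossed product $A\rtimes_\theta S$ be the quotient of $L$ by the two-sided ideal generated by all $a\delta_s-a\delta_t$ with $s\le t$ and $a\in 1_sA$; write $\overline{a\delta_s}$ for the class of $a\delta_s$. For a $K$-algebra $R$ put $R^e=R\otimes_K R^{\mathrm{op}}$; $R$-bimodules are identified with left $R^e$-modules by $(a\otimes b)x=axb$, $R$ is a right $R^e$-module by $x(a\otimes b)=bxa$, and $H_n(R,M)=\operatorname{Tor}^{R^e}_n(R,M)$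 is the Hochschild homology of $R$ with values in an $R$-bimodule $M$. An $A\rtimes_\theta S$-bimodule $M$ is an $A$-bimodule through $a\mapsto\overline{a\delta_1}$, and $A\otimes_{A^e}M$ is a left module over the semigroup algebra $KS$ by $$s\cdot(a\otimes x)=\theta_s(1_{s^{-1}}a)\otimes \overline{1_s\delta_s}\,x\,\overline{1_{s^{-1}}\delta_{s^{-1}}}.$$ This defines a right exact functor $F_1=A\otimes_{A^e}-$ from $(A\rtimes_\theta S)^e$-modules to left $KS$-modules, with left derived functors $L_qF_1$. Let $KE(S)$ be the free $K$-module on $E(S)$, a right $KS$-module by $e\cdot s=s^{-1}es$, and for a left $KS$-module $V$ put $H_n(S,V)=\operatorname{Tor}_n^{KS}(KE(S),V)$. Then for every $A\rtimes_\theta S$-bimodule $M$ there is a first quadrant homology spectral sequence of $K$-modules, with differentials $d^r:E^r_{p,q}\to E^r_{p-r,q+r-1}$ for $r\ge2$, $$E^2_{p,q}=H_p\bigl(S,(L_qF_1)M\bigr)\Rightarrow H_{p+q}(A\rtimes_\theta S,M).$$ That is, $E^2_{p,q}\cong H_p(S,(L_qF_1)M)$ for all $p,q\ge 0$, and each $H_n(A\rtimes_\theta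 S,M)$ has a filtration by $K$-submodules $0=\Phi_{-1}\subseteq\Phi_0\subseteq\dots\subseteq\Phi_n=H_n(A\rtimes_\theta S,M)$ with $\Phi_p/\Phi_{p-1}\cong E^\infty_{p,n-p}$ for $0\le p\le n$, where $E^\infty_{p,q}$ is the common value of $E^r_{p,q}$ for all $r\ge 2$ with $r>\max(p,q+1)$. -/

import Mathlib

universe u

open CategoryTheory

noncomputable section

open TensorProduct MulOpposite


/-! ### Inverse monoids -/

/-- An inverse monoid: a monoid in which every `s` has a unique generalized inverse `s⁻¹`. -/
class InverseMonoid (S : Type*) extends Monoid S, Inv S where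
  mul_inv_mul_self : ∀ s : S, s * s⁻¹ * s = s
  inv_mul_inv_self : ∀ s : S, s⁻¹ * s * s⁻¹ = s⁻¹
  inv_unique : ∀ s t : S, s * t * s = s → t * s * t = t → t = s⁻¹

namespace InverseMonoid

section

variable {S : Type*} [InverseMonoid S]

lemma inv_of_idem {e : S} (he : e * e = e) : e⁻¹ = e :=
  (inv_unique e e (by rw [he, he]) (by rw [he, he])).symm

lemma idem_mul_idem {e f : S} (he : e * e = e) (hf : f * f = f) :
    (e * f) * (e * f) = e * f := by
  have h1 := mul_inv_mul_self (e * f)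
  have h2 := inv_mul_inv_self (e * f)
  set x := (e * f)⁻¹ with hx
  have h3 : f * x * e = x := by
    apply inv_unique
    · calc e * f * (f * x * e) * (e * f) = e * (f * f) * x * (e * e) * f := by
            simp only [mul_assoc]
        _ = e * f * x * (e * f) := by rw [he, hf]; simp only [mul_assoc]
        _ = e * f := h1
    · calc f * x * e * (e * f) * (f * x * e) = f * x * (e * e) * (f * f) * x * e := by
            simp only [mul_assoc]
        _ = f * (x * (e * f) * x) * e := by rw [he, hf]; simp only [mul_assoc]
        _ = f * x * e := by rw [h2]
  have h4 : x * x = x := by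
    calc x * x = (f * x * e) * (f * x * e) := by rw [h3]
      _ = f * (x * (e * f) * x) * e := by simp only [mul_assoc]
      _ = x := by rw [h2, h3]
  have h5 : e * f = x := by
    rw [inv_unique x (e * f) h2 h1, inv_of_idem h4]
  rw [h5, h4]

/-- Idempotents of an inverse monoid commute. -/
lemma idem_comm {e f : S} (he : e * e = e) (hf : f * f = f) : e * f = f * e := by
  have h1 := idem_mul_idem he hf
  have h2 := idem_mul_idem hf he
  have h3 : f * e = (e * f)⁻¹ := by
    apply inv_unique
    · calc e * f * (f * e) * (e * f) = e * (f * f) * (e * e) * f := by simp only [mul_assoc]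
        _ = (e * f) * (e * f) := by rw [he, hf]; simp only [mul_assoc]
        _ = e * f := h1
    · calc f * e * (e * f) * (f * e) = f * (e * e) * (f * f) * e := by simp only [mul_assoc]
        _ = (f * e) * (f * e) := by rw [he, hf]; simp only [mul_assoc]
        _ = f * e := h2
  rw [h3, inv_of_idem h1]

lemma mul_inv_idem (s : S) : (s * s⁻¹) * (s * s⁻¹) = s * s⁻¹ := by
  rw [← mul_assoc, mul_inv_mul_self]

lemma inv_mul_idem (s : S) : (s⁻¹ * s) * (s⁻¹ * s) = s⁻¹ * s := by
  rw [← mul_assoc, inv_mul_inv_self]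

lemma mul_inv_rev' (s t : S) : (s * t)⁻¹ = t⁻¹ * s⁻¹ := by
  have hc := idem_comm (inv_mul_idem s) (mul_inv_idem t)
  symm
  apply inv_unique
  · calc s * t * (t⁻¹ * s⁻¹) * (s * t) = s * ((t * t⁻¹) * (s⁻¹ * s)) * t := by
          simp only [mul_assoc]
      _ = (s * s⁻¹ * s) * (t * t⁻¹ * t) := by rw [← hc]; simp only [mul_assoc]
      _ = s * t := by rw [mul_inv_mul_self, mul_inv_mul_self]
  · calc t⁻¹ * s⁻¹ * (s * t) * (t⁻¹ * s⁻¹) = t⁻¹ * ((s⁻¹ * s) * (t * t⁻¹)) * s⁻¹ := by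
          simp only [mul_assoc]
      _ = (t⁻¹ * t * t⁻¹) * (s⁻¹ * s * s⁻¹) := by rw [hc]; simp only [mul_assoc]
      _ = t⁻¹ * s⁻¹ := by rw [inv_mul_inv_self, inv_mul_inv_self]

lemma inv_one' : (1 : S)⁻¹ = 1 := inv_of_idem (mul_one 1)

lemma conj_idem (s : S) {e : S} (he : e * e = e) :
    (s⁻¹ * e * s) * (s⁻¹ * e * s) = s⁻¹ * e * s := by
  calc (s⁻¹ * e * s) * (s⁻¹ * e * s) = s⁻¹ * (e * (s * s⁻¹)) * e * s := by
        simp only [mul_assoc]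
    _ = (s⁻¹ * s * s⁻¹) * (e * e) * s := by
        rw [idem_comm he (mul_inv_idem s)]; simp only [mul_assoc]
    _ = s⁻¹ * e * s := by rw [inv_mul_inv_self, he]

/-- The natural partial order: `s ≤ t` iff `s = e t` for some idempotent `e`. -/
def NatLE (s t : S) : Prop := ∃ e : S, e * e = e ∧ s = e * t

end

/-- The set `E(S)` of idempotents of `S`. -/
abbrev Idem (S : Type*) [InverseMonoid S] : Type _ := {e : S // e * e = e}

end InverseMonoid

open InverseMonoid

/-! ### Unital actions -/

/-- A unital action of an inverse monoid `S` on a `K`-algebra `A`: a homomorphism `θ` of monoids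
from `S` to the symmetric inverse monoid of all partial bijections `A ≃. A`
(`θ (s t)` is `θ t` followed by `θ s` on the largest possible domain), such that the range of
`θ s` is the ideal `1ₛ A` for a central idempotent `1ₛ = unit s`, and `θ s` is an isomorphism of
algebras from its domain onto its range. (The domain of `θ s` is the range of `θ s⁻¹`,
i.e. the ideal generated by `unit s⁻¹`; see `UnitalAction.mem_dom_iff`.) -/
structure UnitalAction (K A S : Type*) [CommRing K] [Ring A] [Algebra K A]
    [InverseMonoid S] where
  θ : S → (A ≃. A)
  θ_one : θ 1 = PEquiv.refl A
  θ_mul : ∀ s t, θ (s * t) = (θ t).trans (θ s)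
  unit : S → A
  unit_central : ∀ s a, unit s * a = a * unit s
  unit_idem : ∀ s, unit s * unit s = unit s
  mem_range_iff : ∀ s b, (∃ a, θ s a = some b) ↔ ∃ c, b = unit s * c
  apply_add : ∀ s a a' b b', θ s a = some b → θ s a' = some b' → θ s (a + a') = some (b + b')
  apply_mul : ∀ s a a' b b', θ s a = some b → θ s a' = some b' → θ s (a * a') = some (b * b')
  apply_smul : ∀ s (k : K) a b, θ s a = some b → θ s (k • a) = some (k • b)

namespace UnitalAction

variable {K A S : Type u} [CommRing K] [Ring A] [Algebra K A] [InverseMonoid S]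
  (α : UnitalAction K A S)

lemma mul_apply (s t : S) (a : A) : α.θ (s * t) a = (α.θ t a).bind (α.θ s) := by
  rw [α.θ_mul]; rfl

lemma inj {s : S} {a a' b : A} (h : α.θ s a = some b) (h' : α.θ s a' = some b) : a = a' := by
  rw [← PEquiv.eq_some_iff] at h h'
  exact Option.some_injective _ (h.symm.trans h')

lemma inv_aux {s t : S} (hst : s * t * s = s) {a b : A} (h : α.θ s a = some b) :
    α.θ t b = some a := by
  have h1 : α.θ (s * t * s) a = some b := by rw [hst, h]
  rw [mul_apply, h, Option.bind_some, mul_apply, Option.bind_eq_some_iff] at h1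
  obtain ⟨a', ha', hb⟩ := h1
  rw [ha', α.inj hb h]

/-- `θ s⁻¹` is the inverse partial bijection of `θ s`. -/
lemma inv_apply_iff (s : S) (a b : A) : α.θ s⁻¹ b = some a ↔ α.θ s a = some b :=
  ⟨α.inv_aux (inv_mul_inv_self s), α.inv_aux (mul_inv_mul_self s)⟩

lemma unit_mul_of_range {s : S} {a b : A} (h : α.θ s a = some b) : α.unit s * b = b := by
  obtain ⟨c, rfl⟩ := (α.mem_range_iff s b).1 ⟨a, h⟩
  rw [← mul_assoc, α.unit_idem]

/-- The domain of `θ s` is the ideal generated by the central idempotent `unit s⁻¹`. -/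
lemma mem_dom_iff (s : S) (a : A) : (∃ b, α.θ s a = some b) ↔ ∃ c, a = α.unit s⁻¹ * c := by
  rw [← α.mem_range_iff]
  exact exists_congr fun b => (α.inv_apply_iff s a b).symm

lemma unit_mul_of_dom {s : S} {a b : A} (h : α.θ s a = some b) : α.unit s⁻¹ * a = a :=
  α.unit_mul_of_range ((α.inv_apply_iff s a b).2 h)

/-- `s · a = θ s (1_{s⁻¹} a)`, see `UnitalAction.apply_unit_mul`; the default value in `getD` is
never used. -/
def actFun (s : S) (a : A) : A := (α.θ s (α.unit s⁻¹ * a)).getD 0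

lemma apply_unit_mul (s : S) (a : A) : α.θ s (α.unit s⁻¹ * a) = some (α.actFun s a) := by
  obtain ⟨b, hb⟩ := (α.mem_dom_iff s (α.unit s⁻¹ * a)).2 ⟨a, rfl⟩
  rw [actFun, hb]; rfl

lemma actFun_eq {s : S} {a b : A} (h : α.θ s (α.unit s⁻¹ * a) = some b) : α.actFun s a = b := by
  rw [actFun, h]; rfl

lemma actFun_eq_of_dom {s : S} {a b : A} (h : α.θ s a = some b) : α.actFun s a = b :=
  α.actFun_eq (by rw [α.unit_mul_of_dom h, h])

lemma actFun_mul (s : S) (a b : A) : α.actFun s (a * b) = α.actFun s a * α.actFun s b := by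
  apply α.actFun_eq
  have h := α.apply_mul _ _ _ _ _ (α.apply_unit_mul s a) (α.apply_unit_mul s b)
  rwa [α.unit_central s⁻¹ b, ← mul_assoc, mul_assoc (α.unit s⁻¹) a b, α.unit_central s⁻¹ (a * b),
    mul_assoc, α.unit_idem, ← α.unit_central] at h

lemma unit_mul_actFun (s : S) (a : A) : α.unit s * α.actFun s a = α.actFun s a :=
  α.unit_mul_of_range (α.apply_unit_mul s a)

lemma actFun_unit_one (s : S) : α.actFun s 1 = α.unit s := by
  obtain ⟨x, hx⟩ := (α.mem_range_iff s (α.unit s)).2 ⟨1, (mul_one _).symm⟩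
  have h1 : α.actFun s x = α.unit s := α.actFun_eq_of_dom hx
  have h2 := α.actFun_mul s 1 x
  rw [one_mul, h1] at h2
  rw [h2, ← α.unit_central, α.unit_mul_actFun]

lemma unit_one : α.unit 1 = 1 := by
  obtain ⟨c, hc⟩ := (α.mem_range_iff 1 1).1 ⟨1, by rw [α.θ_one]; rfl⟩
  calc α.unit 1 = α.unit 1 * 1 := (mul_one _).symm
    _ = 1 := by rw [hc, ← mul_assoc, α.unit_idem]

lemma actFun_one (a : A) : α.actFun 1 a = a := by
  apply α.actFun_eq_of_dom
  rw [α.θ_one]; rfl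

lemma actFun_actFun (s t : S) (a : A) : α.actFun (s * t) a = α.actFun s (α.actFun t a) := by
  have key : ∀ {x y : A}, α.θ (s * t) x = some y → α.actFun s (α.actFun t x) = y := by
    intro x y h
    rw [mul_apply, Option.bind_eq_some_iff] at h
    obtain ⟨z, hz, hy⟩ := h
    rw [α.actFun_eq_of_dom hz, α.actFun_eq_of_dom hy]
  have h1 := key (α.apply_unit_mul (s * t) a)
  have h2 : α.actFun s (α.actFun t (α.unit (s * t)⁻¹)) = α.unit (s * t) := by
    have h := α.apply_unit_mul (s * t) 1
    rw [mul_one, α.actFun_unit_one] at h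
    exact key h
  rw [actFun_mul, actFun_mul, h2] at h1
  rw [← h1]
  have h3 : ∃ w, α.θ (s * t) w = some (α.actFun s (α.actFun t a)) := by
    obtain ⟨w, hw⟩ := (α.mem_range_iff t (α.unit s⁻¹ * α.actFun t a)).2
      ⟨α.unit s⁻¹ * α.actFun t a, by
        rw [← mul_assoc, α.unit_central t, mul_assoc, α.unit_mul_actFun]⟩
    exact ⟨w, by rw [mul_apply, hw, Option.bind_some, α.apply_unit_mul]⟩
  obtain ⟨w, hw⟩ := h3
  exact α.unit_mul_of_range hw

/-- The left `KS`-module structure on `A`: `s · a = θ s (1_{s⁻¹} a)`. -/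
def act : S →* Module.End K A where
  toFun s :=
    { toFun := α.actFun s
      map_add' := fun a b => α.actFun_eq (by
        rw [mul_add]
        exact α.apply_add _ _ _ _ _ (α.apply_unit_mul s a) (α.apply_unit_mul s b))
      map_smul' := fun k a => α.actFun_eq (by
        rw [mul_smul_comm]
        exact α.apply_smul _ _ _ _ (α.apply_unit_mul s a)) }
  map_one' := by ext a; exact α.actFun_one a
  map_mul' s t := by ext a; exact α.actFun_actFun s t a

lemma apply_unit_mul' (s : S) (a : A) : α.θ s (α.unit s⁻¹ * a) = some (α.act s a) :=
  α.apply_unit_mul s a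

lemma act_mul (s : S) (a b : A) : α.act s (a * b) = α.act s a * α.act s b := α.actFun_mul s a b

lemma unit_mul_act (s : S) (a : A) : α.unit s * α.act s a = α.act s a := α.unit_mul_actFun s a

lemma act_one (s : S) : α.act s 1 = α.unit s := α.actFun_unit_one s

lemma act_act (s t : S) (a : A) : α.act s (α.act t a) = α.act (s * t) a :=
  (α.actFun_actFun s t a).symm

lemma act_unit (s t : S) : α.act s (α.unit t) = α.unit (s * t) := by
  rw [← act_one, act_act, act_one]

lemma act_inv_act (s : S) (a : A) : α.act s⁻¹ (α.act s a) = α.unit s⁻¹ * a :=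
  α.actFun_eq_of_dom ((α.inv_apply_iff s _ _).2 (α.apply_unit_mul s a))

/-! ### The algebra `L(A, θ, S)` -/

/-- The bilinear product on finitely supported functions `S →₀ A` with
`(a δ_s) (b δ_t) = a θ_s(1_{s⁻¹} b) δ_{st}`. -/
def lmul : (S →₀ A) →ₗ[K] (S →₀ A) →ₗ[K] (S →₀ A) :=
  Finsupp.lsum K fun s => LinearMap.flip (Finsupp.lsum K fun t => LinearMap.flip
    (((LinearMap.mul K A).compl₂ (α.act s)).compr₂ (Finsupp.lsingle (s * t))))

lemma lmul_single (s t : S) (a b : A) :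
    α.lmul (Finsupp.single s a) (Finsupp.single t b) = Finsupp.single (s * t) (a * α.act s b) := by
  simp [lmul]

lemma lmul_assoc (x y z : S →₀ A) : α.lmul (α.lmul x y) z = α.lmul x (α.lmul y z) := by
  induction x using Finsupp.induction_linear with
  | zero => simp
  | add x x' h h' => simp [h, h']
  | single s a =>
    induction y using Finsupp.induction_linear with
    | zero => simp
    | add y y' h h' => simp [h, h']
    | single t b =>
      induction z using Finsupp.induction_linear with
      | zero => simp
      | add z z' h h' => simp only [map_add, h, h']
      | single r c =>
        rw [lmul_single, lmul_single, lmul_single, lmul_single, act_mul, act_act, mul_assoc,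
          mul_assoc]

/-- The underlying `K`-module of `L(A, θ, S) = ⨁ₛ 1ₛA δₛ`, realized as the finitely supported
functions `f : S →₀ A` with `f s ∈ 1ₛA` for all `s`; `Finsupp.single s a` is `a δₛ`. -/
def lSubmodule : Submodule K (S →₀ A) where
  carrier := {f | ∀ s, α.unit s * f s = f s}
  add_mem' := fun {f g} hf hg s => by rw [Finsupp.add_apply, mul_add, hf, hg]
  zero_mem' := fun s => by simp
  smul_mem' := fun k _ hf s => by rw [Finsupp.smul_apply, mul_smul_comm, hf]

lemma single_mem {s : S} {a : A} (h : α.unit s * a = a) :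
    Finsupp.single s a ∈ α.lSubmodule := by
  classical
  intro t
  rw [Finsupp.single_apply]
  split_ifs with hst
  · rw [← hst, h]
  · rw [mul_zero]

lemma lmul_mem (f : S →₀ A) {g : S →₀ A} (hg : g ∈ α.lSubmodule) :
    α.lmul f g ∈ α.lSubmodule := by
  rw [← f.sum_single, ← g.sum_single, Finsupp.sum, Finsupp.sum, map_sum α.lmul,
    LinearMap.sum_apply]
  refine Submodule.sum_mem _ fun s _ => ?_
  rw [map_sum]
  refine Submodule.sum_mem _ fun t _ => ?_
  rw [lmul_single]
  apply α.single_mem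
  have h : α.act s (g t) = α.unit (s * t) * α.act s (g t) := by
    conv_lhs => rw [← hg t, act_mul, act_unit]
  rw [h, ← mul_assoc, ← mul_assoc, α.unit_central, mul_assoc (f s), α.unit_idem, mul_assoc]

lemma one_lmul (f : S →₀ A) : α.lmul (Finsupp.single 1 1) f = f := by
  induction f using Finsupp.induction_linear with
  | zero => simp
  | add f g h h' => rw [map_add, h, h']
  | single t b =>
    rw [lmul_single, one_mul, one_mul]
    congr 1
    exact α.actFun_one b

lemma lmul_one {f : S →₀ A} (hf : f ∈ α.lSubmodule) : α.lmul f (Finsupp.single 1 1) = f := by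
  conv_lhs => rw [← f.sum_single, Finsupp.sum, map_sum, LinearMap.sum_apply]
  conv_rhs => rw [← f.sum_single, Finsupp.sum]
  refine Finset.sum_congr rfl fun s _ => ?_
  rw [lmul_single, mul_one, act_one, ← α.unit_central, hf s]

/-- The `K`-algebra `L(A, θ, S)`. -/
def L : Type u := α.lSubmodule

instance : AddCommGroup α.L := inferInstanceAs (AddCommGroup α.lSubmodule)

instance : Module K α.L := inferInstanceAs (Module K α.lSubmodule)

instance : Ring α.L :=
  { (inferInstance : AddCommGroup α.L) with
    mul := fun x y => ⟨α.lmul x.1 y.1, α.lmul_mem x.1 y.2⟩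
    one := ⟨Finsupp.single 1 1, α.single_mem (by rw [α.unit_one, mul_one])⟩
    mul_assoc := fun x y z => Subtype.ext (α.lmul_assoc x.1 y.1 z.1)
    one_mul := fun x => Subtype.ext (α.one_lmul x.1)
    mul_one := fun x => Subtype.ext (α.lmul_one x.2)
    left_distrib := fun x y z => Subtype.ext ((α.lmul x.1).map_add y.1 z.1)
    right_distrib := fun x y z => Subtype.ext (LinearMap.map_add₂ α.lmul x.1 y.1 z.1)
    zero_mul := fun x => Subtype.ext (LinearMap.map_zero₂ α.lmul x.1)
    mul_zero := fun x => Subtype.ext ((α.lmul x.1).map_zero) }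

instance : Algebra K α.L :=
  Algebra.ofModule (fun k x y => Subtype.ext (LinearMap.map_smul₂ α.lmul k x.1 y.1))
    (fun k x y => Subtype.ext ((α.lmul x.1).map_smul k y.1))

/-- The element `a δₛ` of `L(A, θ, S)`, for `a ∈ 1ₛA`. -/
def δ (s : S) (a : A) (h : α.unit s * a = a) : α.L := ⟨Finsupp.single s a, α.single_mem h⟩

lemma δ_mul_δ (s t : S) (a b : A) (ha : α.unit s * a = a) (hb : α.unit t * b = b)
    (hab : α.unit (s * t) * (a * α.act s b) = a * α.act s b) :
    α.δ s a ha * α.δ t b hb = α.δ (s * t) (a * α.act s b) hab :=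
  Subtype.ext (α.lmul_single s t a b)

lemma δ_congr {s t : S} {a b : A} (ha : α.unit s * a = a) (hb : α.unit t * b = b)
    (h : s = t) (h' : a = b) : α.δ s a ha = α.δ t b hb := by
  subst h h'; rfl

/-! ### The crossed product -/

/-- The set of all `a δ_s - a δ_t` with `s ≤ t` and `a ∈ 1ₛA` (then also `a ∈ 1ₜA`). -/
def crossedRel : Set α.L :=
  {x | ∃ (s t : S) (a : A) (hs : α.unit s * a = a) (ht : α.unit t * a = a),
    NatLE s t ∧ x = α.δ s a hs - α.δ t a ht}

/-- If `s ≤ t` then `1ₛA ⊆ 1ₜA`, so that the condition on `t` in `crossedRel` is automatic. -/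
lemma unit_mul_of_natLE {s t : S} (h : NatLE s t) {a : A} (ha : α.unit s * a = a) :
    α.unit t * a = a := by
  obtain ⟨e, he, rfl⟩ := h
  have h1 : e * t = t * (t⁻¹ * e * t) := by
    calc e * t = e * (t * t⁻¹) * t := by rw [mul_assoc e, mul_inv_mul_self]
      _ = t * (t⁻¹ * e * t) := by
        rw [idem_comm he (mul_inv_idem t)]; simp only [mul_assoc]
  have h2 : α.unit t * α.unit (e * t) = α.unit (e * t) := by
    rw [h1, ← act_unit, unit_mul_act]
  rw [← ha, ← mul_assoc, h2]

/-- The crossed product `A ⋊_θ S`: the quotient of `L(A, θ, S)` by the two-sided ideal generated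
by `crossedRel`. -/
abbrev CrossedProduct : Type u := α.L ⧸ (TwoSidedIdeal.span α.crossedRel).asIdeal

/-- The quotient map `L(A, θ, S) → A ⋊_θ S`. -/
def toCrossed : α.L →ₐ[K] α.CrossedProduct :=
  Ideal.Quotient.mkₐ K (TwoSidedIdeal.span α.crossedRel).asIdeal

/-- The algebra homomorphism `A → A ⋊_θ S`, `a ↦ a δ₁`. -/
def ι : A →ₐ[K] α.CrossedProduct :=
  α.toCrossed.comp <| AlgHom.ofLinearMap
    { toFun := fun a => α.δ 1 a (by rw [α.unit_one, one_mul])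
      map_add' := fun a b => Subtype.ext (Finsupp.single_add 1 a b)
      map_smul' := fun k a => Subtype.ext (Finsupp.smul_single k 1 a).symm }
    rfl
    (fun a b => Subtype.ext (by
      refine Eq.trans ?_ (α.lmul_single 1 1 a b).symm
      rw [mul_one, map_one]; rfl))

/-- The monoid homomorphism `Γ : S → A ⋊_θ S`, `s ↦ 1ₛ δₛ`. -/
def Γ : S →* α.CrossedProduct :=
  (α.toCrossed : α.L →* α.CrossedProduct).comp
    { toFun := fun s => α.δ s (α.unit s) (α.unit_idem s)
      map_one' := Subtype.ext (by
        change Finsupp.single (1 : S) (α.unit 1) = Finsupp.single 1 1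
        rw [α.unit_one])
      map_mul' := fun s t => Subtype.ext (by
        refine Eq.trans ?_ (α.lmul_single s t _ _).symm
        change Finsupp.single (s * t) (α.unit (s * t)) = _
        rw [act_unit, ← act_unit, unit_mul_act]) }


lemma Γ_mul_ι (s : S) (a : A) : α.Γ s * α.ι a = α.ι (α.act s a) * α.Γ s := by
  refine congrArg α.toCrossed (Subtype.ext ?_ :
    α.δ s (α.unit s) (α.unit_idem s) * α.δ 1 a (by rw [α.unit_one, one_mul]) =
      α.δ 1 (α.act s a) (by rw [α.unit_one, one_mul]) * α.δ s (α.unit s) (α.unit_idem s))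
  refine (α.lmul_single s 1 _ _).trans (Eq.trans ?_ (α.lmul_single 1 s _ _).symm)
  rw [mul_one, one_mul, act_unit, one_mul, α.unit_central]

lemma Γ_inv_mul_ι_act (s : S) (a : A) : α.Γ s⁻¹ * α.ι (α.act s a) = α.ι a * α.Γ s⁻¹ := by
  rw [Γ_mul_ι, act_inv_act, α.unit_central, map_mul, mul_assoc]
  congr 1
  refine congrArg α.toCrossed (Subtype.ext ?_ :
    α.δ 1 (α.unit s⁻¹) (by rw [α.unit_one, one_mul]) * α.δ s⁻¹ (α.unit s⁻¹) (α.unit_idem s⁻¹) =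
      α.δ s⁻¹ (α.unit s⁻¹) (α.unit_idem s⁻¹))
  refine (α.lmul_single 1 s⁻¹ _ _).trans ?_
  rw [one_mul, act_unit, one_mul, α.unit_idem]; rfl

end UnitalAction

/-! ### Tensor products over a noncommutative algebra, Tor, and Hochschild homology -/

section BalancedTensor

variable (K R : Type u) [CommRing K] [Ring R] (X : Type u) [AddCommGroup X] [Module K X]
  [Module Rᵐᵒᵖ X] [SMulCommClass K Rᵐᵒᵖ X] (Y : Type u) [AddCommGroup Y] [Module R Y]

/-- The relations `x r ⊗ y = x ⊗ r y`. -/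
def balancedRel : Submodule K (X ⊗[ℤ] Y) :=
  Submodule.span K {z | ∃ (x : X) (r : R) (y : Y), z = (op r • x) ⊗ₜ[ℤ] y - x ⊗ₜ[ℤ] (r • y)}

/-- The tensor product `X ⊗_R Y` of a `K`-`R`-bimodule `X` (its right `R`-module structure is a
`Rᵐᵒᵖ`-module structure) and a left `R`-module `Y`, as a `K`-module. -/
abbrev BalancedTensor : Type u := (X ⊗[ℤ] Y) ⧸ balancedRel K R X Y

variable {X Y}

/-- The pure tensor `x ⊗_R y`. -/
def BalancedTensor.mk (x : X) (y : Y) : BalancedTensor K R X Y :=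
  Submodule.Quotient.mk (x ⊗ₜ[ℤ] y)

namespace BalancedTensor

lemma mk_smul (x : X) (r : R) (y : Y) : mk K R (op r • x) y = mk K R x (r • y) :=
  (Submodule.Quotient.eq _).2 (Submodule.subset_span ⟨x, r, y, rfl⟩)

lemma add_mk (x x' : X) (y : Y) : mk K R (x + x') y = mk K R x y + mk K R x' y := by
  rw [mk, TensorProduct.add_tmul]; rfl

lemma mk_add (x : X) (y y' : Y) : mk K R x (y + y') = mk K R x y + mk K R x y' := by
  rw [mk, TensorProduct.tmul_add]; rfl

lemma zero_mk (y : Y) : mk K R (0 : X) y = 0 := by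
  rw [mk, TensorProduct.zero_tmul]; rfl

lemma mk_zero (x : X) : mk K R x (0 : Y) = 0 := by
  rw [mk, TensorProduct.tmul_zero]; rfl

variable {K R}

lemma induction {p : BalancedTensor K R X Y → Prop} (z : BalancedTensor K R X Y)
    (hmk : ∀ x y, p (mk K R x y)) (hadd : ∀ z w, p z → p w → p (z + w)) : p z := by
  obtain ⟨z, rfl⟩ := Submodule.Quotient.mk_surjective _ z
  induction z using TensorProduct.induction_on with
  | zero =>
    have h := hmk (0 : X) (0 : Y)
    rw [zero_mk] at h
    exact h
  | tmul x y => exact hmk x y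
  | add z w hz hw => exact hadd _ _ hz hw

variable {R' : Type u} [Ring R'] {X' : Type u} [AddCommGroup X'] [Module K X']
  [Module R'ᵐᵒᵖ X'] [SMulCommClass K R'ᵐᵒᵖ X'] {Y' : Type u} [AddCommGroup Y'] [Module R' Y']

/-- The map `x ⊗ y ↦ f x ⊗ g y`, for `f` and `g` such that this is balanced. -/
def map (f : X →ₗ[K] X') (g : Y →+ Y')
    (h : ∀ x (r : R) y, mk K R' (f (op r • x)) (g y) = mk K R' (f x) (g (r • y))) :
    BalancedTensor K R X Y →ₗ[K] BalancedTensor K R' X' Y' :=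
  Submodule.mapQ _ _ (TensorProduct.AlgebraTensorModule.map f g.toIntLinearMap) (by
    rw [balancedRel, Submodule.span_le]
    rintro _ ⟨x, r, y, rfl⟩
    rw [SetLike.mem_coe, Submodule.mem_comap, map_sub]
    exact (Submodule.Quotient.eq _).1 (h x r y))

lemma map_mk (f : X →ₗ[K] X') (g : Y →+ Y')
    (h : ∀ x (r : R) y, mk K R' (f (op r • x)) (g y) = mk K R' (f x) (g (r • y)))
    (x : X) (y : Y) : map f g h (mk K R x y) = mk K R' (f x) (g y) := rfl

lemma hom_ext {P : Type*} [AddCommGroup P] [Module K P] {f g : BalancedTensor K R X Y →ₗ[K] P}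
    (h : ∀ x y, f (mk K R x y) = g (mk K R x y)) : f = g := by
  refine LinearMap.ext fun z => ?_
  induction z using BalancedTensor.induction with
  | hmk x y => exact h x y
  | hadd z w hz hw => rw [map_add, map_add, hz, hw]

end BalancedTensor

variable (X)

/-- The functor `X ⊗_R - : R-Mod → K-Mod`. -/
def tensorFunctor : ModuleCat.{u} R ⥤ ModuleCat.{u} K where
  obj Y := ModuleCat.of K (BalancedTensor K R X Y)
  map g := ModuleCat.ofHom (BalancedTensor.map LinearMap.id g.hom.toAddMonoidHom (fun x r y => by
    change BalancedTensor.mk K R (op r • x) (g.hom y) = BalancedTensor.mk K R x (g.hom (r • y))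
    rw [BalancedTensor.mk_smul, map_smul]))
  map_id Y := by
    ext1
    exact BalancedTensor.hom_ext fun x y => rfl
  map_comp f g := by
    ext1
    exact BalancedTensor.hom_ext fun x y => rfl

instance : (tensorFunctor K R X).Additive where
  map_add {Y Z f g} := by
    ext1
    exact BalancedTensor.hom_ext fun x y => BalancedTensor.mk_add K R x (f.hom y) (g.hom y)

/-- `Tor_n^R(X, -)`, the `n`-th left derived functor of `X ⊗_R -`. -/
def torFunctor (n : ℕ) : ModuleCat.{u} R ⥤ ModuleCat.{u} K :=
  (tensorFunctor K R X).leftDerived n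

end BalancedTensor

section Hochschild

variable (K R : Type u) [CommRing K] [Ring R] [Algebra K R]

/-- The enveloping algebra `R^e = R ⊗_K R^op`; a `K`-`R`-bimodule is a left `R^e`-module through
`(a ⊗ b) x = a x b`. -/
abbrev Env : Type u := R ⊗[K] Rᵐᵒᵖ

lemma envRight_commute (a : R) (b : Rᵐᵒᵖ) :
    Commute ((AlgHom.opComm.symm (Algebra.lsmul K K R : Rᵐᵒᵖ →ₐ[K] Module.End K R)) a)
      ((AlgHom.op (Algebra.lmul K R)) b) :=
  congrArg op (LinearMap.ext fun x => by simp [mul_assoc])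

/-- The right `R^e`-action on `R`, `x (a ⊗ b) = b x a`; see `op_tmul_smul`. -/
def envRightAction : (Env K R)ᵐᵒᵖ →ₐ[K] Module.End K R :=
  AlgHom.opComm (Algebra.TensorProduct.lift
    (AlgHom.opComm.symm (Algebra.lsmul K K R : Rᵐᵒᵖ →ₐ[K] Module.End K R))
    (AlgHom.op (Algebra.lmul K R))
    (envRight_commute K R))

instance envRightModule : Module (Env K R)ᵐᵒᵖ R :=
  Module.compHom R (envRightAction K R).toRingHom

lemma env_op_smul_def (r : (Env K R)ᵐᵒᵖ) (x : R) : r • x = envRightAction K R r x := rfl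

lemma op_tmul_smul (a b x : R) : op (a ⊗ₜ[K] op b) • x = b * x * a := by
  rw [env_op_smul_def]
  have h : envRightAction K R (op (a ⊗ₜ[K] op b)) =
      unop ((AlgHom.opComm.symm (Algebra.lsmul K K R : Rᵐᵒᵖ →ₐ[K] Module.End K R)) a *
        (AlgHom.op (Algebra.lmul K R)) (op b)) :=
    congrArg unop (Algebra.TensorProduct.lift_tmul _ _ (envRight_commute K R) a (op b))
  rw [h, mul_assoc]
  rfl

instance : SMulCommClass K (Env K R)ᵐᵒᵖ R where
  smul_comm k r x := ((envRightAction K R r).map_smul k x).symm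

/-- The Hochschild homology `H_n(R, M) = Tor_n^{R^e}(R, M)`. -/
def hochschildHomology (n : ℕ) (M : ModuleCat.{u} (Env K R)) : ModuleCat.{u} K :=
  (torFunctor K (Env K R) R n).obj M

end Hochschild

/-! ### Homology of an inverse monoid -/

section InverseMonoidHomology

variable (K S : Type u) [CommRing K] [InverseMonoid S]

/-- The free `K`-module `KE(S)` on the idempotents of `S`. -/
abbrev KE : Type u := Idem S →₀ K

/-- The right action of `KS` on `KE(S)`, `e · s = s⁻¹ e s`. -/
def trivialAction : (MonoidAlgebra K S)ᵐᵒᵖ →ₐ[K] Module.End K (KE K S) :=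
  AlgHom.opComm (MonoidAlgebra.lift K _ S
    { toFun := fun s => op (Finsupp.lmapDomain K K
        (fun e : Idem S => (⟨s⁻¹ * e.1 * s, conj_idem s e.2⟩ : Idem S)))
      map_one' := by
        apply unop_injective
        ext e : 1
        ext
        simp [inv_one']
      map_mul' := fun s t => by
        apply unop_injective
        ext e : 1
        ext
        simp [mul_inv_rev', mul_assoc] })

instance trivialModule : Module (MonoidAlgebra K S)ᵐᵒᵖ (KE K S) :=
  Module.compHom (KE K S) (trivialAction K S).toRingHom

lemma trivial_op_smul_def (r : (MonoidAlgebra K S)ᵐᵒᵖ) (x : KE K S) :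
    r • x = trivialAction K S r x := rfl

lemma op_of_smul_single (s : S) (e : Idem S) :
    op (MonoidAlgebra.of K S s) • (Finsupp.single e 1 : KE K S) =
      Finsupp.single ⟨s⁻¹ * e.1 * s, conj_idem s e.2⟩ 1 := by
  rw [trivial_op_smul_def]
  simp [trivialAction]

instance : SMulCommClass K (MonoidAlgebra K S)ᵐᵒᵖ (KE K S) where
  smul_comm k r x := ((trivialAction K S r).map_smul k x).symm

/-- The homology `H_n(S, V) = Tor_n^{KS}(KE(S), V)` of `S` with values in a `KS`-module `V`. -/
def inverseMonoidHomology (n : ℕ) (V : ModuleCat.{u} (MonoidAlgebra K S)) : ModuleCat.{u} K :=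
  (torFunctor K (MonoidAlgebra K S) (KE K S) n).obj V

end InverseMonoidHomology

/-! ### The functor `F₁ = A ⊗_{A^e} -` -/

namespace UnitalAction

variable {K A S : Type u} [CommRing K] [Ring A] [Algebra K A] [InverseMonoid S]
  (α : UnitalAction K A S)

/-- The algebra homomorphism `A^e → (A ⋊_θ S)^e` induced by `A → A ⋊_θ S`. -/
def envMap : Env K A →ₐ[K] Env K α.CrossedProduct :=
  Algebra.TensorProduct.map α.ι (AlgHom.op α.ι)

/-- Restriction of scalars: an `A ⋊_θ S`-bimodule as an `A`-bimodule. -/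
abbrev restrict (M : ModuleCat.{u} (Env K α.CrossedProduct)) : ModuleCat.{u} (Env K A) :=
  (ModuleCat.restrictScalars α.envMap.toRingHom).obj M

/-- The homomorphism `S → (A ⋊_θ S)^e`, `s ↦ Γ s ⊗ Γ s⁻¹`; through it `S` acts on an
`A ⋊_θ S`-bimodule `M` by `s · x = (1ₛ δₛ) x (1_{s⁻¹} δ_{s⁻¹})`. -/
def conj : S →* Env K α.CrossedProduct where
  toFun s := α.Γ s ⊗ₜ[K] op (α.Γ s⁻¹)
  map_one' := by rw [inv_one', map_one]; rfl
  map_mul' s t := by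
    rw [Algebra.TensorProduct.tmul_mul_tmul, ← op_mul, ← map_mul, ← map_mul, mul_inv_rev']

lemma conj_mul_envMap (s : S) (a b : A) :
    α.conj s * α.envMap (a ⊗ₜ op b) = α.envMap (α.act s a ⊗ₜ op (α.act s b)) * α.conj s := by
  change (α.Γ s ⊗ₜ[K] op (α.Γ s⁻¹)) * (α.ι a ⊗ₜ[K] op (α.ι b)) =
    (α.ι (α.act s a) ⊗ₜ[K] op (α.ι (α.act s b))) * (α.Γ s ⊗ₜ[K] op (α.Γ s⁻¹))
  rw [Algebra.TensorProduct.tmul_mul_tmul, Algebra.TensorProduct.tmul_mul_tmul, ← op_mul,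
    ← op_mul, Γ_mul_ι, Γ_inv_mul_ι_act]

/-- The map `x ↦ s · x` on an `A ⋊_θ S`-bimodule `M`. -/
def conjHom (M : ModuleCat.{u} (Env K α.CrossedProduct)) (s : S) :
    α.restrict M →+ α.restrict M :=
  DistribSMul.toAddMonoidHom M (α.conj s)

lemma conjHom_apply (M : ModuleCat.{u} (Env K α.CrossedProduct)) (s : S) (x : α.restrict M) :
    α.conjHom M s x = (α.conj s • (show M from x) : M) := rfl

lemma conjHom_one (M : ModuleCat.{u} (Env K α.CrossedProduct)) (x : α.restrict M) :
    α.conjHom M 1 x = x := by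
  rw [conjHom_apply, map_one, one_smul]

lemma conjHom_mul (M : ModuleCat.{u} (Env K α.CrossedProduct)) (s t : S) (x : α.restrict M) :
    α.conjHom M (s * t) x = α.conjHom M s (α.conjHom M t x) := by
  rw [conjHom_apply, map_mul, mul_smul]; rfl

lemma conjHom_smul (M : ModuleCat.{u} (Env K α.CrossedProduct)) (s : S) (a b : A)
    (x : α.restrict M) : α.conjHom M s ((a ⊗ₜ[K] op b : Env K A) • x) =
      (α.act s a ⊗ₜ[K] op (α.act s b) : Env K A) • α.conjHom M s x := by
  have h2 : α.conj s • (α.envMap (a ⊗ₜ[K] op b) • (show M from x)) =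
      α.envMap (α.act s a ⊗ₜ[K] op (α.act s b)) • (α.conj s • (show M from x)) := by
    rw [← mul_smul, ← mul_smul, ← conj_mul_envMap]
  exact h2

/-- The underlying `K`-module of `A ⊗_{A^e} M`. -/
abbrev F₁Obj (M : ModuleCat.{u} (Env K α.CrossedProduct)) : Type u :=
  BalancedTensor K (Env K A) A (α.restrict M)

/-- The endomorphism `a ⊗ x ↦ s · a ⊗ s · x` of `A ⊗_{A^e} M`. -/
def diagMap (M : ModuleCat.{u} (Env K α.CrossedProduct)) (s : S) :
    α.F₁Obj M →ₗ[K] α.F₁Obj M :=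
  BalancedTensor.map (α.act s) (α.conjHom M s) (fun x r y => by
    induction r using TensorProduct.induction_on with
    | zero =>
      have h1 : op (0 : Env K A) • x = 0 := zero_smul (Env K A)ᵐᵒᵖ x
      have h2 : (0 : Env K A) • y = 0 := zero_smul (Env K A) y
      rw [h1, h2, map_zero, map_zero, BalancedTensor.zero_mk, BalancedTensor.mk_zero]
    | add r r' h h' =>
      rw [MulOpposite.op_add, add_smul, add_smul, map_add, map_add, BalancedTensor.add_mk,
        BalancedTensor.mk_add, h, h']
    | tmul a b =>
      rw [← op_unop b, op_tmul_smul, act_mul, act_mul, conjHom_smul, ← BalancedTensor.mk_smul,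
        op_tmul_smul])

/-- The action of `S` on `A ⊗_{A^e} M` by `s · (a ⊗ x) = s · a ⊗ s · x`. -/
def diagAction (M : ModuleCat.{u} (Env K α.CrossedProduct)) :
    S →* Module.End K (α.F₁Obj M) where
  toFun := α.diagMap M
  map_one' := BalancedTensor.hom_ext fun a x => by
    change BalancedTensor.mk K (Env K A) (α.act 1 a) (α.conjHom M 1 x) = _
    rw [map_one, conjHom_one]; rfl
  map_mul' s t := BalancedTensor.hom_ext fun a x => by
    change BalancedTensor.mk K (Env K A) (α.act (s * t) a) (α.conjHom M (s * t) x) = _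
    rw [map_mul, conjHom_mul]; rfl

instance diagModule (M : ModuleCat.{u} (Env K α.CrossedProduct)) :
    Module (MonoidAlgebra K S) (α.F₁Obj M) :=
  Module.compHom (α.F₁Obj M) (MonoidAlgebra.lift K _ S (α.diagAction M)).toRingHom

lemma diag_smul_def (M : ModuleCat.{u} (Env K α.CrossedProduct)) (r : MonoidAlgebra K S)
    (z : α.F₁Obj M) : r • z = MonoidAlgebra.lift K _ S (α.diagAction M) r z := rfl

lemma of_smul_mk (M : ModuleCat.{u} (Env K α.CrossedProduct)) (s : S) (a : A)
    (x : α.restrict M) :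
    MonoidAlgebra.of K S s • (BalancedTensor.mk K (Env K A) a x : α.F₁Obj M) =
      BalancedTensor.mk K (Env K A) (α.act s a) (α.conjHom M s x) := by
  rw [diag_smul_def, MonoidAlgebra.lift_of]; rfl

/-- The homomorphism of `A`-bimodules underlying a homomorphism of `A ⋊_θ S`-bimodules. -/
abbrev restrictMap {M N : ModuleCat.{u} (Env K α.CrossedProduct)} (f : M ⟶ N) :
    α.restrict M ⟶ α.restrict N :=
  (ModuleCat.restrictScalars α.envMap.toRingHom).map f

lemma restrictMap_conjHom {M N : ModuleCat.{u} (Env K α.CrossedProduct)} (f : M ⟶ N) (s : S)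
    (x : α.restrict M) :
    (α.restrictMap f).hom (α.conjHom M s x) = α.conjHom N s ((α.restrictMap f).hom x) :=
  f.hom.map_smul (α.conj s) (show M from x)

/-- The `K`-linear map `a ⊗ x ↦ a ⊗ f x` from `A ⊗_{A^e} M` to `A ⊗_{A^e} N` induced by a
homomorphism `f` of bimodules. -/
def F₁MapAux {M N : ModuleCat.{u} (Env K α.CrossedProduct)} (f : M ⟶ N) :
    α.F₁Obj M →ₗ[K] α.F₁Obj N :=
  ((tensorFunctor K (Env K A) A).map (α.restrictMap f)).hom

lemma F₁MapAux_mk {M N : ModuleCat.{u} (Env K α.CrossedProduct)} (f : M ⟶ N) (a : A)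
    (x : α.restrict M) : α.F₁MapAux f (BalancedTensor.mk K (Env K A) a x) =
      BalancedTensor.mk K (Env K A) a ((α.restrictMap f).hom x) := rfl

lemma F₁MapAux_of_smul {M N : ModuleCat.{u} (Env K α.CrossedProduct)} (f : M ⟶ N)
    (s : S) (z : α.F₁Obj M) :
    α.F₁MapAux f (α.diagAction M s z) = α.diagAction N s (α.F₁MapAux f z) := by
  refine LinearMap.congr_fun (f := α.F₁MapAux f ∘ₗ α.diagAction M s)
    (g := α.diagAction N s ∘ₗ α.F₁MapAux f) (BalancedTensor.hom_ext fun a x => ?_) z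
  change BalancedTensor.mk K (Env K A) (α.act s a) ((α.restrictMap f).hom (α.conjHom M s x)) =
    BalancedTensor.mk K (Env K A) (α.act s a) (α.conjHom N s ((α.restrictMap f).hom x))
  rw [restrictMap_conjHom]

lemma F₁MapAux_smul {M N : ModuleCat.{u} (Env K α.CrossedProduct)} (f : M ⟶ N)
    (r : MonoidAlgebra K S) (z : α.F₁Obj M) :
    α.F₁MapAux f (r • z) = r • α.F₁MapAux f z := by
  rw [diag_smul_def, diag_smul_def]
  induction r using MonoidAlgebra.induction_on with
  | of s => rw [MonoidAlgebra.lift_of, MonoidAlgebra.lift_of, F₁MapAux_of_smul]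
  | add r r' h h' => rw [map_add, map_add, LinearMap.add_apply, LinearMap.add_apply, map_add, h, h']
  | smul k r h =>
    rw [map_smul, map_smul, LinearMap.smul_apply, LinearMap.smul_apply, map_smul, h]

/-- The `KS`-linear map `A ⊗_{A^e} M → A ⊗_{A^e} N` induced by a homomorphism of bimodules. -/
def F₁Map {M N : ModuleCat.{u} (Env K α.CrossedProduct)} (f : M ⟶ N) :
    α.F₁Obj M →ₗ[MonoidAlgebra K S] α.F₁Obj N where
  toFun := α.F₁MapAux f
  map_add' := map_add _
  map_smul' := α.F₁MapAux_smul f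

lemma F₁Map_ext {M N : ModuleCat.{u} (Env K α.CrossedProduct)}
    {f g : α.F₁Obj M →ₗ[MonoidAlgebra K S] α.F₁Obj N}
    (h : ∀ (a : A) (x : α.restrict M),
      f (BalancedTensor.mk K (Env K A) a x) = g (BalancedTensor.mk K (Env K A) a x)) : f = g := by
  refine LinearMap.ext fun z => ?_
  induction z using BalancedTensor.induction with
  | hmk x y => exact h x y
  | hadd z w hz hw => rw [map_add, map_add, hz, hw]

/-- The functor `F₁ = A ⊗_{A^e} - : (A ⋊_θ S)^e-Mod → KS-Mod`. -/
def F₁ : ModuleCat.{u} (Env K α.CrossedProduct) ⥤ ModuleCat.{u} (MonoidAlgebra K S) where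
  obj M := ModuleCat.of (MonoidAlgebra K S) (α.F₁Obj M)
  map f := ModuleCat.ofHom (α.F₁Map f)
  map_id _ := ModuleCat.hom_ext (α.F₁Map_ext fun _ _ => rfl)
  map_comp _ _ := ModuleCat.hom_ext (α.F₁Map_ext fun _ _ => rfl)

instance : α.F₁.Additive where
  map_add {_ _ f g} := ModuleCat.hom_ext (α.F₁Map_ext fun a x =>
    BalancedTensor.mk_add K (Env K A) a ((α.restrictMap f).hom x) ((α.restrictMap g).hom x))

end UnitalAction

/-! ### First quadrant homology spectral sequences -/

/-- A first quadrant homology spectral sequence `(E^r, d^r)`, `r ≥ 2`, of `K`-modules, with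
differentials `d^r : E^r_{p,q} → E^r_{p-r,q+r-1}`. -/
abbrev FirstQuadrantHomologySS (K : Type u) [CommRing K] :=
  SpectralSequence (ModuleCat.{u} K)
    (fun r : ℤ => ComplexShape.spectralSequenceNat (⟨-r, r - 1⟩ : ℤ × ℤ)) 2

/-- Convergence `E^2_{p,q} ⇒ H_{p+q}`: every `H n` has a filtration
`0 = Φ_{-1} ⊆ Φ_0 ⊆ ⋯ ⊆ Φ_n = H n` with `Φ_p / Φ_{p-1} ≅ E^∞_{p,q}` for `p + q = n`. As no
nonzero differential enters or leaves `E^r_{p,q}` when `r > max p (q + 1)`, the limit term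
`E^∞_{p,q}` is `E^r_{p,q}` for any such `r`. -/
def FirstQuadrantHomologySS.ConvergesTo {K : Type u} [CommRing K]
    (E : FirstQuadrantHomologySS K) (H : ℕ → ModuleCat.{u} K) : Prop :=
  ∃ Φ : (n : ℕ) → ℤ → Submodule K (H n),
    (∀ n, Monotone (Φ n)) ∧
    (∀ n p, p < 0 → Φ n p = ⊥) ∧
    (∀ (n : ℕ) (p : ℤ), (n : ℤ) ≤ p → Φ n p = ⊤) ∧
    ∀ (p q : ℕ) (r : ℤ) (hr : 2 ≤ r), (p : ℤ) < r → (q : ℤ) + 1 < r →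
      Nonempty ((E.page r hr).X (p, q) ≃ₗ[K]
        (↥(Φ (p + q) p) ⧸ (Φ (p + q) (p - 1)).submoduleOf (Φ (p + q) p)))

end

/-!
Write `B` for the crossed product. Both `KE(S) ⊗_{KS} (A ⊗_{Aᵉ} M)` and `B ⊗_{Bᵉ} M` are the
quotient of `M` by its commutators with `B`, so Hochschild homology of `B` is the left derived
functor of a composite, and the spectral sequence is Grothendieck's once `F₁` is known to send free
bimodules to modules which are acyclic for `KE(S) ⊗_{KS} -`.

`F₁` of a free bimodule is a retract of a module `KS ⊗_{KE} U` induced from the commutative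
algebra `KE` of the monoid `E(S)`. This algebra is generated by idempotents, hence von Neumann
regular, so that all modules over it are flat and induction to `KS` is exact. Induction also
preserves projectives, and `KE(S) ⊗_{KS} (KS ⊗_{KE} U) ≅ U` is exact in `U`: the higher derived
functors of `KE(S) ⊗_{KS} -` vanish on induced modules, and on their retracts.

A free resolution of a module over an algebra over a field can be chosen functorial and exact in the
module, as `R ⊗_K V` is both. Applied to the terms of a complex it gives a double complex whose
columns have the homology of the complex resolved again, and no Cartan-Eilenberg resolution is
needed.
-/

noncomputable section

open InverseMonoid TensorProduct MulOpposite

/-! ### The spectral sequence of a filtered differential module -/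

/-- The homology of a short complex of modules, computed by a module `N` of representatives whose
image, together with the boundaries, exhausts the cycles. -/
def homologyIsoQuotient {K : Type u} [Ring K] (C : ShortComplex (ModuleCat.{u} K))
    {N : Type u} [AddCommGroup N] [Module K N] (φ : N →ₗ[K] C.X₂) (N' : Submodule K N)
    (cycle : ∀ n, C.g (φ n) = 0) (surj : ∀ x, C.g x = 0 → ∃ n y, x = φ n + C.f y)
    (mem_iff : ∀ n, n ∈ N' ↔ ∃ y, C.f y = φ n) :
    C.homology ≅ ModuleCat.of K (N ⧸ N') :=
  let ψ : N →ₗ[K] LinearMap.ker C.g.hom ⧸ LinearMap.range C.moduleCatToCycles :=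
    (LinearMap.range C.moduleCatToCycles).mkQ ∘ₗ φ.codRestrict (LinearMap.ker C.g.hom) cycle
  have hψ : Function.Surjective ψ := by
    intro z
    obtain ⟨⟨x, hx⟩, rfl⟩ := Submodule.Quotient.mk_surjective _ z
    obtain ⟨n, y, rfl⟩ := surj x hx
    refine ⟨n, (Submodule.Quotient.eq _).2 ⟨-y, Subtype.ext ?_⟩⟩
    change C.f.hom (-y) = φ n - (φ n + C.f.hom y)
    rw [map_neg]
    abel
  have hker : N' = LinearMap.ker ψ := by
    ext n
    rw [LinearMap.mem_ker, mem_iff]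
    refine Iff.trans ?_ (Submodule.Quotient.mk_eq_zero _).symm
    exact ⟨fun ⟨y, hy⟩ => ⟨y, Subtype.ext hy⟩, fun ⟨y, hy⟩ => ⟨y, congrArg Subtype.val hy⟩⟩
  C.moduleCatHomologyIso ≪≫
    ((Submodule.quotEquivOfEq _ _ hker).trans (ψ.quotKerEquivOfSurjective hψ)).symm.toModuleIso

/-- A differential module `T` with an increasing filtration in each degree: `fil p n` is the part
of filtration `≤ p` in degree `n`. The filtration is concentrated in the first quadrant: it is zero
for `p < 0` and exhausts degree `n` at `p = n`. -/
structure FilteredDifferential (K : Type u) [CommRing K] (T : Type u) [AddCommGroup T]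
    [Module K T] where
  d : T →ₗ[K] T
  d_d : ∀ x, d (d x) = 0
  fil : ℤ → ℤ → Submodule K T
  mono : ∀ {p p' : ℤ} (n : ℤ), p ≤ p' → fil p n ≤ fil p' n
  d_mem : ∀ {p n : ℤ} {x : T}, x ∈ fil p n → d x ∈ fil p (n - 1)
  neg : ∀ {p : ℤ} (n : ℤ), p < 0 → fil p n = ⊥
  top : ∀ {p n : ℤ}, n ≤ p → fil p n = fil n n

namespace FilteredDifferential

variable {K : Type u} [CommRing K] {T : Type u} [AddCommGroup T] [Module K T]
  (D : FilteredDifferential K T)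

lemma eq_zero_of_mem_fil {p n : ℤ} (hp : p < 0) {x : T} (hx : x ∈ D.fil p n) : x = 0 := by
  rwa [D.neg n hp, Submodule.mem_bot] at hx

lemma mem_fil_of_le {p p' n : ℤ} (hn : n ≤ p') {x : T} (hx : x ∈ D.fil p n) :
    x ∈ D.fil p' n := by
  rcases le_total p p' with h | h
  · exact D.mono n h hx
  · rwa [D.top hn, ← D.top (hn.trans h)]

/-- The elements of filtration `≤ p` in degree `n` that are cycles up to filtration `p - r`. -/
def Z (r p n : ℤ) : Submodule K T := D.fil p n ⊓ (D.fil (p - r) (n - 1)).comap D.d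

/-- The elements of `Z r p n` that vanish on the `r`-th page. -/
def B (r p n : ℤ) : Submodule K T :=
  D.Z (r - 1) (p - 1) n ⊔ (D.Z (r - 1) (p + r - 1) (n + 1)).map D.d

lemma mem_Z {r p n : ℤ} {x : T} :
    x ∈ D.Z r p n ↔ x ∈ D.fil p n ∧ D.d x ∈ D.fil (p - r) (n - 1) := Iff.rfl

lemma mem_B {r p n : ℤ} {x : T} : x ∈ D.B r p n ↔
    ∃ y ∈ D.Z (r - 1) (p - 1) n, ∃ z ∈ D.Z (r - 1) (p + r - 1) (n + 1), y + D.d z = x := by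
  simp only [B, Submodule.mem_sup, Submodule.mem_map, exists_exists_and_eq_and]

lemma mem_Z_of_d_eq_zero {r p n : ℤ} {x : T} (hx : x ∈ D.fil p n) (h : D.d x = 0) :
    x ∈ D.Z r p n :=
  D.mem_Z.2 ⟨hx, h ▸ zero_mem _⟩

lemma d_eq_zero_of_mem_Z {r p n : ℤ} (h : p < r) {x : T} (hx : x ∈ D.Z r p n) : D.d x = 0 :=
  D.eq_zero_of_mem_fil (by lia) hx.2

lemma Z_le_Z {r r' p p' : ℤ} (n : ℤ) (h : p' ≤ p) (h' : p' - r' ≤ p - r) :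
    D.Z r' p' n ≤ D.Z r p n :=
  fun _ hx => ⟨D.mono n h hx.1, D.mono (n - 1) h' hx.2⟩

lemma Z_sub_one_le_B (r p n : ℤ) : D.Z (r - 1) (p - 1) n ≤ D.B r p n := le_sup_left

lemma d_mem_B_of_mem_Z {r p n p' n' : ℤ} (hp : p + r - 1 = p') (hn : n + 1 = n') {x : T}
    (hx : x ∈ D.Z (r - 1) p' n') : D.d x ∈ D.B r p n := by
  subst hp hn
  exact Submodule.mem_sup_right ⟨x, hx, rfl⟩

lemma d_mem_Z {r p n p' n' : ℤ} (hp : p - r = p') (hn : n - 1 = n') {x : T}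
    (hx : x ∈ D.Z r p n) : D.d x ∈ D.Z r p' n' := by
  subst hp hn
  exact D.mem_Z_of_d_eq_zero hx.2 (D.d_d x)

lemma d_mem_B {r p n p' n' : ℤ} (hp : p - r = p') (hn : n - 1 = n') {x : T}
    (hx : x ∈ D.B r p n) : D.d x ∈ D.B r p' n' := by
  obtain ⟨y, hy, z, -, rfl⟩ := D.mem_B.1 hx
  rw [map_add, D.d_d, add_zero]
  exact D.d_mem_B_of_mem_Z (by lia) (by lia) hy

lemma d_mem_B_iff {r p n p' n' : ℤ} (hp : p - r = p') (hn : n - 1 = n') {x : T}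
    (hx : x ∈ D.Z r p n) : D.d x ∈ D.B r p' n' ↔ ∃ y ∈ D.Z (r + 1) p n, x - y ∈ D.B r p n := by
  constructor
  · intro h
    obtain ⟨u, hu, v, hv, huv⟩ := D.mem_B.1 h
    subst hp hn
    rw [show p - r + r - 1 = p - 1 by ring, sub_add_cancel] at hv
    refine ⟨x - v, D.mem_Z.2 ⟨sub_mem hx.1 (D.mono n (by lia) hv.1), ?_⟩, ?_⟩
    · rw [map_sub, ← huv, add_sub_cancel_right]
      exact D.mono _ (by lia) hu.1
    · rw [sub_sub_cancel]
      exact D.Z_sub_one_le_B r p n hv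
  · rintro ⟨y, hy, hxy⟩
    rw [← sub_add_cancel x y, map_add]
    subst hp hn
    refine add_mem (D.d_mem_B rfl rfl hxy) (D.Z_sub_one_le_B _ _ _ ?_)
    exact D.mem_Z_of_d_eq_zero (D.mono _ (by lia) hy.2) (D.d_d y)

lemma mem_B_succ_iff {r p n : ℤ} {x : T} (hx : x ∈ D.Z (r + 1) p n) :
    x ∈ D.B (r + 1) p n ↔ ∃ y ∈ D.Z r (p + r) (n + 1), D.d y - x ∈ D.B r p n := by
  constructor
  · intro h
    obtain ⟨u, hu, v, hv, rfl⟩ := D.mem_B.1 h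
    refine ⟨v, D.Z_le_Z _ (by lia) (by lia) hv, ?_⟩
    rw [sub_add_cancel_right, neg_mem_iff]
    exact D.Z_sub_one_le_B _ _ _ (D.Z_le_Z _ (by lia) (by lia) hu)
  · rintro ⟨y, hy, h⟩
    obtain ⟨u, hu, v, hv, huv⟩ := D.mem_B.1 h
    have hyv : y - v ∈ D.Z (r + 1 - 1) (p + (r + 1) - 1) (n + 1) :=
      sub_mem (D.Z_le_Z _ (by lia) (by lia) hy) (D.Z_le_Z _ (by lia) (by lia) hv)
    have hx' : -u + D.d (y - v) = x := by
      rw [map_sub, ← sub_sub_self (D.d y) x, ← huv]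
      abel
    have hdu : D.d (-u) = D.d x := by rw [← hx', map_add, D.d_d, add_zero]
    refine D.mem_B.2 ⟨-u, D.mem_Z.2 ⟨neg_mem hu.1, ?_⟩, y - v, hyv, hx'⟩
    rw [hdu]
    exact D.mono _ (by lia) hx.2

lemma mem_B_succ_iff_of_le {r p n : ℤ} (h : n + 2 ≤ p + r) {x : T} (hx : x ∈ D.Z (r + 1) p n) :
    x ∈ D.B (r + 1) p n ↔ x ∈ D.B r p n := by
  rw [D.mem_B_succ_iff hx]
  constructor
  · rintro ⟨y, hy, hyx⟩
    rw [← sub_sub_self (D.d y) x]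
    refine sub_mem (D.d_mem_B_of_mem_Z rfl rfl ⟨D.mem_fil_of_le (by lia) hy.1, ?_⟩) hyx
    exact D.mono _ (by lia) hy.2
  · intro hx
    exact ⟨0, zero_mem _, by rwa [map_zero, zero_sub, neg_mem_iff]⟩

/-- The term of filtration `p` and degree `n` on the `r`-th page. The page is bigraded by `p` and
`q = n - p` only in `FilteredDifferential.page`. -/
abbrev E (r p n : ℤ) : Type u := ↥(D.Z r p n) ⧸ (D.B r p n).submoduleOf (D.Z r p n)

/-- The class on the `r`-th page of an element of `Z r p n`. -/
def E.mk (r p n : ℤ) : ↥(D.Z r p n) →ₗ[K] D.E r p n := Submodule.mkQ _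

lemma E.mk_surjective (r p n : ℤ) : Function.Surjective (E.mk D r p n) :=
  Submodule.mkQ_surjective _

lemma E.mk_eq_zero_iff {r p n : ℤ} (x : D.Z r p n) : E.mk D r p n x = 0 ↔ (x : T) ∈ D.B r p n :=
  Submodule.Quotient.mk_eq_zero _

lemma E.mk_eq_mk_iff {r p n : ℤ} (x y : D.Z r p n) :
    E.mk D r p n x = E.mk D r p n y ↔ (x : T) - y ∈ D.B r p n :=
  Submodule.Quotient.eq _

/-- The differential of the `r`-th page. -/
def dE (r : ℤ) {p n p' n' : ℤ} (hp : p - r = p') (hn : n - 1 = n') :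
    D.E r p n →ₗ[K] D.E r p' n' :=
  Submodule.mapQ _ _ (D.d.restrict fun _ => D.d_mem_Z hp hn) fun _ => D.d_mem_B hp hn

lemma dE_dE (r : ℤ) {p n p' n' p'' n'' : ℤ} (hp : p - r = p') (hn : n - 1 = n')
    (hp' : p' - r = p'') (hn' : n' - 1 = n'') (x : D.E r p n) :
    D.dE r hp' hn' (D.dE r hp hn x) = 0 := by
  obtain ⟨x, rfl⟩ := E.mk_surjective D r p n x
  refine (E.mk_eq_zero_iff D _).2 ?_
  change D.d (D.d x) ∈ D.B r p'' n''
  rw [D.d_d]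
  exact zero_mem _

/-- The shape of the `r`-th page, with differentials of bidegree `(-r, r - 1)`. -/
abbrev pageShape (r : ℤ) : ComplexShape (ℕ × ℕ) :=
  ComplexShape.spectralSequenceNat (⟨-r, r - 1⟩ : ℤ × ℤ)

lemma pageShape_rel_iff {r : ℤ} {a b : ℕ × ℕ} : (pageShape r).Rel a b ↔
    (a.1 : ℤ) - r = b.1 ∧ (a.1 + a.2 : ℤ) - 1 = b.1 + b.2 := by
  change (a.1 : ℤ) + -r = b.1 ∧ (a.2 : ℤ) + (r - 1) = b.2 ↔ _
  lia

/-- The `r`-th page. -/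
def page (r : ℤ) : HomologicalComplex (ModuleCat.{u} K) (pageShape r) :=
  open scoped Classical in
  { X := fun a => ModuleCat.of K (D.E r a.1 (a.1 + a.2))
    d := fun a b => if h : (pageShape r).Rel a b then
      ModuleCat.ofHom (D.dE r (pageShape_rel_iff.1 h).1 (pageShape_rel_iff.1 h).2) else 0
    shape := fun _ _ h => dif_neg h
    d_comp_d' := fun _ _ _ hab hbc => by
      rw [dif_pos hab, dif_pos hbc]
      have hab := pageShape_rel_iff.1 hab
      have hbc := pageShape_rel_iff.1 hbc
      exact ModuleCat.hom_ext (LinearMap.ext (D.dE_dE r hab.1 hab.2 hbc.1 hbc.2)) }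

lemma page_d_mk {r : ℤ} {a b : ℕ × ℕ} (h : (pageShape r).Rel a b)
    (x : D.Z r a.1 (a.1 + a.2)) :
    (D.page r).d a b (E.mk D r a.1 (a.1 + a.2) x) = E.mk D r b.1 (b.1 + b.2)
      ⟨D.d x, D.d_mem_Z (pageShape_rel_iff.1 h).1 (pageShape_rel_iff.1 h).2 x.2⟩ := by
  have hd : (D.page r).d a b = _ := dif_pos h
  rw [hd]
  rfl

lemma page_d_next_mk_eq_zero_iff {r : ℤ} (hr : 1 ≤ r) (a : ℕ × ℕ) (x : D.Z r a.1 (a.1 + a.2)) :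
    (D.page r).d a ((pageShape r).next a) (E.mk D r a.1 (a.1 + a.2) x) = 0 ↔
      ∃ y ∈ D.Z (r + 1) a.1 (a.1 + a.2), (x : T) - y ∈ D.B r a.1 (a.1 + a.2) := by
  by_cases h : ∃ b, (pageShape r).Rel a b
  · obtain ⟨b, hab⟩ := h
    obtain ⟨hp, hn⟩ := pageShape_rel_iff.1 hab
    rw [ComplexShape.next_eq' _ hab, page_d_mk D hab, ← D.d_mem_B_iff hp hn x.2]
    exact E.mk_eq_zero_iff D _
  · have hra : a.1 < r := by
      by_contra!
      refine h ⟨((a.1 - r).toNat, (a.2 + r - 1).toNat), pageShape_rel_iff.2 ?_⟩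
      dsimp only
      lia
    rw [(D.page r).shape _ _ fun hrel => h ⟨_, hrel⟩]
    refine iff_of_true rfl ⟨x, D.mem_Z_of_d_eq_zero x.2.1 (D.d_eq_zero_of_mem_Z hra x.2), ?_⟩
    rw [sub_self]
    exact zero_mem _

lemma exists_page_d_prev_eq_mk_iff {r : ℤ} (hr : 0 ≤ r) (a : ℕ × ℕ)
    (x : D.Z r a.1 (a.1 + a.2)) (hx : (x : T) ∈ D.Z (r + 1) a.1 (a.1 + a.2)) :
    (∃ y, (D.page r).d ((pageShape r).prev a) a y = E.mk D r a.1 (a.1 + a.2) x) ↔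
      (x : T) ∈ D.B (r + 1) a.1 (a.1 + a.2) := by
  by_cases h : ∃ b, (pageShape r).Rel b a
  · obtain ⟨b, hba⟩ := h
    obtain ⟨hp, hn⟩ := pageShape_rel_iff.1 hba
    rw [ComplexShape.prev_eq' _ hba, D.mem_B_succ_iff hx, ← sub_eq_iff_eq_add.1 hp,
      ← sub_eq_iff_eq_add.1 hn]
    refine (E.mk_surjective D r b.1 (b.1 + b.2)).exists.trans (SetLike.exists.trans ?_)
    refine exists_congr fun y => Iff.trans (exists_congr fun hy => ?_) exists_prop
    exact (Eq.congr_left (D.page_d_mk hba ⟨y, hy⟩)).trans (E.mk_eq_mk_iff D _ _)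
  · have hra : a.2 + 1 < r := by
      by_contra!
      refine h ⟨((a.1 + r).toNat, (a.2 + 1 - r).toNat), pageShape_rel_iff.2 ?_⟩
      dsimp only
      lia
    rw [(D.page r).shape _ _ fun hrel => h ⟨_, hrel⟩, D.mem_B_succ_iff_of_le (by lia) hx,
      ← E.mk_eq_zero_iff]
    exact ⟨fun ⟨_, h⟩ => h.symm, fun h => ⟨0, h.symm⟩⟩

/-- The homology of the `r`-th page is the next page. -/
def pageHomologyIso {r : ℤ} (hr : 1 ≤ r) (a : ℕ × ℕ) :
    (D.page r).homology a ≅ (D.page (r + 1)).X a :=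
  have hle : D.Z (r + 1) a.1 (a.1 + a.2) ≤ D.Z r a.1 (a.1 + a.2) := D.Z_le_Z _ le_rfl (by lia)
  homologyIsoQuotient ((D.page r).sc a) (E.mk D r a.1 (a.1 + a.2) ∘ₗ Submodule.inclusion hle) _
    (fun x => (D.page_d_next_mk_eq_zero_iff hr a (Submodule.inclusion hle x)).2
      ⟨x, x.2, by rw [Submodule.coe_inclusion, sub_self]; exact zero_mem _⟩)
    (fun x hx => by
      obtain ⟨x, rfl⟩ := E.mk_surjective D _ _ _ x
      obtain ⟨y, hy, hxy⟩ := (D.page_d_next_mk_eq_zero_iff hr a x).1 hx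
      refine ⟨⟨y, hy⟩, 0, ?_⟩
      rw [map_zero, add_zero]
      exact (E.mk_eq_mk_iff D x (Submodule.inclusion hle ⟨y, hy⟩)).2 hxy)
    (fun x => (D.exists_page_d_prev_eq_mk_iff (by lia) a (Submodule.inclusion hle x) x.2).symm)

/-- The spectral sequence of a filtered differential module. -/
def spectralSequence : FirstQuadrantHomologySS K where
  page r _ := D.page r
  iso r r' a hrr' hr := by
    subst hrr'
    exact D.pageHomologyIso (by lia) a

/-- The cycles of filtration `≤ p` in degree `n`. -/
def cycles (p n : ℤ) : Submodule K T := D.fil p n ⊓ LinearMap.ker D.d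

/-- The boundaries in degree `n`. -/
def boundaries (n : ℤ) : Submodule K T := (D.fil (n + 1) (n + 1)).map D.d

/-- The homology in degree `n`. -/
abbrev homology (n : ℤ) : Type u :=
  ↥(D.cycles n n) ⧸ (D.boundaries n).submoduleOf (D.cycles n n)

lemma cycles_le_cycles (n : ℤ) {p p' : ℤ} (h : p ≤ p') : D.cycles p n ≤ D.cycles p' n :=
  inf_le_inf_right _ (D.mono n h)

lemma Z_eq_cycles {r p n : ℤ} (h : p < r) : D.Z r p n = D.cycles p n :=
  le_antisymm (fun _ hx => ⟨hx.1, D.d_eq_zero_of_mem_Z h hx⟩)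
    fun _ hx => D.mem_Z_of_d_eq_zero hx.1 hx.2

lemma mem_B_iff_of_lt {p n r : ℤ} (hp : p < r) (hn : n + 2 ≤ p + r) {x : T}
    (hx : x ∈ D.cycles p n) :
    x ∈ D.B r p n ↔ ∃ y ∈ D.cycles (p - 1) n, x - y ∈ D.boundaries n := by
  rw [mem_B, Z_eq_cycles D (by lia)]
  refine exists_congr fun y => and_congr_right fun hy => ?_
  constructor
  · rintro ⟨z, hz, rfl⟩
    exact ⟨z, D.mem_fil_of_le le_rfl hz.1, (add_sub_cancel_left _ _).symm⟩
  · rintro ⟨z, hz, hzx⟩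
    refine ⟨z, D.mem_Z.2 ⟨D.mem_fil_of_le (by lia) hz, ?_⟩, add_eq_of_eq_sub' hzx⟩
    rw [hzx, add_sub_cancel_right]
    exact D.mono _ (by lia) (sub_mem hx.1 (D.mono _ (by lia) hy.1))

/-- The filtration on the homology in degree `n` by the classes of cycles of filtration `≤ p`. -/
def homologyFil (n p : ℤ) : Submodule K (D.homology n) :=
  ((D.cycles p n).submoduleOf (D.cycles n n)).map (Submodule.mkQ _)

lemma homologyFil_mono (n : ℤ) : Monotone (D.homologyFil n) := fun _ _ h =>
  Submodule.map_mono (Submodule.comap_mono (D.cycles_le_cycles n h))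

lemma homologyFil_eq_bot {n p : ℤ} (hp : p < 0) : D.homologyFil n p = ⊥ := by
  rw [eq_bot_iff]
  rintro _ ⟨x, hx, rfl⟩
  obtain rfl : x = 0 := Subtype.ext (D.eq_zero_of_mem_fil hp hx.1)
  exact map_zero _

lemma homologyFil_eq_top {n p : ℤ} (hp : n ≤ p) : D.homologyFil n p = ⊤ := by
  rw [homologyFil, Submodule.submoduleOf_eq_top.2 (D.cycles_le_cycles n hp), Submodule.map_top,
    Submodule.range_mkQ]

/-- The graded pieces of the filtration on the homology are the terms of the limit page. -/
def limitTermEquiv {n p r : ℤ} (hp : p < r) (hn : n + 2 ≤ p + r) (hpn : p ≤ n) :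
    D.E r p n ≃ₗ[K]
      ↥(D.homologyFil n p) ⧸ (D.homologyFil n (p - 1)).submoduleOf (D.homologyFil n p) :=
  have hZ : D.Z r p n ≤ D.cycles n n := (D.Z_eq_cycles hp).trans_le (D.cycles_le_cycles n hpn)
  let f : D.Z r p n →ₗ[K] D.homologyFil n p :=
    (Submodule.mkQ _ ∘ₗ Submodule.inclusion hZ).codRestrict _
      fun x => ⟨_, (D.Z_eq_cycles hp).le x.2, rfl⟩
  let g := ((D.homologyFil n (p - 1)).submoduleOf (D.homologyFil n p)).mkQ ∘ₗ f
  have hg : Function.Surjective g := by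
    intro z
    obtain ⟨⟨_, x, hx, rfl⟩, rfl⟩ := Submodule.Quotient.mk_surjective _ z
    exact ⟨⟨x, (D.Z_eq_cycles hp).ge hx⟩, rfl⟩
  have hker : (D.B r p n).submoduleOf (D.Z r p n) = LinearMap.ker g := by
    ext x
    refine (D.mem_B_iff_of_lt hp hn ((D.Z_eq_cycles hp).le x.2)).trans
      (Iff.trans ?_ (Submodule.Quotient.mk_eq_zero _).symm)
    constructor
    · rintro ⟨y, hy, hxy⟩
      refine ⟨⟨y, D.cycles_le_cycles n (by lia) hy⟩, hy, ((Submodule.Quotient.eq _).2 ?_).symm⟩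
      exact hxy
    · rintro ⟨y, hy, hyx⟩
      exact ⟨y, hy, (Submodule.Quotient.eq ((D.boundaries n).submoduleOf _)).1 hyx.symm⟩
  (Submodule.quotEquivOfEq _ _ hker).trans (g.quotKerEquivOfSurjective hg)

theorem spectralSequence_convergesTo :
    D.spectralSequence.ConvergesTo fun n => ModuleCat.of K (D.homology n) := by
  refine ⟨fun n => D.homologyFil n, fun n => D.homologyFil_mono n,
    fun n p => D.homologyFil_eq_bot, fun n p => D.homologyFil_eq_top, fun p q r _ hp hq => ?_⟩
  have hn : (p + q : ℤ) = (p + q : ℕ) := (Nat.cast_add p q).symm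
  have hlimit := D.limitTermEquiv (n := (p + q : ℕ)) hp (by lia) (by lia)
  rw [← hn] at hlimit
  exact ⟨hlimit⟩

end FilteredDifferential

theorem FirstQuadrantHomologySS.ConvergesTo.of_equiv {K : Type u} [CommRing K]
    {E : FirstQuadrantHomologySS K} {H H' : ℕ → ModuleCat.{u} K} (h : E.ConvergesTo H)
    (e : ∀ n, H n ≃ₗ[K] H' n) : E.ConvergesTo H' := by
  obtain ⟨Φ, hmono, hbot, htop, hlimit⟩ := h
  refine ⟨fun n p => (Φ n p).map (e n).toLinearMap, fun n _ _ hp => Submodule.map_mono (hmono n hp),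
    fun n p hp => ?_, fun n p hp => ?_, fun p q r hr hp hq => ?_⟩
  · exact (congrArg _ (hbot n p hp)).trans (Submodule.map_bot _)
  · exact (congrArg _ (htop n p hp)).trans (Submodule.map_top _ |>.trans (e n).range)
  · obtain ⟨f⟩ := hlimit p q r hr hp hq
    refine ⟨f.trans (Submodule.Quotient.equiv _ _ ((e (p + q)).submoduleMap _) ?_)⟩
    ext ⟨_, x, hx, rfl⟩
    constructor
    · rintro ⟨y, hy, hyx⟩
      exact ⟨y, hy, congrArg Subtype.val hyx⟩
    · rintro ⟨y, hy, hyx⟩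
      exact ⟨⟨y, hmono _ (by lia) hy⟩, hy, Subtype.ext hyx⟩

/-! ### First quadrant double complexes -/

section HomologyClass

variable {K : Type u} [Ring K] (W : ChainComplex (ModuleCat.{u} K) ℕ)

lemma down_nat_next (q : ℕ) : (ComplexShape.down ℕ).next q = q - 1 := by
  cases q with
  | zero => exact ChainComplex.next_nat_zero
  | succ q => exact ChainComplex.next_nat_succ q

/-- The homology class of a cycle of a chain complex of modules. The differential out of degree `0`
is `W.d 0 (0 - 1) = W.d 0 0`, which is zero. -/
def homologyClass (q : ℕ) : LinearMap.ker (W.d q (q - 1)).hom →ₗ[K] W.homology q :=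
  (W.liftCycles (ModuleCat.ofHom (Submodule.subtype _)) (q - 1) (down_nat_next q)
    (ModuleCat.hom_ext (LinearMap.ext fun z => z.2)) ≫ W.homologyπ q).hom

lemma iCycles_liftCycles (q : ℕ) (z : LinearMap.ker (W.d q (q - 1)).hom) (hq) (h) :
    W.iCycles q (W.liftCycles (ModuleCat.ofHom (Submodule.subtype _)) (q - 1) hq h z) = z.1 :=
  congrArg (fun f => f.hom z) (W.liftCycles_i (i := q) _ (q - 1) hq h)

lemma iCycles_injective (q : ℕ) : Function.Injective (W.iCycles q) :=
  (ModuleCat.mono_iff_injective (W.iCycles q)).1 inferInstance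

lemma homologyClass_surjective (q : ℕ) : Function.Surjective (homologyClass W q) := by
  intro c
  obtain ⟨z, rfl⟩ := (ModuleCat.epi_iff_surjective (W.homologyπ q)).1 inferInstance c
  exact ⟨⟨W.iCycles q z, ConcreteCategory.congr_hom (W.iCycles_d q (q - 1)) z⟩,
    congrArg (W.homologyπ q) (iCycles_injective W q (iCycles_liftCycles W q _ _ _))⟩

lemma homologyClass_eq_zero_iff (q : ℕ) (z : LinearMap.ker (W.d q (q - 1)).hom) :
    homologyClass W q z = 0 ↔ ∃ w, W.d (q + 1) q w = (z : W.X q) := by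
  have hexact := (ShortComplex.moduleCat_exact_iff _).1 <| ShortComplex.exact_of_g_is_cokernel
    (ShortComplex.mk (W.toCycles (q + 1) q) (W.homologyπ q) (by simp))
    (W.homologyIsCokernel (q + 1) q (ChainComplex.prev ℕ q))
  have htoCycles (w : W.X (q + 1)) : W.iCycles q (W.toCycles (q + 1) q w) = W.d (q + 1) q w :=
    ConcreteCategory.congr_hom (W.toCycles_i (q + 1) q) w
  constructor
  · intro h
    obtain ⟨w, hw⟩ := hexact _ h
    refine ⟨w, (htoCycles w).symm.trans ?_⟩
    exact (congrArg (W.iCycles q) hw).trans (iCycles_liftCycles W q z _ _)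
  · rintro ⟨w, hw⟩
    refine (congrArg (W.homologyπ q) (iCycles_injective W q ?_)).trans
      (ConcreteCategory.congr_hom (W.toCycles_comp_homologyπ (q + 1) q) w)
    exact (iCycles_liftCycles W q z _ _).trans (hw.symm.trans (htoCycles w).symm)

lemma homologyClass_eq_iff (q : ℕ) (z z' : LinearMap.ker (W.d q (q - 1)).hom) :
    homologyClass W q z = homologyClass W q z' ↔ ∃ w, W.d (q + 1) q w = (z - z' : W.X q) := by
  rw [← sub_eq_zero, ← map_sub, homologyClass_eq_zero_iff]
  rfl

lemma homologyMap_homologyClass {W W' : ChainComplex (ModuleCat.{u} K) ℕ} (f : W ⟶ W') {q : ℕ}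
    {z : W.X q} (hz : z ∈ LinearMap.ker (W.d q (q - 1)).hom)
    (hfz : f.f q z ∈ LinearMap.ker (W'.d q (q - 1)).hom) :
    HomologicalComplex.homologyMap f q (homologyClass W q ⟨z, hz⟩) =
      homologyClass W' q ⟨f.f q z, hfz⟩ := by
  refine (ConcreteCategory.congr_hom (HomologicalComplex.homologyπ_naturality f q) _).trans
    (congrArg (W'.homologyπ q) (iCycles_injective W' q ?_))
  refine Eq.trans ?_ (iCycles_liftCycles W' q ⟨f.f q z, hfz⟩ _ _).symm
  refine (ConcreteCategory.congr_hom (HomologicalComplex.cyclesMap_i f q) _).trans ?_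
  exact congrArg (f.f q) (iCycles_liftCycles W q ⟨z, hz⟩ _ _)

end HomologyClass

/-- A first quadrant double complex of modules: `(D.X p).X q` is the term in column `p` and row `q`,
and the squares commute. -/
abbrev DoubleComplex (K : Type u) [CommRing K] :=
  ChainComplex (ChainComplex (ModuleCat.{u} K) ℕ) ℕ

namespace DoubleComplex

variable {K : Type u} [CommRing K] (D : DoubleComplex K)

/-- The horizontal differential. -/
def h (p p' q : ℕ) : (D.X p).X q →ₗ[K] (D.X p').X q := ((D.d p p').f q).hom

/-- The vertical differential. -/
def v (p q q' : ℕ) : (D.X p).X q →ₗ[K] (D.X p).X q' := ((D.X p).d q q').hom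

lemma h_h (p p' p'' q : ℕ) (x : (D.X p).X q) : D.h p' p'' q (D.h p p' q x) = 0 :=
  congrArg (fun f => (f.f q).hom x) (D.d_comp_d p p' p'')

lemma v_v (p q q' q'' : ℕ) (x : (D.X p).X q) : D.v p q' q'' (D.v p q q' x) = 0 :=
  congrArg (fun f => f.hom x) ((D.X p).d_comp_d q q' q'')

lemma h_v (p p' q q' : ℕ) (x : (D.X p).X q) :
    D.h p p' q' (D.v p q q' x) = D.v p' q q' (D.h p p' q x) :=
  congrArg (fun f => f.hom x) ((D.d p p').comm q q').symm

lemma h_eq_zero {p p' : ℕ} (hp : p' + 1 ≠ p) (q : ℕ) (x : (D.X p).X q) : D.h p p' q x = 0 :=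
  congrArg (fun f => (f.f q).hom x) (D.shape p p' hp)

lemma v_eq_zero (p : ℕ) {q q' : ℕ} (hq : q' + 1 ≠ q) (x : (D.X p).X q) : D.v p q q' x = 0 :=
  congrArg (fun f => f.hom x) ((D.X p).shape q q' hq)

/-- The product of all terms of a double complex. -/
abbrev Total : Type u := ∀ p q, (D.X p).X q

/-- The total differential. -/
def totalD : D.Total →ₗ[K] D.Total where
  toFun x p q := D.h (p + 1) p q (x (p + 1) q) + (-1 : K) ^ p • D.v p (q + 1) q (x p (q + 1))
  map_add' x y := by
    ext p q
    simp only [Pi.add_apply, map_add, smul_add]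
    abel
  map_smul' k x := by
    ext p q
    simp only [Pi.smul_apply, map_smul, smul_add, RingHom.id_apply, smul_comm k]

lemma totalD_apply (x : D.Total) (p q : ℕ) : D.totalD x p q =
    D.h (p + 1) p q (x (p + 1) q) + (-1 : K) ^ p • D.v p (q + 1) q (x p (q + 1)) := rfl

lemma neg_one_pow_smul_neg_one_pow_smul {M : Type*} [AddCommGroup M] [Module K M] (p : ℕ) (x : M) :
    (-1 : K) ^ p • (-1 : K) ^ p • x = x := by
  rw [smul_smul, ← mul_pow, neg_one_mul, neg_neg, one_pow, one_smul]

lemma totalD_totalD (x : D.Total) : D.totalD (D.totalD x) = 0 := by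
  ext p q
  simp only [totalD_apply, map_add, map_smul, h_h, v_v, h_v, pow_succ, mul_neg, mul_one, neg_smul,
    map_neg, smul_zero, zero_add, add_zero, neg_add_cancel, Pi.zero_apply]

/-- The elements of degree `n` with vanishing components in the columns after the `p`-th one. -/
def columnFil (p n : ℤ) : Submodule K D.Total where
  carrier := {x | ∀ i j : ℕ, ¬ ((i : ℤ) + j = n ∧ (i : ℤ) ≤ p) → x i j = 0}
  add_mem' hx hy i j hij := by
    rw [Pi.add_apply, Pi.add_apply, hx i j hij, hy i j hij, add_zero]
  zero_mem' _ _ _ := rfl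
  smul_mem' k x hx i j hij := by rw [Pi.smul_apply, Pi.smul_apply, hx i j hij, smul_zero]

/-- The total complex of a double complex, filtered by columns. -/
def filtered : FilteredDifferential K D.Total where
  d := D.totalD
  d_d := D.totalD_totalD
  fil := D.columnFil
  mono n h x hx i j hij := hx i j fun h' => hij ⟨h'.1, h'.2.trans h⟩
  d_mem {p n x} hx i j hij := by
    rw [totalD_apply, hx (i + 1) j fun h => hij (by lia), hx i (j + 1) fun h => hij (by lia),
      map_zero, map_zero, smul_zero, add_zero]
  neg n hp := (Submodule.eq_bot_iff _).2 fun x hx => funext₂ fun i j => hx i j (by lia)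
  top {p n} hn := Submodule.ext fun x => forall₂_congr fun i j => by
    rw [show ((i : ℤ) + j = n ∧ (i : ℤ) ≤ p) ↔ ((i : ℤ) + j = n ∧ (i : ℤ) ≤ n) by lia]

/-- The element of the total complex with a single component. -/
def inc (p q : ℕ) : (D.X p).X q →ₗ[K] D.Total :=
  LinearMap.single K (fun p => ∀ q, (D.X p).X q) p ∘ₗ LinearMap.single K (fun q => (D.X p).X q) q

lemma inc_self (p q : ℕ) (c : (D.X p).X q) : D.inc p q c p q = c := by
  change (Pi.single p (Pi.single q c) : D.Total) p q = c
  rw [Pi.single_eq_same, Pi.single_eq_same]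

lemma inc_of_ne {p q i j : ℕ} (c : (D.X p).X q) (hij : ¬ (i = p ∧ j = q)) :
    D.inc p q c i j = 0 := by
  change (Pi.single p (Pi.single q c) : D.Total) i j = 0
  by_cases hi : i = p
  · subst hi
    rw [Pi.single_eq_same, Pi.single_eq_of_ne fun hj => hij ⟨rfl, hj⟩]
  · rw [Pi.single_eq_of_ne hi, Pi.zero_apply]

lemma inc_mem_columnFil (p q : ℕ) (c : (D.X p).X q) {p' n : ℤ} (hp : p ≤ p')
    (hn : (p : ℤ) + q = n) : D.inc p q c ∈ D.columnFil p' n :=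
  fun _ _ hij => D.inc_of_ne c (by lia)

lemma totalD_inc (p q : ℕ) (c : (D.X p).X q) : D.totalD (D.inc p q c) =
    D.inc (p - 1) q (D.h p (p - 1) q c) + (-1 : K) ^ p • D.inc p (q - 1) (D.v p q (q - 1) c) := by
  ext i j
  rw [totalD_apply, Pi.add_apply, Pi.smul_apply, Pi.add_apply, Pi.smul_apply]
  congr 1
  · by_cases hij : i + 1 = p ∧ j = q
    · obtain ⟨rfl, rfl⟩ := hij
      rw [inc_self]
      exact (D.inc_self i j _).symm
    · rw [D.inc_of_ne c hij, map_zero]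
      obtain rfl | hp := eq_or_ne p 0
      · rw [D.h_eq_zero (by lia), map_zero]
        rfl
      · rw [D.inc_of_ne _ (by lia)]
  · by_cases hij : i = p ∧ j + 1 = q
    · obtain ⟨rfl, rfl⟩ := hij
      rw [inc_self]
      exact congrArg _ (D.inc_self i j _).symm
    · rw [D.inc_of_ne c hij, map_zero]
      obtain rfl | hq := eq_or_ne q 0
      · rw [D.v_eq_zero p (by lia), map_zero, smul_zero]
        exact (smul_zero _).symm
      · by_cases hi : i = p
        · rw [D.inc_of_ne _ (by lia), smul_zero, smul_zero]
        · rw [D.inc_of_ne _ (by lia), smul_zero, smul_zero]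

lemma inc_h_mem_columnFil (p q : ℕ) (c : (D.X p).X q) {p' n : ℤ} (hp : p - 1 ≤ p')
    (hn : (p : ℤ) + q = n + 1) : D.inc (p - 1) q (D.h p (p - 1) q c) ∈ D.columnFil p' n := by
  cases p with
  | zero =>
    rw [D.h_eq_zero (by lia), map_zero]
    exact zero_mem _
  | succ p => exact D.inc_mem_columnFil p q _ (by lia) (by lia)

variable {D}

lemma sub_inc_mem_columnFil {p q : ℕ} {x : D.Total} (hx : x ∈ D.columnFil p (p + q)) :
    x - D.inc p q (x p q) ∈ D.columnFil (p - 1) (p + q) := by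
  intro i j hij
  rw [Pi.sub_apply, Pi.sub_apply]
  by_cases h : i = p ∧ j = q
  · obtain ⟨rfl, rfl⟩ := h
    rw [inc_self, sub_self]
  · rw [hx i j (by lia), D.inc_of_ne _ h, sub_zero]

lemma v_eq_zero_of_mem_Z {r : ℤ} (hr : 1 ≤ r) {p q : ℕ} {n : ℤ} (hn : (p : ℤ) + q = n)
    {x : D.Total} (hx : x ∈ D.filtered.Z r p n) : D.v p q (q - 1) (x p q) = 0 := by
  cases q with
  | zero => exact D.v_eq_zero p (by lia) _
  | succ q =>
    have hd : D.totalD x p q = 0 := hx.2 p q (by lia)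
    rw [totalD_apply, hx.1 (p + 1) q (by lia), map_zero, zero_add] at hd
    rw [← neg_one_pow_smul_neg_one_pow_smul (K := K) p (D.v p _ _ _)]
    exact (congrArg _ hd).trans (smul_zero _)

lemma exists_mem_Z_two_iff {p q : ℕ} {z : (D.X p).X q} (hz : D.v p q (q - 1) z = 0) :
    (∃ x ∈ D.filtered.Z 2 p (p + q), x p q = z) ↔
      ∃ w, D.v (p - 1) (q + 1) q w = D.h p (p - 1) q z := by
  constructor
  · rintro ⟨x, hx, rfl⟩
    cases p with
    | zero => exact ⟨0, by rw [map_zero, D.h_eq_zero (by lia)]⟩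
    | succ p =>
      have hd : D.totalD x p q = 0 := hx.2 p q (by lia)
      refine ⟨-((-1 : K) ^ p • x p (q + 1)), ?_⟩
      change D.v p (q + 1) q _ = D.h (p + 1) p q _
      rw [map_neg, map_smul, neg_eq_iff_add_eq_zero, add_comm]
      exact hd
  · rintro ⟨w, hw⟩
    cases p with
    | zero =>
      refine ⟨D.inc 0 q z, D.filtered.mem_Z_of_d_eq_zero (D.inc_mem_columnFil 0 q z le_rfl rfl) ?_,
        D.inc_self 0 q z⟩
      exact (D.totalD_inc 0 q z).trans (by rw [hz, D.h_eq_zero (by lia)]; simp)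
    | succ p =>
      change D.v p (q + 1) q w = D.h (p + 1) p q z at hw
      refine ⟨D.inc (p + 1) q z - (-1 : K) ^ p • D.inc p (q + 1) w, D.filtered.mem_Z.2
        ⟨sub_mem (D.inc_mem_columnFil _ _ _ le_rfl rfl)
          (Submodule.smul_mem _ _ (D.inc_mem_columnFil _ _ _ (by lia) (by lia))), ?_⟩, ?_⟩
      · change D.totalD _ ∈ _
        rw [map_sub, map_smul, totalD_inc, totalD_inc, hz, map_zero, smul_zero, add_zero, smul_add,
          neg_one_pow_smul_neg_one_pow_smul, Nat.add_sub_cancel, Nat.add_sub_cancel, hw,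
          sub_add_cancel_right]
        exact neg_mem (Submodule.smul_mem _ _ (D.inc_h_mem_columnFil p (q + 1) w (by lia) (by lia)))
      · rw [Pi.sub_apply, Pi.sub_apply, Pi.smul_apply, Pi.smul_apply, inc_self,
          D.inc_of_ne (p := p) w (by lia), smul_zero, sub_zero]

lemma mem_B_two_iff {p q : ℕ} {x : D.Total} (hx : x ∈ D.filtered.Z 2 p (p + q)) :
    x ∈ D.filtered.B 2 p (p + q) ↔ ∃ y, D.v (p + 1) q (q - 1) y = 0 ∧
      ∃ w, D.h (p + 1) p q y + D.v p (q + 1) q w = x p q := by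
  rw [FilteredDifferential.mem_B]
  constructor
  · rintro ⟨y, hy, z, hz, rfl⟩
    have hz' : z ∈ D.filtered.Z 1 (p + 1 : ℕ) (p + q + 1) :=
      D.filtered.Z_le_Z _ (by lia) (by lia) hz
    refine ⟨z (p + 1) q, v_eq_zero_of_mem_Z le_rfl (by lia) hz', (-1 : K) ^ p • z p (q + 1), ?_⟩
    rw [Pi.add_apply, Pi.add_apply, hy.1 p q (by lia), zero_add, map_smul]
    rfl
  · rintro ⟨y, hy, w, hyw⟩
    set z := D.inc (p + 1) q y + (-1 : K) ^ p • D.inc p (q + 1) w with hz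
    have hzmem : z ∈ D.columnFil (p + 1) (p + q + 1) :=
      add_mem (D.inc_mem_columnFil _ _ _ (by lia) (by lia))
        (Submodule.smul_mem _ _ (D.inc_mem_columnFil _ _ _ (by lia) (by lia)))
    have hdz : D.totalD z = D.inc p q (x p q) +
        (-1 : K) ^ p • D.inc (p - 1) (q + 1) (D.h p (p - 1) (q + 1) w) := by
      rw [hz, map_add, map_smul, totalD_inc, totalD_inc, hy, map_zero, smul_zero, add_zero,
        smul_add, neg_one_pow_smul_neg_one_pow_smul, Nat.add_sub_cancel, Nat.add_sub_cancel, ← hyw,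
        map_add]
      abel
    have hsub : x - D.totalD z ∈ D.columnFil (p - 1) (p + q) := by
      rw [hdz, ← sub_sub]
      exact sub_mem (sub_inc_mem_columnFil hx.1)
        (Submodule.smul_mem _ _ (D.inc_h_mem_columnFil p (q + 1) w le_rfl (by lia)))
    refine ⟨x - D.totalD z, D.filtered.mem_Z.2 ⟨hsub, ?_⟩, z, D.filtered.mem_Z.2 ⟨?_, ?_⟩,
      sub_add_cancel _ _⟩
    · change D.totalD _ ∈ _
      rw [map_sub, D.totalD_totalD, sub_zero]
      exact D.filtered.mono _ (by lia) hx.2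
    · exact D.filtered.mono _ (by lia) hzmem
    · rw [show (D.filtered.d z : D.Total) = x - (x - D.totalD z) from (sub_sub_cancel _ _).symm]
      rw [add_sub_cancel_right]
      exact sub_mem (D.filtered.mono _ (by lia) hx.1) (D.filtered.mono _ (by lia) hsub)

variable (D)

/-- The complex formed by the homology in row `q` of the columns. -/
abbrev columnHomology (q : ℕ) : ChainComplex (ModuleCat.{u} K) ℕ :=
  ((HomologicalComplex.homologyFunctor _ _ q).mapHomologicalComplex _).obj D

variable {D}

lemma h_mem_ker {p p' q q' : ℕ} {z : (D.X p).X q} (hz : z ∈ LinearMap.ker ((D.X p).d q q').hom) :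
    D.h p p' q z ∈ LinearMap.ker ((D.X p').d q q').hom :=
  (D.h_v p p' q q' z).symm.trans ((congrArg _ hz).trans (map_zero _))

lemma columnHomology_d_class {p p' q : ℕ} {z : (D.X p).X q}
    (hz : z ∈ LinearMap.ker ((D.X p).d q (q - 1)).hom) :
    (D.columnHomology q).d p p' (homologyClass (D.X p) q ⟨z, hz⟩) =
      homologyClass (D.X p') q ⟨D.h p p' q z, h_mem_ker hz⟩ :=
  homologyMap_homologyClass (D.d p p') hz (h_mem_ker hz)

lemma columnHomology_d_class_eq_zero_iff {p q : ℕ} {z : (D.X p).X q}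
    (hz : z ∈ LinearMap.ker ((D.X p).d q (q - 1)).hom) :
    (D.columnHomology q).d p (p - 1) (homologyClass (D.X p) q ⟨z, hz⟩) = 0 ↔
      ∃ x ∈ D.filtered.Z 2 p (p + q), x p q = z :=
  (Eq.congr_left (columnHomology_d_class hz)).trans <|
    (homologyClass_eq_zero_iff _ _ _).trans (exists_mem_Z_two_iff hz).symm

lemma exists_columnHomology_d_eq_class_iff {p q : ℕ} {z : (D.X p).X q}
    (hz : z ∈ LinearMap.ker ((D.X p).d q (q - 1)).hom) :
    (∃ c, (D.columnHomology q).d (p + 1) p c = homologyClass (D.X p) q ⟨z, hz⟩) ↔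
      ∃ y, D.v (p + 1) q (q - 1) y = 0 ∧ ∃ w, D.h (p + 1) p q y + D.v p (q + 1) q w = z := by
  refine (homologyClass_surjective (D.X (p + 1)) q).exists.trans (Subtype.exists.trans ?_)
  refine exists_congr fun y => Iff.trans (exists_congr fun hy => ?_) exists_prop
  refine (Eq.congr_left (columnHomology_d_class hy)).trans <| eq_comm.trans <|
    (homologyClass_eq_iff _ _ _ _).trans ?_
  exact exists_congr fun w => eq_sub_iff_add_eq'

/-- The second page of the spectral sequence of a double complex filtered by columns. -/
def columnHomologyIso (p q : ℕ) :
    (D.columnHomology q).homology p ≅ ModuleCat.of K (D.filtered.E 2 p (p + q)) := by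
  refine homologyIsoQuotient ((D.columnHomology q).sc p)
    (homologyClass (D.X p) q ∘ₗ LinearMap.codRestrict (LinearMap.ker ((D.X p).d q (q - 1)).hom)
      (LinearMap.proj (R := K) (φ := fun q => (D.X p).X q) q ∘ₗ
        LinearMap.proj (R := K) (φ := fun p => ∀ q, (D.X p).X q) p ∘ₗ Submodule.subtype _)
      fun x => v_eq_zero_of_mem_Z one_le_two rfl x.2) _ ?_ ?_ ?_
  · intro x
    change (D.columnHomology q).d p ((ComplexShape.down ℕ).next p) (homologyClass _ q _) = 0
    rw [down_nat_next]
    exact (columnHomology_d_class_eq_zero_iff _).2 ⟨x, x.2, rfl⟩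
  · intro c hc
    obtain ⟨⟨z, hz⟩, rfl⟩ := homologyClass_surjective (D.X p) q c
    change (D.columnHomology q).d p ((ComplexShape.down ℕ).next p) _ = 0 at hc
    rw [down_nat_next, columnHomology_d_class_eq_zero_iff] at hc
    obtain ⟨x, hx, rfl⟩ := hc
    exact ⟨⟨x, hx⟩, 0, by rw [map_zero, add_zero]; rfl⟩
  · intro x
    change (x : D.Total) ∈ D.filtered.B 2 p (p + q) ↔
      ∃ c, (D.columnHomology q).d ((ComplexShape.down ℕ).prev p) p c = homologyClass _ q _
    rw [ChainComplex.prev, mem_B_two_iff x.2]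
    exact (exists_columnHomology_d_eq_class_iff (v_eq_zero_of_mem_Z one_le_two rfl x.2)).symm

lemma sub_totalD_inc_eq_zero {n k : ℕ} {t : D.Total} (ht : t ∈ D.columnFil n (n - 1))
    (ht0 : ∀ i < k, ∀ j, t i j = 0) {c : (D.X (k + 1)).X (n - 1 - k)}
    (hc : D.h (k + 1) k (n - 1 - k) c = t k (n - 1 - k)) (i : ℕ) (hi : i < k + 1) (j : ℕ) :
    (t - D.totalD (D.inc (k + 1) (n - 1 - k) c)) i j = 0 := by
  rw [Pi.sub_apply, Pi.sub_apply, totalD_inc, Pi.add_apply, Pi.add_apply, Pi.smul_apply,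
    Pi.smul_apply, D.inc_of_ne (p := k + 1) _ (by lia), smul_zero, add_zero, Nat.add_sub_cancel, hc]
  by_cases hij : i = k ∧ j = n - 1 - k
  · obtain ⟨rfl, rfl⟩ := hij
    rw [inc_self, sub_self]
  · rw [D.inc_of_ne _ hij, sub_zero]
    by_cases hik : i < k
    · exact ht0 i hik j
    · exact ht i j (by lia)

section Augmentation

variable {W : ChainComplex (ModuleCat.{u} K) ℕ} {ε : D.X 0 ⟶ W}
  (hrow : ∀ p q, Function.Exact (D.h (p + 2) (p + 1) q) (D.h (p + 1) p q))
  (hε : ∀ q, Function.Exact (D.h 1 0 q) (ε.f q)) (hε' : ∀ q, Function.Surjective (ε.f q))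

include hrow in
lemma exists_totalD_eq_of_exact (n m : ℕ) : ∀ k, n ≤ k + m → ∀ t ∈ D.columnFil n (n - 1),
    D.totalD t = 0 → (∀ i < k, ∀ j, t i j = 0) → (∀ j, ∃ y, D.h (k + 1) k j y = t k j) →
    ∃ u ∈ D.columnFil n n, D.totalD u = t ∧ ∀ j, u 0 j = 0 := by
  -- The columns of `t` are made zero one after the other, the `k`-th one next.
  induction m with
  | zero =>
    intro k hk t ht _ ht0 _
    refine ⟨0, zero_mem _, (map_zero _).trans (funext₂ fun i j => ?_).symm, fun _ => rfl⟩
    by_cases hi : i < k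
    · exact ht0 i hi j
    · exact ht i j (by lia)
  | succ m ih =>
    intro k hk t ht hdt ht0 htk
    by_cases hn : n ≤ k
    · exact ih k (by lia) t ht hdt ht0 htk
    obtain ⟨c, hc⟩ := htk (n - 1 - k)
    have hcmem : D.inc (k + 1) (n - 1 - k) c ∈ D.columnFil n n :=
      D.inc_mem_columnFil _ _ _ (by lia) (by lia)
    set t' := t - D.totalD (D.inc (k + 1) (n - 1 - k) c) with ht'
    have hdt' : D.totalD t' = 0 := by rw [ht', map_sub, hdt, D.totalD_totalD, sub_zero]
    have ht'0 : ∀ i < k + 1, ∀ j, t' i j = 0 := sub_totalD_inc_eq_zero ht ht0 hc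
    obtain ⟨u, hu, hdu, hu0⟩ := ih (k + 1) (by lia) t' (sub_mem ht (D.filtered.d_mem hcmem)) hdt'
      ht'0 fun j => (hrow k j _).1 (by
        have hd : D.totalD t' k j = 0 := congrFun₂ hdt' k j
        rwa [totalD_apply, ht'0 k (by lia), map_zero, smul_zero, add_zero] at hd)
    refine ⟨u + D.inc (k + 1) (n - 1 - k) c, add_mem hu hcmem, ?_, fun j => ?_⟩
    · rw [map_add, hdu, sub_add_cancel]
    · rw [Pi.add_apply, Pi.add_apply, hu0, D.inc_of_ne _ (by lia), add_zero]

include hrow hε in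
lemma exists_totalD_eq {n : ℕ} {t : D.Total} (ht : t ∈ D.columnFil n (n - 1))
    (hdt : D.totalD t = 0) (hεt : ∀ q, ε.f q (t 0 q) = 0) :
    ∃ u ∈ D.columnFil n n, D.totalD u = t ∧ ∀ q, u 0 q = 0 :=
  exists_totalD_eq_of_exact hrow n n 0 (by lia) t ht hdt (by lia) fun q => (hε q _).1 (hεt q)

include hε in
lemma augmentation_totalD (x : D.Total) (q : ℕ) :
    ε.f q (D.totalD x 0 q) = W.d (q + 1) q (ε.f (q + 1) (x 0 (q + 1))) := by
  rw [totalD_apply, pow_zero, one_smul, map_add, (hε q).apply_apply_eq_zero, zero_add]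
  exact (ConcreteCategory.congr_hom (ε.comm (q + 1) q) _).symm

include hrow hε in
lemma exists_cycle_of_d_augmentation_eq_zero {n : ℕ} {x : (D.X 0).X n}
    (hx : W.d n (n - 1) (ε.f n x) = 0) : ∃ y ∈ D.filtered.cycles n n, y 0 n = x := by
  have hmem : D.inc 0 n x ∈ D.columnFil n n := D.inc_mem_columnFil 0 n x (by lia) (by lia)
  have hεd (q : ℕ) : ε.f q (D.totalD (D.inc 0 n x) 0 q) = 0 := by
    rw [augmentation_totalD hε]
    by_cases hq : q + 1 = n
    · subst hq
      rw [inc_self]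
      exact hx
    · rw [D.inc_of_ne x (by lia), map_zero, map_zero]
  obtain ⟨u, hu, hdu, hu0⟩ := exists_totalD_eq hrow hε (D.filtered.d_mem hmem)
    (D.totalD_totalD _) hεd
  refine ⟨D.inc 0 n x - u, ⟨sub_mem hmem hu, ?_⟩, ?_⟩
  · exact (map_sub _ _ _).trans (sub_eq_zero.2 hdu.symm)
  · rw [Pi.sub_apply, Pi.sub_apply, inc_self, hu0, sub_zero]

include hrow hε hε' in
lemma mem_boundaries_iff {n : ℕ} {x : D.Total} (hx : x ∈ D.filtered.cycles n n) :
    x ∈ D.filtered.boundaries n ↔ ∃ w, W.d (n + 1) n w = ε.f n (x 0 n) := by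
  constructor
  · rintro ⟨y, -, rfl⟩
    exact ⟨_, (augmentation_totalD hε y n).symm⟩
  · rintro ⟨w, hw⟩
    obtain ⟨w, rfl⟩ := hε' _ w
    have hmem : D.inc 0 (n + 1) w ∈ D.columnFil (n + 1 : ℕ) (n + 1 : ℕ) :=
      D.inc_mem_columnFil _ _ _ (by lia) (by lia)
    have ht : x - D.totalD (D.inc 0 (n + 1) w) ∈ D.columnFil (n + 1 : ℕ) ((n + 1 : ℕ) - 1) :=
      sub_mem (fun i j hij => hx.1 i j (by lia)) (D.filtered.d_mem hmem)
    obtain ⟨u, hu, hdu, -⟩ := exists_totalD_eq hrow hε ht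
      (by rw [map_sub, D.totalD_totalD, sub_zero]; exact hx.2) fun q => by
        rw [Pi.sub_apply, Pi.sub_apply, map_sub, augmentation_totalD hε]
        by_cases hq : q = n
        · subst hq
          rw [inc_self, hw, sub_self]
        · rw [D.inc_of_ne (j := q + 1) w (by lia), hx.1 0 q (by lia), map_zero, map_zero,
            map_zero, sub_zero]
    refine ⟨u + D.inc 0 (n + 1) w, fun i j hij => add_mem hu hmem i j (by lia), ?_⟩
    exact (map_add _ _ _).trans (by rw [show D.filtered.d u = _ from hdu]; exact sub_add_cancel _ _)

/-- If the rows of a double complex are resolutions of the terms of a complex, then the total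
complex computes the homology of this complex. -/
def augmentationHomologyIso (n : ℕ) :
    W.homology n ≅ ModuleCat.of K (D.filtered.homology n) := by
  refine homologyIsoQuotient (W.sc n) ((ε.f n).hom ∘ₗ
    LinearMap.proj (R := K) (φ := fun q => (D.X 0).X q) n ∘ₗ
      LinearMap.proj (R := K) (φ := fun p => ∀ q, (D.X p).X q) 0 ∘ₗ Submodule.subtype _) _ ?_ ?_ ?_
  · rintro ⟨x, -, hdx⟩
    change W.d n ((ComplexShape.down ℕ).next n) (ε.f n (x 0 n)) = 0
    cases n with
    | zero => rw [W.shape _ _ (by simp)]; rfl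
    | succ n =>
      rw [ChainComplex.next_nat_succ, ← augmentation_totalD hε, show D.totalD x = 0 from hdx]
      exact map_zero _
  · intro w hw
    obtain ⟨x, rfl⟩ := hε' n w
    change W.d n ((ComplexShape.down ℕ).next n) (ε.f n x) = 0 at hw
    rw [down_nat_next] at hw
    obtain ⟨y, hy, rfl⟩ := exists_cycle_of_d_augmentation_eq_zero hrow hε hw
    exact ⟨⟨y, hy⟩, 0, by rw [map_zero, add_zero]; rfl⟩
  · rintro ⟨x, hx⟩
    change x ∈ D.filtered.boundaries n ↔
      ∃ w, W.d ((ComplexShape.down ℕ).prev n) n w = ε.f n (x 0 n)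
    rw [ChainComplex.prev, mem_boundaries_iff hrow hε hε' hx]

include hrow hε hε' in
theorem exists_spectralSequence : ∃ E : FirstQuadrantHomologySS K,
    (∀ p q : ℕ, Nonempty ((E.page 2 le_rfl).X (p, q) ≅ (D.columnHomology q).homology p)) ∧
      E.ConvergesTo fun n => W.homology n :=
  ⟨D.filtered.spectralSequence, fun p q => ⟨(columnHomologyIso p q).symm⟩,
    D.filtered.spectralSequence_convergesTo.of_equiv fun n =>
      (augmentationHomologyIso hrow hε hε' n).symm.toLinearEquiv⟩

end Augmentation

end DoubleComplex

/-! ### Functorial free resolutions -/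

section NaturalResolution

variable {A B : Type*} [Category* A] [Category* B] [Abelian A] [Abelian B]
  (T : ChainComplex (A ⥤ B) ℕ) [∀ p, (T.X p).Additive] (C : ChainComplex A ℕ)

/-- The complex of complexes obtained by applying a complex of functors `T` termwise to `C`: its
columns are the complexes `(T.X p) C` and its rows the complexes `T (C.X q)`. -/
def applyTermwise : ChainComplex (ChainComplex B ℕ) ℕ where
  X p := ((T.X p).mapHomologicalComplex _).obj C
  d p p' := (NatTrans.mapHomologicalComplex (T.d p p') _).app C
  shape p p' h := by
    ext q
    exact NatTrans.congr_app (T.shape p p' h) (C.X q)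
  d_comp_d' p p' p'' _ _ := by
    ext q
    exact NatTrans.congr_app (T.d_comp_d p p' p'') (C.X q)

/-- Exact functors commute with the homology of `C`, naturally in the functor. -/
def applyTermwiseHomologyIso [∀ p, (T.X p).PreservesHomology] (q : ℕ) :
    ((HomologicalComplex.homologyFunctor B _ q).mapHomologicalComplex _).obj (applyTermwise T C) ≅
      (((evaluation A B).obj (C.homology q)).mapHomologicalComplex _).obj T :=
  HomologicalComplex.Hom.isoOfComponents (fun p => (C.sc q).mapHomologyIso (T.X p)) fun p p' _ =>
    (Iso.eq_inv_comp _).1 (NatTrans.app_homology (T.d p p') (C.sc q))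

end NaturalResolution

namespace FreeCover

open scoped ModuleCat

section Cover

variable (K R : Type u) [Field K] [Ring R] [Algebra K R]

/-- The functor sending an `R`-module `V` to the `R`-module `R ⊗ V` induced from the `K`-module
underlying `V`. -/
def cover : ModuleCat.{u} R ⥤ ModuleCat.{u} R where
  obj V := ModuleCat.of R (R ⊗[K] V)
  map f := ModuleCat.ofHom (LinearMap.baseChange R (f.hom.restrictScalars K))
  map_id _ := ModuleCat.hom_ext LinearMap.baseChange_id
  map_comp _ _ := ModuleCat.hom_ext (TensorProduct.AlgebraTensorModule.ext fun _ _ => rfl)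

/-- The action maps `R ⊗ V → V`. -/
def counit : cover K R ⟶ 𝟭 (ModuleCat.{u} R) where
  app V := ModuleCat.ofHom <| TensorProduct.AlgebraTensorModule.lift
    { toFun := fun r => Module.toModuleEnd K V r
      map_add' := map_add _
      map_smul' := fun r s => map_mul (Module.toModuleEnd K V) r s }
  naturality _ _ f := ModuleCat.hom_ext <|
    TensorProduct.AlgebraTensorModule.ext fun r x => (map_smul f.hom r x).symm

instance additive_cover : (cover K R).Additive where
  map_add {_ _ f g} := ModuleCat.hom_ext (LinearMap.baseChange_add
    (f.hom.restrictScalars K) (g.hom.restrictScalars K))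

variable {K R}

lemma counit_surjective (V : ModuleCat.{u} R) : Function.Surjective ((counit K R).app V) :=
  fun x => ⟨(1 : R) ⊗ₜ[K] x, one_smul R x⟩

lemma counit_naturality_apply {V W : ModuleCat.{u} R} (f : V ⟶ W) (z : (cover K R).obj V) :
    (counit K R).app W ((cover K R).map f z) = f ((counit K R).app V z) :=
  ConcreteCategory.congr_hom ((counit K R).naturality f) z

instance (V : ModuleCat.{u} R) : Epi ((counit K R).app V) :=
  (ModuleCat.epi_iff_surjective _).2 (counit_surjective V)

lemma shortExact_map_cover {S : ShortComplex (ModuleCat.{u} R)}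
    (hS : S.ShortExact) : (S.map (cover K R)).ShortExact := by
  have hex : Function.Exact (S.f.hom.restrictScalars K) (S.g.hom.restrictScalars K) :=
    (ShortComplex.ShortExact.moduleCat_exact_iff_function_exact S).1 hS.exact
  refine ModuleCat.shortComplex_shortExact _ ?_ ?_ ?_
  · exact Module.Flat.lTensor_exact R hex
  · exact Module.Flat.lTensor_preserves_injective_linearMap (M := R)
      (S.f.hom.restrictScalars K) hS.moduleCat_injective_f
  · exact LinearMap.lTensor_surjective R (g := S.g.hom.restrictScalars K) hS.moduleCat_surjective_g

variable (K R)

/-- The functor sending `V` to the kernel of the action map `R ⊗ V → V`. -/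
def syzygy : ModuleCat.{u} R ⥤ ModuleCat.{u} R where
  obj V := ModuleCat.of R (LinearMap.ker ((counit K R).app V).hom)
  map f := ModuleCat.ofHom <| ((cover K R).map f).hom.restrict fun z hz =>
    (counit_naturality_apply f z).trans <| (congrArg f hz).trans (map_zero f.hom)
  map_id V := ModuleCat.hom_ext <| LinearMap.ext fun z => Subtype.ext <|
    ConcreteCategory.congr_hom ((cover K R).map_id V) z.1
  map_comp f g := ModuleCat.hom_ext <| LinearMap.ext fun z => Subtype.ext <|
    ConcreteCategory.congr_hom ((cover K R).map_comp f g) z.1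

instance additive_syzygy : (syzygy K R).Additive where
  map_add {_ _ f g} := ModuleCat.hom_ext <| LinearMap.ext fun z => Subtype.ext <|
    ConcreteCategory.congr_hom ((cover K R).map_add (f := f) (g := g)) z.1

/-- The inclusions of the kernels of the action maps. -/
def syzygyInclusion : syzygy K R ⟶ cover K R where
  app V := ModuleCat.ofHom (LinearMap.ker ((counit K R).app V).hom).subtype
  naturality _ _ _ := rfl

variable {K R}

lemma syzygyInclusion_injective (V : ModuleCat.{u} R) :
    Function.Injective ((syzygyInclusion K R).app V) :=
  Subtype.val_injective

lemma syzygyInclusion_naturality_apply {V W : ModuleCat.{u} R} (f : V ⟶ W)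
    (z : (syzygy K R).obj V) : (syzygyInclusion K R).app W ((syzygy K R).map f z) =
      (cover K R).map f ((syzygyInclusion K R).app V z) := rfl

lemma exact_syzygyInclusion_counit (V : ModuleCat.{u} R) :
    Function.Exact ((syzygyInclusion K R).app V) ((counit K R).app V) :=
  LinearMap.exact_subtype_ker_map ((counit K R).app V).hom

lemma surjective_map_syzygy {S : ShortComplex (ModuleCat.{u} R)}
    (hS : S.ShortExact) : Function.Surjective ((syzygy K R).map S.g) := by
  have hcover := shortExact_map_cover (K := K) hS
  have hex := (ShortComplex.ShortExact.moduleCat_exact_iff_function_exact S).1 hS.exact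
  intro z
  obtain ⟨y, hy⟩ : ∃ y : (cover K R).obj S.X₂,
      (cover K R).map S.g y = (syzygyInclusion K R).app S.X₃ z := hcover.moduleCat_surjective_g _
  have hcounit : S.g ((counit K R).app S.X₂ y) = 0 :=
    (counit_naturality_apply S.g y).symm.trans <| (congrArg _ hy).trans <|
      (exact_syzygyInclusion_counit S.X₃).apply_apply_eq_zero z
  obtain ⟨x, hx⟩ := (hex _).1 hcounit
  obtain ⟨w, rfl⟩ := counit_surjective (K := K) S.X₁ x
  have hker : (counit K R).app S.X₂ (y - (cover K R).map S.f w) = 0 := by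
    rw [map_sub, sub_eq_zero, counit_naturality_apply]
    exact hx.symm
  obtain ⟨y', hy'⟩ := (exact_syzygyInclusion_counit S.X₂ _).1 hker
  refine ⟨y', syzygyInclusion_injective S.X₃ ?_⟩
  rw [syzygyInclusion_naturality_apply, hy', map_sub]
  have hzero : (cover K R).map S.g ((cover K R).map S.f w) = 0 :=
    ConcreteCategory.congr_hom (S.map (cover K R)).zero w
  rw [hzero, sub_zero]
  exact hy

lemma exact_map_syzygy {S : ShortComplex (ModuleCat.{u} R)}
    (hS : S.ShortExact) : (S.map (syzygy K R)).Exact := by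
  have hcover := shortExact_map_cover (K := K) hS
  refine (ShortComplex.moduleCat_exact_iff _).2 fun y hy => ?_
  obtain ⟨x, hx⟩ := (ShortComplex.moduleCat_exact_iff _).1 hcover.exact
    ((syzygyInclusion K R).app S.X₂ y) (congrArg ((syzygyInclusion K R).app S.X₃) hy)
  have hker : (counit K R).app S.X₁ x = 0 := by
    apply hS.moduleCat_injective_f
    refine (counit_naturality_apply S.f x).symm.trans <| (congrArg _ hx).trans ?_
    exact ((exact_syzygyInclusion_counit S.X₂).apply_apply_eq_zero y).trans (map_zero _).symm
  obtain ⟨x', rfl⟩ := (exact_syzygyInclusion_counit S.X₁ _).1 hker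
  exact ⟨x', syzygyInclusion_injective S.X₂ hx⟩

lemma shortExact_map_syzygy {S : ShortComplex (ModuleCat.{u} R)}
    (hS : S.ShortExact) : (S.map (syzygy K R)).ShortExact where
  exact := exact_map_syzygy hS
  mono_f := by
    refine (ModuleCat.mono_iff_injective _).2 fun x x' h => syzygyInclusion_injective S.X₁ ?_
    exact (shortExact_map_cover hS).moduleCat_injective_f
      (congrArg ((syzygyInclusion K R).app S.X₂) h)
  epi_g := (ModuleCat.epi_iff_surjective _).2 (surjective_map_syzygy hS)

variable (K R)

/-- The iterated kernels `ΩᵖV`, where `ΩV` is the kernel of `R ⊗ V → V`. -/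
def syzygies : ℕ → ModuleCat.{u} R ⥤ ModuleCat.{u} R
  | 0 => 𝟭 _
  | p + 1 => syzygies p ⋙ syzygy K R

instance additive_syzygies : ∀ p, (syzygies K R p).Additive
  | 0 => inferInstanceAs (𝟭 _ : ModuleCat.{u} R ⥤ _).Additive
  | p + 1 =>
    have := additive_syzygies p
    inferInstanceAs (syzygies K R p ⋙ syzygy K R).Additive

variable {K R} in
lemma shortExact_map_syzygies (p : ℕ) {S : ShortComplex (ModuleCat.{u} R)}
    (hS : S.ShortExact) : (S.map (syzygies K R p)).ShortExact := by
  induction p with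
  | zero => exact hS
  | succ p ih => exact shortExact_map_syzygy (S := S.map (syzygies K R p)) ih

/-- The composition `R ⊗ ΩV → ΩV → R ⊗ V`. -/
def connecting : syzygy K R ⋙ cover K R ⟶ cover K R :=
  Functor.whiskerLeft (syzygy K R) (counit K R) ≫ syzygyInclusion K R

variable {K R} in
lemma exact_connecting_counit (V : ModuleCat.{u} R) :
    Function.Exact ((connecting K R).app V) ((counit K R).app V) :=
  (Function.Surjective.comp_exact_iff_exact (counit_surjective ((syzygy K R).obj V))).2
    (exact_syzygyInclusion_counit V)

variable {K R} in
lemma exact_connecting_connecting (V : ModuleCat.{u} R) :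
    Function.Exact ((connecting K R).app ((syzygy K R).obj V)) ((connecting K R).app V) :=
  (Function.Injective.comp_exact_iff_exact (syzygyInclusion_injective V)).2
    (exact_connecting_counit ((syzygy K R).obj V))

/-- The complex of functors `⋯ → R ⊗ Ω²V → R ⊗ ΩV → R ⊗ V`. -/
def functorComplex : ChainComplex (ModuleCat.{u} R ⥤ ModuleCat.{u} R) ℕ :=
  ChainComplex.of (fun p => syzygies K R p ⋙ cover K R)
    (fun p => Functor.whiskerLeft (syzygies K R p) (connecting K R)) fun p => by
      ext V x
      exact (exact_connecting_connecting ((syzygies K R p).obj V)).apply_apply_eq_zero x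

lemma functorComplex_d (p : ℕ) : (functorComplex K R).d (p + 1) p =
    Functor.whiskerLeft (syzygies K R p) (connecting K R) :=
  ChainComplex.of_d (fun p => syzygies K R p ⋙ cover K R)
    (fun p => Functor.whiskerLeft (syzygies K R p) (connecting K R)) p

instance additive_functorComplex (p : ℕ) : ((functorComplex K R).X p).Additive :=
  inferInstanceAs (syzygies K R p ⋙ cover K R).Additive

end Cover

end FreeCover

lemma exactAt_succ_iff {R : Type u} [Ring R] (W : ChainComplex (ModuleCat.{u} R) ℕ) (p : ℕ) :
    W.ExactAt (p + 1) ↔ Function.Exact (W.d (p + 2) (p + 1)) (W.d (p + 1) p) :=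
  (W.exactAt_iff' (p + 2) (p + 1) p (by simp) (by simp)).trans
    (ShortComplex.ShortExact.moduleCat_exact_iff_function_exact _)

namespace FreeCover

open scoped ModuleCat

variable (K : Type u) {R : Type u} [Field K] [Ring R] [Algebra K R]

instance (V : ModuleCat.{u} R) : Projective ((cover K R).obj V) :=
  ModuleCat.projective_of_categoryTheory_projective (ModuleCat.of R (R ⊗[K] V))

/-- The complex `⋯ → R ⊗ Ω²V → R ⊗ ΩV → R ⊗ V`. -/
abbrev complex (V : ModuleCat.{u} R) : ChainComplex (ModuleCat.{u} R) ℕ :=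
  (((evaluation _ _).obj V).mapHomologicalComplex _).obj (functorComplex K R)

lemma complex_d (V : ModuleCat.{u} R) (p : ℕ) :
    (complex K V).d (p + 1) p = (connecting K R).app ((syzygies K R p).obj V) :=
  NatTrans.congr_app (functorComplex_d K R p) V

lemma complex_exactAt_succ (V : ModuleCat.{u} R) (p : ℕ) : (complex K V).ExactAt (p + 1) := by
  rw [exactAt_succ_iff, complex_d, complex_d]
  exact exact_connecting_connecting ((syzygies K R p).obj V)

lemma complex_d_comp_counit (V : ModuleCat.{u} R) :
    (complex K V).d 1 0 ≫ (counit K R).app V = 0 := by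
  rw [complex_d]
  ext x
  exact (exact_connecting_counit V).apply_apply_eq_zero x

lemma exact_complex_d_counit (V : ModuleCat.{u} R) :
    (ShortComplex.mk _ _ (complex_d_comp_counit K V)).Exact := by
  refine (ShortComplex.ShortExact.moduleCat_exact_iff_function_exact _).2 ?_
  change Function.Exact ((complex K V).d 1 0) ((counit K R).app V)
  rw [complex_d]
  exact exact_connecting_counit V

/-- The projective resolution `⋯ → R ⊗ Ω²V → R ⊗ ΩV → R ⊗ V → V`. Unlike the resolutions provided
by enough projectives, it is exact and functorial in `V`. -/
def resolution (V : ModuleCat.{u} R) : ProjectiveResolution V where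
  complex := complex K V
  projective p := inferInstanceAs (Projective ((cover K R).obj _))
  π := (ChainComplex.toSingle₀Equiv _ _).symm ⟨(counit K R).app V, complex_d_comp_counit K V⟩
  quasiIso := ⟨fun n => by
    cases n
    · rw [ChainComplex.quasiIsoAt₀_iff, ShortComplex.quasiIso_iff_of_zeros' _ rfl rfl rfl]
      exact ⟨exact_complex_d_counit K V, inferInstanceAs (Epi ((counit K R).app V))⟩
    · exact (quasiIsoAt_iff_exactAt' _ _ (ChainComplex.exactAt_succ_single_obj _ _)).2
        (complex_exactAt_succ K V _)⟩

section SpectralSequence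

variable (F : ModuleCat.{u} R ⥤ ModuleCat.{u} K) [F.Additive]

/-- The complex of functors `⋯ → F (R ⊗ Ω²V) → F (R ⊗ ΩV) → F (R ⊗ V)`, whose homology computes the
left derived functors of `F`. -/
abbrev derivingComplex : ChainComplex (ModuleCat.{u} R ⥤ ModuleCat.{u} K) ℕ :=
  (((Functor.whiskeringRight _ _ _).obj F).mapHomologicalComplex _).obj (functorComplex K R)

instance (p : ℕ) : ((derivingComplex K F).X p).Additive :=
  inferInstanceAs ((functorComplex K R).X p ⋙ F).Additive

instance preservesHomology_derivingComplex (p : ℕ) :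
    ((derivingComplex K F).X p).PreservesHomology := by
  refine (((derivingComplex K F).X p).exact_tfae.out 0 2).1 fun S hS => ?_
  have h : ((S.map (syzygies K R p)).map (cover K R)).ShortExact :=
    shortExact_map_cover (shortExact_map_syzygies p hS)
  have : Projective ((S.map (syzygies K R p)).map (cover K R)).X₃ :=
    inferInstanceAs (Projective ((cover K R).obj _))
  exact (h.splittingOfProjective.map F).shortExact

/-- The double complex of the modules `F (R ⊗ Ωᵖ C_q)`. -/
abbrev doubleComplex (C : ChainComplex (ModuleCat.{u} R) ℕ) : DoubleComplex K :=
  applyTermwise (derivingComplex K F) C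

def columnHomologyIsoLeftDerived (C : ChainComplex (ModuleCat.{u} R) ℕ) (p q : ℕ) :
    ((doubleComplex K F C).columnHomology q).homology p ≅
      (F.leftDerived p).obj (C.homology q) :=
  (HomologicalComplex.homologyFunctor _ _ p).mapIso
      (applyTermwiseHomologyIso (derivingComplex K F) C q) ≪≫
    ((resolution K (C.homology q)).isoLeftDerivedObj F p).symm

lemma row_exact {V : ModuleCat.{u} R} {p : ℕ}
    (hV : Limits.IsZero ((F.leftDerived (p + 1)).obj V)) :
    Function.Exact (((derivingComplex K F).d (p + 2) (p + 1)).app V)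
      (((derivingComplex K F).d (p + 1) p).app V) :=
  (exactAt_succ_iff _ p).1 <| (HomologicalComplex.exactAt_iff_isZero_homology _ _).2 <|
    (((resolution K V).isoLeftDerivedObj F (p + 1)).isZero_iff).1 hV

/-- The chain map `F (R ⊗ C) → F C` induced by the action maps. -/
def augmentation (C : ChainComplex (ModuleCat.{u} R) ℕ) :
    (doubleComplex K F C).X 0 ⟶ (F.mapHomologicalComplex _).obj C :=
  (NatTrans.mapHomologicalComplex (Functor.whiskerRight (counit K R) F) _).app C

variable [Limits.PreservesFiniteColimits F]

lemma augmentation_exact (V : ModuleCat.{u} R) :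
    Function.Exact (((derivingComplex K F).d 1 0).app V) (F.map ((counit K R).app V)) ∧
      Function.Surjective (F.map ((counit K R).app V)) := by
  obtain ⟨hexact, hepi⟩ := ((F.preservesFiniteColimits_tfae.out 3 1 rfl rfl).1 ‹_›) _
    ⟨exact_complex_d_counit K V, inferInstanceAs (Epi ((counit K R).app V))⟩
  exact ⟨(ShortComplex.ShortExact.moduleCat_exact_iff_function_exact _).1 hexact,
    (ModuleCat.epi_iff_surjective _).1 hepi⟩

theorem exists_spectralSequence {C : ChainComplex (ModuleCat.{u} R) ℕ}
    (hC : ∀ p q, Limits.IsZero ((F.leftDerived (p + 1)).obj (C.X q))) :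
    ∃ E : FirstQuadrantHomologySS K,
      (∀ p q : ℕ, Nonempty ((E.page 2 le_rfl).X (p, q) ≅
        (F.leftDerived p).obj (C.homology q))) ∧
      E.ConvergesTo fun n => ((F.mapHomologicalComplex _).obj C).homology n := by
  obtain ⟨E, hE, hconv⟩ := DoubleComplex.exists_spectralSequence
    (D := doubleComplex K F C) (ε := augmentation K F C) (fun p q => row_exact K F (hC p q))
    (fun q => (augmentation_exact K F (C.X q)).1) (fun q => (augmentation_exact K F (C.X q)).2)
  exact ⟨E, fun p q => ⟨(hE p q).some ≪≫ columnHomologyIsoLeftDerived K F C p q⟩, hconv⟩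

end SpectralSequence

end FreeCover

/-! ### Balanced tensor products -/

namespace BalancedTensor

section Lift

variable {K R : Type u} [CommRing K] [Ring R] {X : Type u} [AddCommGroup X] [Module K X]
  [Module Rᵐᵒᵖ X] {Y : Type u} [AddCommGroup Y] [Module R Y]
  {P : Type*} [AddCommGroup P] [Module K P]

/-- The map out of `X ⊗_R Y` given by a balanced biadditive map which is `K`-linear in the first
variable. -/
def lift (f : X →ₗ[K] Y →+ P) (h : ∀ x (r : R) y, f (op r • x) y = f x (r • y)) :
    BalancedTensor K R X Y →ₗ[K] P :=
  Submodule.liftQ _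
    (TensorProduct.AlgebraTensorModule.lift ((addMonoidHomLequivInt K).toLinearMap ∘ₗ f)) <| by
      rw [balancedRel, Submodule.span_le]
      rintro _ ⟨x, r, y, rfl⟩
      rw [SetLike.mem_coe, LinearMap.mem_ker, map_sub, sub_eq_zero]
      exact h x r y

end Lift

section RightExact

variable {K R : Type u} [CommRing K] [Ring R] {X : Type u} [AddCommGroup X] [Module K X]
  [Module Rᵐᵒᵖ X] {Y Y' : Type u} [AddCommGroup Y] [Module R Y] [AddCommGroup Y'] [Module R Y']

lemma balancedRel_le_map {g : Y →ₗ[R] Y'} (hg : Function.Surjective g) :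
    balancedRel K R X Y' ≤ (balancedRel K R X Y).map
      (TensorProduct.AlgebraTensorModule.map (.id : X →ₗ[K] X)
        g.toAddMonoidHom.toIntLinearMap) := by
  rw [balancedRel, Submodule.span_le]
  rintro _ ⟨x, r, y, rfl⟩
  obtain ⟨y, rfl⟩ := hg y
  refine ⟨_, Submodule.subset_span ⟨x, r, y, rfl⟩, ?_⟩
  rw [map_sub, ← map_smul]
  rfl

variable (K X) [SMulCommClass K Rᵐᵒᵖ X]

lemma surjective_map_tensorFunctor {V W : ModuleCat.{u} R} {g : V ⟶ W}
    (hg : Function.Surjective g) : Function.Surjective ((tensorFunctor K R X).map g) := by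
  intro z
  induction z using BalancedTensor.induction with
  | hmk x y =>
    obtain ⟨y, rfl⟩ := hg y
    exact ⟨mk K R x y, rfl⟩
  | hadd z w hz hw =>
    obtain ⟨z, rfl⟩ := hz
    obtain ⟨w, rfl⟩ := hw
    exact ⟨z + w, map_add _ _ _⟩

lemma exact_map_tensorFunctor {S : ShortComplex (ModuleCat.{u} R)} (hS : S.Exact)
    (hg : Function.Surjective S.g) : (S.map (tensorFunctor K R X)).Exact := by
  rw [ShortComplex.moduleCat_exact_iff]
  intro z hz
  obtain ⟨z, rfl⟩ := Submodule.Quotient.mk_surjective _ z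
  let G : X ⊗[ℤ] S.X₂ →ₗ[K] X ⊗[ℤ] S.X₃ :=
    TensorProduct.AlgebraTensorModule.map .id S.g.hom.toAddMonoidHom.toIntLinearMap
  have hGz : G z ∈ balancedRel K R X S.X₃ := (Submodule.Quotient.mk_eq_zero _).1 hz
  obtain ⟨w, hw, hwz⟩ := balancedRel_le_map hg hGz
  have hex : Function.Exact S.f.hom.toAddMonoidHom.toIntLinearMap
      S.g.hom.toAddMonoidHom.toIntLinearMap :=
    (ShortComplex.ShortExact.moduleCat_exact_iff_function_exact S).1 hS
  have hzw : G (z - w) = 0 := by rw [map_sub, sub_eq_zero]; exact hwz.symm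
  obtain ⟨v, hv⟩ := (lTensor_exact X hex hg (z - w)).1 hzw
  refine ⟨Submodule.Quotient.mk v, (Submodule.Quotient.eq _).2 ?_⟩
  change LinearMap.lTensor X _ v - z ∈ _
  rw [hv, sub_sub_cancel_left]
  exact neg_mem hw

instance preservesFiniteColimits_tensorFunctor :
    Limits.PreservesFiniteColimits (tensorFunctor K R X) :=
  ((Functor.preservesFiniteColimits_tfae (tensorFunctor K R X)).out 0 3 rfl rfl).1 fun S hS =>
    have hg : Function.Surjective S.g := (ModuleCat.epi_iff_surjective _).1 hS.epi_g
    ⟨exact_map_tensorFunctor K X hS.exact hg,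
      (ModuleCat.epi_iff_surjective _).2 (surjective_map_tensorFunctor K X hg)⟩

end RightExact

/-! ### Tensor products with `KE(S)` -/

section KE

variable {K S : Type u} [CommRing K] [InverseMonoid S]

lemma op_algebraMap_smul (k : K) (u : KE K S) :
    op (algebraMap K (MonoidAlgebra K S) k) • u = k • u := by
  rw [trivial_op_smul_def]
  exact LinearMap.congr_fun ((trivialAction K S).commutes k) u

/-- The identity of `S` as an idempotent. -/
def oneIdem (S : Type u) [InverseMonoid S] : Idem S := ⟨1, mul_one 1⟩

variable {Z : Type u} [AddCommGroup Z] [Module (MonoidAlgebra K S) Z]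

lemma mk_single_idem (e : Idem S) (z : Z) :
    mk K (MonoidAlgebra K S) (Finsupp.single e 1 : KE K S) z =
      mk K _ (Finsupp.single (oneIdem S) 1) (MonoidAlgebra.of K S e.1 • z) := by
  have he : e = ⟨e.1⁻¹ * (oneIdem S).1 * e.1, conj_idem e.1 (oneIdem S).2⟩ :=
    Subtype.ext (by change e.1 = e.1⁻¹ * 1 * e.1; rw [inv_of_idem e.2, mul_one, e.2])
  rw [← mk_smul, op_of_smul_single, ← he]

lemma mk_single (e : Idem S) (k : K) (z : Z) :
    mk K (MonoidAlgebra K S) (Finsupp.single e k : KE K S) z =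
      mk K _ (Finsupp.single e 1) (algebraMap K (MonoidAlgebra K S) k • z) := by
  rw [← mk_smul, op_algebraMap_smul, Finsupp.smul_single, smul_eq_mul, mul_one]

lemma exists_eq_mk_one (t : BalancedTensor K (MonoidAlgebra K S) (KE K S) Z) :
    ∃ z, t = mk K _ (Finsupp.single (oneIdem S) 1) z := by
  induction t using BalancedTensor.induction with
  | hadd z w hz hw =>
    obtain ⟨z, rfl⟩ := hz
    obtain ⟨w, rfl⟩ := hw
    exact ⟨z + w, (mk_add K _ _ _ _).symm⟩
  | hmk u z =>
    induction u using Finsupp.induction_linear with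
    | zero => exact ⟨0, by rw [zero_mk, mk_zero]⟩
    | add u v hu hv =>
      obtain ⟨z, hz⟩ := hu
      obtain ⟨w, hw⟩ := hv
      exact ⟨z + w, by rw [add_mk, hz, hw, mk_add]⟩
    | single e k => exact ⟨_, by rw [mk_single, mk_single_idem]⟩

variable [Module K Z] {T : Type u} [AddCommGroup T] [Module K T] (f : Idem S → Z →ₗ[K] T)

lemma linearCombination_of_smul
    (hf : ∀ e s z, f e (MonoidAlgebra.of K S s • z) = f ⟨s⁻¹ * e.1 * s, conj_idem s e.2⟩ z)
    (u : KE K S) (s : S) (z : Z) :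
    Finsupp.linearCombination K f (op (MonoidAlgebra.of K S s) • u) z =
      Finsupp.linearCombination K f u (MonoidAlgebra.of K S s • z) := by
  induction u using Finsupp.induction_linear with
  | zero => rw [smul_zero, map_zero, LinearMap.zero_apply, LinearMap.zero_apply]
  | add u v hu hv =>
    rw [smul_add, map_add, map_add, LinearMap.add_apply, LinearMap.add_apply, hu, hv]
  | single e k =>
    have hk : (Finsupp.single e k : KE K S) = k • Finsupp.single e 1 := by
      rw [Finsupp.smul_single, smul_eq_mul, mul_one]
    rw [hk, ← smul_comm, op_of_smul_single, map_smul (Finsupp.linearCombination K f),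
      map_smul (Finsupp.linearCombination K f), LinearMap.smul_apply, LinearMap.smul_apply,
      Finsupp.linearCombination_single, Finsupp.linearCombination_single, one_smul, one_smul, hf]

variable [IsScalarTower K (MonoidAlgebra K S) Z]

lemma linearCombination_smul
    (hf : ∀ e s z, f e (MonoidAlgebra.of K S s • z) = f ⟨s⁻¹ * e.1 * s, conj_idem s e.2⟩ z)
    (u : KE K S) (r : MonoidAlgebra K S) (z : Z) :
    Finsupp.linearCombination K f (op r • u) z = Finsupp.linearCombination K f u (r • z) := by
  induction r using MonoidAlgebra.induction_on generalizing u with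
  | of s => exact linearCombination_of_smul f hf u s z
  | add r r' h h' =>
    rw [MulOpposite.op_add, add_smul, add_smul, map_add, map_add, LinearMap.add_apply, h, h']
  | smul k r h =>
    have hu : op (k • r) • u = op r • k • u := by
      rw [Algebra.smul_def, MulOpposite.op_mul, mul_smul, op_algebraMap_smul]
    rw [hu, h, map_smul (Finsupp.linearCombination K f), LinearMap.smul_apply, smul_assoc,
      map_smul (Finsupp.linearCombination K f u) k]

/-- The linear map `e ⊗ z ↦ f e z` on `KE(S) ⊗_{KS} Z`. -/
def liftKE
    (hf : ∀ e s z, f e (MonoidAlgebra.of K S s • z) = f ⟨s⁻¹ * e.1 * s, conj_idem s e.2⟩ z) :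
    BalancedTensor K (MonoidAlgebra K S) (KE K S) Z →ₗ[K] T :=
  lift ({ LinearMap.toAddMonoidHom' with map_smul' := fun _ _ => rfl } ∘ₗ
    Finsupp.linearCombination K f) (linearCombination_smul f hf)

lemma liftKE_mk
    (hf : ∀ e s z, f e (MonoidAlgebra.of K S s • z) = f ⟨s⁻¹ * e.1 * s, conj_idem s e.2⟩ z)
    (e : Idem S) (z : Z) : liftKE f hf (mk K _ (Finsupp.single e 1) z) = f e z := by
  change Finsupp.linearCombination K f (Finsupp.single e 1) z = _
  rw [Finsupp.linearCombination_single, one_smul]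

end KE

end BalancedTensor

/-! ### The Hochschild functor as a composite -/

section Env

variable (K R : Type u) [CommRing K] [Ring R] [Algebra K R]

/-- The homomorphism `R → R^e` giving the left action of `R` on an `R`-bimodule. -/
abbrev envLeft : R →ₐ[K] Env K R := Algebra.TensorProduct.includeLeft

/-- The homomorphism `R^op → R^e` giving the right action of `R` on an `R`-bimodule. -/
abbrev envRight : Rᵐᵒᵖ →ₐ[K] Env K R := Algebra.TensorProduct.includeRight

variable {K R}

lemma envLeft_mul_envRight (a : R) (b : Rᵐᵒᵖ) : envLeft K R a * envRight K R b = a ⊗ₜ b := by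
  simp

lemma envRight_mul_envLeft (a : R) (b : Rᵐᵒᵖ) : envRight K R b * envLeft K R a = a ⊗ₜ b := by
  simp

lemma op_envLeft_smul (a x : R) : op (envLeft K R a) • x = x * a :=
  (op_tmul_smul K R a 1 x).trans (by rw [one_mul])

lemma op_envRight_smul (a x : R) : op (envRight K R (op a)) • x = a * x :=
  (op_tmul_smul K R 1 a x).trans (by rw [mul_one])

lemma env_induction {p : Env K R → Prop} (r : Env K R) (left : ∀ a, p (envLeft K R a))
    (right : ∀ a, p (envRight K R (op a))) (add : ∀ r s, p r → p s → p (r + s))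
    (mul : ∀ r s, p r → p s → p (r * s)) : p r := by
  induction r using TensorProduct.induction_on with
  | zero => exact map_zero (envLeft K R) ▸ left 0
  | tmul a b => exact envLeft_mul_envRight (K := K) a b ▸ mul _ _ (left a) (right (unop b))
  | add r s hr hs => exact add r s hr hs

variable {M : Type u} [AddCommGroup M] [Module (Env K R) M]

lemma envLeft_mul_smul (a b : R) (x : M) :
    envLeft K R (a * b) • x = envLeft K R a • envLeft K R b • x := by
  rw [map_mul, mul_smul]

lemma envRight_mul_smul (a b : R) (x : M) :
    envRight K R (op (a * b)) • x = envRight K R (op b) • envRight K R (op a) • x := by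
  rw [op_mul, map_mul, mul_smul]

lemma envLeft_smul_envRight_smul (a : R) (b : Rᵐᵒᵖ) (x : M) :
    envLeft K R a • envRight K R b • x = envRight K R b • envLeft K R a • x := by
  rw [← mul_smul, ← mul_smul, envLeft_mul_envRight, envRight_mul_envLeft]

variable {Q : Type u} [AddCommGroup Q] [Module K Q] (f : M →+ Q)
  (hf : ∀ a (x : M), f (envLeft K R a • x) = f (envRight K R (op a) • x))
  (hK : ∀ k (x : M), f (envLeft K R (algebraMap K R k) • x) = k • f x)

/-- The map `a ⊗ x ↦ f (a x)` on `R ⊗_{R^e} M` induced by a trace on `M`, i.e. a map `f` with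
`f (a x) = f (x a)`. -/
def traceLift : BalancedTensor K (Env K R) R M →ₗ[K] Q :=
  BalancedTensor.lift
    { toFun := fun a => f.comp (DistribSMul.toAddMonoidHom M (envLeft K R a))
      map_add' := fun a b => AddMonoidHom.ext fun x => by
        change f (envLeft K R (a + b) • x) = f (envLeft K R a • x) + f (envLeft K R b • x)
        rw [map_add, add_smul, map_add]
      map_smul' := fun k a => AddMonoidHom.ext fun x => by
        change f (envLeft K R (k • a) • x) = k • f (envLeft K R a • x)
        rw [Algebra.smul_def, envLeft_mul_smul, hK] }
    (fun a r x => by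
      change f (envLeft K R (op r • a) • x) = f (envLeft K R a • r • x)
      induction r using env_induction generalizing a x with
      | left b => rw [op_envLeft_smul, envLeft_mul_smul]
      | right b => rw [op_envRight_smul, envLeft_mul_smul, hf, envLeft_smul_envRight_smul]
      | add r s hr hs => rw [MulOpposite.op_add, add_smul, map_add, add_smul, map_add, hr, hs,
          ← map_add, ← smul_add, ← add_smul]
      | mul r s hr hs => rw [op_mul, mul_smul, hs, hr, mul_smul])

end Env

namespace UnitalAction

variable {K A S : Type u} [CommRing K] [Ring A] [Algebra K A] [InverseMonoid S]
  (α : UnitalAction K A S)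

lemma toCrossed_δ_eq {s t : S} (h : NatLE s t) (a : A) (hs : α.unit s * a = a)
    (ht : α.unit t * a = a) : α.toCrossed (α.δ s a hs) = α.toCrossed (α.δ t a ht) := by
  refine Ideal.Quotient.eq.2 ?_
  rw [TwoSidedIdeal.mem_asIdeal]
  exact TwoSidedIdeal.subset_span ⟨s, t, a, hs, ht, h, rfl⟩

lemma Γ_idem {e : S} (he : e * e = e) : α.Γ e = α.ι (α.unit e) :=
  α.toCrossed_δ_eq ⟨e, he, (mul_one _).symm⟩ _ (α.unit_idem _) (by rw [α.unit_one, one_mul])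

lemma ι_unit_mul_Γ (s : S) : α.ι (α.unit s) * α.Γ s = α.Γ s := by
  rw [← act_one, ← Γ_mul_ι, map_one, mul_one]

lemma toCrossed_δ (s : S) (a : A) (h : α.unit s * a = a) :
    α.toCrossed (α.δ s a h) = α.ι a * α.Γ s := by
  refine (congrArg α.toCrossed (Subtype.ext ?_)).trans (map_mul α.toCrossed
    (α.δ 1 a (by rw [α.unit_one, one_mul])) (α.δ s (α.unit s) (α.unit_idem s)))
  refine Eq.trans ?_ (α.lmul_single 1 s a (α.unit s)).symm
  rw [act_unit, one_mul, ← unit_central, h]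
  rfl

lemma toCrossed_eq_sum (f : α.L) :
    α.toCrossed f = ∑ s ∈ f.1.support, α.ι (f.1 s) * α.Γ s := by
  have h : f = ∑ s ∈ f.1.support, α.δ s (f.1 s) (f.2 s) := Subtype.ext <| by
    refine Eq.trans ?_ (map_sum α.lSubmodule.subtype _ _).symm
    exact (Finsupp.sum_single f.1).symm
  nth_rw 1 [h]
  rw [map_sum]
  exact Finset.sum_congr rfl fun s _ => α.toCrossed_δ s _ _

lemma crossedProduct_induction {p : α.CrossedProduct → Prop} (b : α.CrossedProduct)
    (zero : p 0) (add : ∀ x y, p x → p y → p (x + y))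
    (single : ∀ (a : A) (s : S), p (α.ι a * α.Γ s)) : p b := by
  obtain ⟨f, rfl⟩ := Ideal.Quotient.mk_surjective b
  exact (α.toCrossed_eq_sum f).symm ▸ Finset.sum_induction _ p add zero fun s _ => single _ s

lemma envMap_envLeft (a : A) : α.envMap (envLeft K A a) = envLeft K α.CrossedProduct (α.ι a) :=
  congrArg (α.ι a ⊗ₜ[K] ·) (map_one (AlgHom.op α.ι))

lemma envMap_envRight (a : A) :
    α.envMap (envRight K A (op a)) = envRight K α.CrossedProduct (op (α.ι a)) :=
  congrArg (· ⊗ₜ[K] op (α.ι a)) (map_one α.ι)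

lemma conj_eq (s : S) : α.conj s = envLeft K _ (α.Γ s) * envRight K _ (op (α.Γ s⁻¹)) :=
  (envLeft_mul_envRight _ _).symm

variable (M : ModuleCat.{u} (Env K α.CrossedProduct))

instance : IsScalarTower K (MonoidAlgebra K S) (α.F₁Obj M) where
  smul_assoc k r z := by
    rw [diag_smul_def, diag_smul_def, map_smul, LinearMap.smul_apply]

/-- The map `x ↦ 1 ⊗ x` from `M` to `A ⊗_{A^e} M`. -/
def mkOne : M →+ α.F₁Obj M :=
  AddMonoidHom.mk' (fun x => BalancedTensor.mk K (Env K A) (1 : A) (show α.restrict M from x))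
    fun _ _ => BalancedTensor.mk_add K _ _ _ _

lemma mk_eq_mkOne (a : A) (x : M) :
    BalancedTensor.mk K (Env K A) a (show α.restrict M from x) =
      α.mkOne M (envLeft K _ (α.ι a) • x) := by
  nth_rw 1 [← one_mul a]
  rw [← op_envLeft_smul (K := K), BalancedTensor.mk_smul, ← envMap_envLeft]
  rfl

lemma mkOne_surjective : Function.Surjective (α.mkOne M) := fun z => by
  induction z using BalancedTensor.induction with
  | hmk a x => exact ⟨_, (α.mk_eq_mkOne M a x).symm⟩
  | hadd z w hz hw =>
    obtain ⟨⟨x, rfl⟩, ⟨y, rfl⟩⟩ := And.intro hz hw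
    exact ⟨x + y, map_add _ _ _⟩

lemma mkOne_envLeft_smul (a : A) (x : M) :
    α.mkOne M (envLeft K _ (α.ι a) • x) = α.mkOne M (envRight K _ (op (α.ι a)) • x) := by
  refine (α.mk_eq_mkOne M a x).symm.trans ?_
  nth_rw 1 [← mul_one a]
  rw [← op_envRight_smul (K := K), BalancedTensor.mk_smul, ← envMap_envRight]
  rfl

lemma of_smul_mkOne (s : S) (x : M) :
    MonoidAlgebra.of K S s • α.mkOne M x = α.mkOne M (α.conj s • x) := by
  refine (α.of_smul_mk M s 1 x).trans ?_
  rw [act_one]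
  refine (α.mk_eq_mkOne M (α.unit s) (α.conj s • x)).trans ?_
  rw [← mul_smul, conj_eq, ← mul_assoc, ← map_mul, ι_unit_mul_Γ]

lemma of_idem_smul_mkOne {e : S} (he : e * e = e) (x : M) :
    MonoidAlgebra.of K S e • α.mkOne M x = α.mkOne M (envRight K _ (op (α.Γ e)) • x) := by
  rw [of_smul_mkOne, conj_eq, inv_of_idem he, mul_smul, Γ_idem α he, mkOne_envLeft_smul,
    ← envRight_mul_smul, ← map_mul, unit_idem]

lemma of_smul_mkOne_envRight_smul (a : A) (s : S) (x : M) :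
    MonoidAlgebra.of K S s • α.mkOne M (envRight K _ (op (α.ι a * α.Γ s)) • x) =
      α.mkOne M (envLeft K _ (α.ι a * α.Γ s) • x) := by
  rw [of_smul_mkOne, conj_eq, mul_smul, envRight_mul_smul, ← envRight_mul_smul (α.Γ s),
    envLeft_smul_envRight_smul, ← map_mul, Γ_idem α (mul_inv_idem s), ← mkOne_envLeft_smul,
    ← Γ_idem α (mul_inv_idem s), ← envLeft_mul_smul, ← map_mul, mul_inv_mul_self,
    envLeft_smul_envRight_smul, ← mkOne_envLeft_smul, envLeft_mul_smul]

lemma mkOne_envLeft_algebraMap_smul (k : K) (x : M) :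
    α.mkOne M (envLeft K _ (algebraMap K α.CrossedProduct k) • x) = k • α.mkOne M x := by
  rw [← α.ι.commutes, ← mk_eq_mkOne, Algebra.algebraMap_eq_smul_one]
  rfl

variable {M} {Q : Type u} [AddCommGroup Q] [Module K Q] (f : M →+ Q)
    (hf : ∀ a (x : M), f (envLeft K _ (α.ι a) • x) = f (envRight K _ (op (α.ι a)) • x))
    (hK : ∀ k (x : M), f (envLeft K _ (algebraMap K α.CrossedProduct k) • x) = k • f x)

/-- The map on `A ⊗_{A^e} M` induced by a map `f` on `M` with `f (a x) = f (x a)` for all `a` in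
`A`. -/
def F₁Lift : α.F₁Obj M →ₗ[K] Q :=
  traceLift (M := α.restrict M) f
    (fun a x => (congrArg (fun r => f (r • (show M from x))) (α.envMap_envLeft a)).trans
      ((hf a x).trans (congrArg (fun r => f (r • (show M from x))) (α.envMap_envRight a)).symm))
    (fun k x => (congrArg (fun r => f (r • (show M from x))) (α.envMap_envLeft _)).trans
      ((congrArg (fun b => f (envLeft K _ b • (show M from x))) (α.ι.commutes k)).trans (hK k x)))

lemma F₁Lift_mkOne (x : M) :
    α.F₁Lift f hf hK (α.mkOne M x) = f x :=
  (congrArg f (congrArg (· • (show α.restrict M from x)) (map_one (envLeft K A)))).trans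
    (congrArg f (one_smul (Env K A) (show α.restrict M from x)))

variable (M)

/-- The map `1 ⊗ x ↦ Γ e ⊗ x` from `A ⊗_{A^e} M` to `B ⊗_{B^e} M`, where `B` is the crossed
product. -/
def ΓTensor (e : Idem S) :
    α.F₁Obj M →ₗ[K] BalancedTensor K (Env K α.CrossedProduct) α.CrossedProduct M :=
  α.F₁Lift (AddMonoidHom.mk' (fun x => BalancedTensor.mk K _ (α.Γ e.1) x)
      (BalancedTensor.mk_add K _ _))
    (fun a x => by
      change BalancedTensor.mk K _ _ _ = BalancedTensor.mk K _ _ _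
      rw [← BalancedTensor.mk_smul, ← BalancedTensor.mk_smul, op_envLeft_smul, op_envRight_smul,
        Γ_idem α e.2, ← map_mul, ← map_mul, unit_central])
    (fun k x => by
      change BalancedTensor.mk K _ _ _ = k • BalancedTensor.mk K _ _ _
      rw [← BalancedTensor.mk_smul, op_envLeft_smul, ← Algebra.commutes, ← Algebra.smul_def]
      rfl)

lemma ΓTensor_mkOne (e : Idem S) (x : M) : α.ΓTensor M e (α.mkOne M x) =
    BalancedTensor.mk K (Env K α.CrossedProduct) (α.Γ e.1) x :=
  α.F₁Lift_mkOne _ _ _ x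

lemma ΓTensor_of_smul (e : Idem S) (s : S) (z : α.F₁Obj M) :
    α.ΓTensor M e (MonoidAlgebra.of K S s • z) =
      α.ΓTensor M ⟨s⁻¹ * e.1 * s, conj_idem s e.2⟩ z := by
  obtain ⟨x, rfl⟩ := α.mkOne_surjective M z
  rw [of_smul_mkOne, ΓTensor_mkOne, ΓTensor_mkOne, ← BalancedTensor.mk_smul, map_mul, map_mul]
  exact congrArg (BalancedTensor.mk K _ · x) (op_tmul_smul K _ _ _ _)

/-- The map `e ⊗ (1 ⊗ x) ↦ Γ e ⊗ x` from `KE(S) ⊗_{KS} (A ⊗_{A^e} M)` to `B ⊗_{B^e} M`, where `B`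
is the crossed product. -/
def compositeMap : BalancedTensor K (MonoidAlgebra K S) (KE K S) (α.F₁Obj M) →ₗ[K]
    BalancedTensor K (Env K α.CrossedProduct) α.CrossedProduct M :=
  BalancedTensor.liftKE (α.ΓTensor M) (α.ΓTensor_of_smul M)

/-- The map `x ↦ 1 ⊗ (1 ⊗ x)` from `M` to `KE(S) ⊗_{KS} (A ⊗_{A^e} M)`. It identifies `b x` with
`x b` for every `b` in the crossed product, see `trace_envLeft_smul`. -/
def trace : M →+ BalancedTensor K (MonoidAlgebra K S) (KE K S) (α.F₁Obj M) :=
  (AddMonoidHom.mk' (fun z => BalancedTensor.mk K _ (Finsupp.single (BalancedTensor.oneIdem S) 1) z)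
    (BalancedTensor.mk_add K _ _)).comp (α.mkOne M)

lemma trace_apply (x : M) : α.trace M x =
    BalancedTensor.mk K _ (Finsupp.single (BalancedTensor.oneIdem S) 1) (α.mkOne M x) := rfl

lemma trace_surjective : Function.Surjective (α.trace M) := fun z => by
  obtain ⟨z, rfl⟩ := BalancedTensor.exists_eq_mk_one z
  obtain ⟨x, rfl⟩ := α.mkOne_surjective M z
  exact ⟨x, rfl⟩

lemma compositeMap_trace (x : M) :
    α.compositeMap M (α.trace M x) = BalancedTensor.mk K (Env K α.CrossedProduct) 1 x := by
  refine (BalancedTensor.liftKE_mk _ _ _ _).trans ?_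
  rw [ΓTensor_mkOne, BalancedTensor.oneIdem, map_one]

lemma trace_envLeft_smul (b : α.CrossedProduct) (x : M) :
    α.trace M (envLeft K _ b • x) = α.trace M (envRight K _ (op b) • x) := by
  induction b using α.crossedProduct_induction with
  | zero => rw [op_zero, map_zero, map_zero]
  | add b c hb hc =>
    rw [MulOpposite.op_add, map_add, map_add, add_smul, add_smul, map_add, map_add, hb, hc]
  | single a s =>
    have one_smul_of : op (MonoidAlgebra.of K S s) •
        Finsupp.single (BalancedTensor.oneIdem S) (1 : K) =
          Finsupp.single ⟨s⁻¹ * s, inv_mul_idem s⟩ 1 := by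
      rw [op_of_smul_single]
      exact congrArg (Finsupp.single · 1) (Subtype.ext (congrArg (· * s) (mul_one s⁻¹)))
    rw [trace_apply, ← of_smul_mkOne_envRight_smul, ← BalancedTensor.mk_smul, one_smul_of,
      BalancedTensor.mk_single_idem, of_idem_smul_mkOne α M (inv_mul_idem s),
      ← envRight_mul_smul, mul_assoc, ← map_mul, ← mul_assoc, mul_inv_mul_self, trace_apply]

lemma trace_envLeft_algebraMap_smul (k : K) (x : M) :
    α.trace M (envLeft K _ (algebraMap K α.CrossedProduct k) • x) = k • α.trace M x := by
  have h : k • α.mkOne M x = algebraMap K (MonoidAlgebra K S) k • α.mkOne M x :=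
    (algebraMap_smul _ _ _).symm
  rw [trace_apply, mkOne_envLeft_algebraMap_smul, h, ← BalancedTensor.mk_smul,
    BalancedTensor.op_algebraMap_smul]
  rfl

/-- The map `b ⊗ x ↦ 1 ⊗ (1 ⊗ b x)`. -/
def compositeInv : BalancedTensor K (Env K α.CrossedProduct) α.CrossedProduct M →ₗ[K]
    BalancedTensor K (MonoidAlgebra K S) (KE K S) (α.F₁Obj M) :=
  traceLift (α.trace M) (α.trace_envLeft_smul M) (α.trace_envLeft_algebraMap_smul M)

lemma compositeInv_mk (b : α.CrossedProduct) (x : M) :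
    α.compositeInv M (BalancedTensor.mk K _ b x) = α.trace M (envLeft K _ b • x) := rfl

lemma compositeMap_comp_compositeInv : α.compositeMap M ∘ₗ α.compositeInv M = .id :=
  BalancedTensor.hom_ext fun b x => by
    rw [LinearMap.comp_apply, compositeInv_mk, compositeMap_trace, ← BalancedTensor.mk_smul,
      op_envLeft_smul, one_mul, LinearMap.id_apply]

lemma compositeInv_comp_compositeMap : α.compositeInv M ∘ₗ α.compositeMap M = .id :=
  LinearMap.ext fun z => by
    obtain ⟨x, rfl⟩ := α.trace_surjective M z
    rw [LinearMap.comp_apply, compositeMap_trace, compositeInv_mk, map_one, one_smul,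
      LinearMap.id_apply]

lemma compositeMap_map {M N : ModuleCat.{u} (Env K α.CrossedProduct)} (f : M ⟶ N)
    (z : BalancedTensor K (MonoidAlgebra K S) (KE K S) (α.F₁Obj M)) :
    α.compositeMap N ((tensorFunctor K (MonoidAlgebra K S) (KE K S)).map (α.F₁.map f) z) =
      (tensorFunctor K (Env K α.CrossedProduct) α.CrossedProduct).map f (α.compositeMap M z) := by
  obtain ⟨x, rfl⟩ := α.trace_surjective M z
  refine (α.compositeMap_trace N (f.hom x)).trans ?_
  rw [compositeMap_trace]
  rfl

/-- `KE(S) ⊗_{KS} (A ⊗_{A^e} M) ≅ B ⊗_{B^e} M`, where `B` is the crossed product. -/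
def compositeIso : α.F₁ ⋙ tensorFunctor K (MonoidAlgebra K S) (KE K S) ≅
    tensorFunctor K (Env K α.CrossedProduct) α.CrossedProduct :=
  NatIso.ofComponents
    (fun M => (LinearEquiv.ofLinearMap (α.compositeMap M) (α.compositeInv M)
      (α.compositeMap_comp_compositeInv M) (α.compositeInv_comp_compositeMap M)).toModuleIso)
    (fun f => ModuleCat.hom_ext (LinearMap.ext (α.compositeMap_map f)))

end UnitalAction

/-! ### Induction from the idempotents -/

/-- A commutative ring is von Neumann regular if every element has an inner inverse. -/
def IsVonNeumannRegular (R : Type*) [CommRing R] : Prop :=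
  ∀ r : R, ∃ x, r * x * r = r

section VonNeumannRegular

variable {R : Type*} [CommRing R]

lemma IsVonNeumannRegular.isIdempotentElem_ideal (hR : IsVonNeumannRegular R) (I : Ideal R) :
    IsIdempotentElem I := by
  refine le_antisymm Ideal.mul_le_left fun r hr => ?_
  obtain ⟨x, hx⟩ := hR r
  rw [← hx]
  exact Ideal.mul_mem_mul (I.mul_mem_right x hr) hr

theorem IsVonNeumannRegular.flat (hR : IsVonNeumannRegular R) (M : Type*) [AddCommGroup M]
    [Module R M] : Module.Flat R M := by
  rw [Module.Flat.iff_lTensor_injective]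
  intro I hI
  obtain ⟨e, he, rfl⟩ := (Ideal.isIdempotentElem_iff_of_fg I hI).1 (hR.isIdempotentElem_ideal I)
  let proj : R →ₗ[R] (R ∙ e : Ideal R) :=
    LinearMap.toSpanSingleton R _ ⟨e, Ideal.mem_span_singleton_self e⟩
  have hproj : proj ∘ₗ (R ∙ e : Ideal R).subtype = LinearMap.id := by
    refine LinearMap.ext fun ⟨r, hr⟩ => Subtype.ext ?_
    obtain ⟨c, rfl⟩ := Ideal.mem_span_singleton'.1 hr
    change c * e * e = c * e
    rw [mul_assoc, he.eq]
  have hlTensor : proj.lTensor M ∘ₗ (R ∙ e : Ideal R).subtype.lTensor M = LinearMap.id := by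
    rw [← LinearMap.lTensor_comp, hproj, LinearMap.lTensor_id]
  exact Function.LeftInverse.injective (LinearMap.congr_fun hlTensor)

/-- Inner inverses can be glued along the decomposition `R = eR × (1 - e)R`. -/
lemma exists_inner_inverse_of_idempotent {e a b x y : R} (he : e * e = e) (hx : a * x * a = a)
    (hy : b * y * b = b) :
    ∃ z, (a * e + b * (1 - e)) * z * (a * e + b * (1 - e)) = a * e + b * (1 - e) := by
  refine ⟨x * e + y * (1 - e), ?_⟩
  linear_combination e * hx + (1 - e) * hy +
    ((a - b) ^ 2 * y + 2 * b * (a - b) * (x - y) + (e + 1) * (a - b) ^ 2 * (x - y)) * he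

lemma isVonNeumannRegular_monoidAlgebra {K G : Type*} [Field K] [CommMonoid G]
    (hG : ∀ g : G, g * g = g) : IsVonNeumannRegular (MonoidAlgebra K G) := by
  suffices shifted : ∀ (r : MonoidAlgebra K G) (c : K), ∃ x, (r + algebraMap K _ c) * x *
      (r + algebraMap K _ c) = r + algebraMap K _ c by
    intro r
    simpa only [map_zero, add_zero] using shifted r 0
  intro r
  induction r using MonoidAlgebra.induction with
  | zero =>
    intro c
    refine ⟨algebraMap K _ c⁻¹, ?_⟩
    rw [zero_add, ← map_mul, ← map_mul, mul_inv_mul_cancel]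
  | single_add g k r _ _ ih =>
    intro c
    obtain ⟨x, hx⟩ := ih (c + k)
    obtain ⟨y, hy⟩ := ih c
    have hg : MonoidAlgebra.of K G g * MonoidAlgebra.of K G g = MonoidAlgebra.of K G g := by
      rw [← map_mul, hG]
    have hsplit : MonoidAlgebra.single g k + r + algebraMap K _ c =
        (r + algebraMap K _ (c + k)) * MonoidAlgebra.of K G g +
          (r + algebraMap K _ c) * (1 - MonoidAlgebra.of K G g) := by
      have hk : MonoidAlgebra.single g k =
          algebraMap K (MonoidAlgebra K G) k * MonoidAlgebra.of K G g := by
        rw [← Algebra.smul_def, MonoidAlgebra.of_apply, MonoidAlgebra.smul_single,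
          smul_eq_mul, mul_one]
      rw [hk, map_add]
      ring
    rw [hsplit]
    exact exists_inner_inverse_of_idempotent hg hx hy

end VonNeumannRegular

section Induction

variable (R T : Type u) [CommRing R] [Ring T] [Module R T] [SMulCommClass R T T]

/-- The homomorphism `R →+* T` corresponding to an action of the commutative ring `R` on the
right of `T`, which is encoded as a `Module R T` commuting with left multiplication. -/
def rightScalars : R →+* T where
  toFun r := r • 1
  map_one' := one_smul R 1
  map_mul' r r' := by rw [mul_comm r r', mul_smul, mul_smul_comm, mul_one]
  map_zero' := zero_smul R 1
  map_add' r r' := add_smul r r' 1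

variable {R T}

lemma mul_rightScalars (t : T) (r : R) : t * rightScalars R T r = r • t := by
  change t * r • 1 = _
  rw [mul_smul_comm, mul_one]

lemma smul_one_tmul {U : Type*} [AddCommGroup U] [Module R U] (t : T) (u : U) :
    t • ((1 : T) ⊗ₜ[R] u) = t ⊗ₜ[R] u := by
  rw [TensorProduct.smul_tmul', smul_eq_mul, mul_one]

lemma rightScalars_smul_one_tmul {U : Type*} [AddCommGroup U] [Module R U] (r : R) (u : U) :
    rightScalars R T r • ((1 : T) ⊗ₜ[R] u) = (1 : T) ⊗ₜ[R] (r • u) := by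
  rw [smul_one_tmul, ← one_mul (rightScalars R T r), mul_rightScalars,
    TensorProduct.smul_tmul]

lemma tensorProduct_hom_ext_one_tmul {U N : Type*} [AddCommGroup U] [Module R U] [AddCommGroup N]
    [Module T N] {f g : T ⊗[R] U →ₗ[T] N} (h : ∀ u, f (1 ⊗ₜ u) = g (1 ⊗ₜ u)) : f = g := by
  refine LinearMap.ext fun z => ?_
  induction z with
  | zero => rw [map_zero, map_zero]
  | add z w hz hw => rw [map_add, map_add, hz, hw]
  | tmul t u => rw [← smul_one_tmul, map_smul, map_smul, h]

variable (R T) in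
/-- Induction `U ↦ T ⊗[R] U` from `R` to `T`. This is not `ModuleCat.extendScalars` since `T` is
not assumed to be commutative. -/
def induce : ModuleCat.{u} R ⥤ ModuleCat.{u} T where
  obj U := ModuleCat.of T (T ⊗[R] U)
  map f := ModuleCat.ofHom
    { f.hom.lTensor T with
      map_smul' := fun t z => by
        induction z with
        | zero => exact (map_zero (f.hom.lTensor T)).trans (smul_zero t).symm
        | add z w hz hw =>
          refine (congrArg _ (smul_add t z w)).trans ((map_add (f.hom.lTensor T) _ _).trans ?_)
          exact (congrArg₂ _ hz hw).trans
            ((smul_add t _ _).symm.trans (congrArg _ (map_add (f.hom.lTensor T) z w).symm))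
        | tmul t' u => rfl }
  map_id _ := ModuleCat.hom_ext (tensorProduct_hom_ext_one_tmul fun _ => rfl)
  map_comp _ _ := ModuleCat.hom_ext (tensorProduct_hom_ext_one_tmul fun _ => rfl)

variable {U : ModuleCat.{u} R} {N : ModuleCat.{u} T}

/-- The homomorphism `t ⊗ u ↦ t • h u`. -/
def induceLift (h : U ⟶ (ModuleCat.restrictScalars (rightScalars R T)).obj N) :
    T ⊗[R] U →ₗ[T] N where
  toFun := TensorProduct.liftAddHom
    (((smulAddHom T N).flip.comp h.hom.toAddMonoidHom).flip)
    (fun r t u => by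
      change (r • t) • (show N from h.hom u) = t • (show N from h.hom (r • u))
      rw [map_smul, ← mul_rightScalars, mul_smul]
      rfl)
  map_add' := map_add _
  map_smul' t z := by
    induction z with
    | zero => rw [smul_zero, map_zero]; exact (smul_zero t).symm
    | add z w hz hw => rw [smul_add, map_add, map_add, smul_add, hz, hw]
    | tmul t' u => exact mul_smul t t' (show N from h.hom u)

/-- The restriction to `1 ⊗ U` of a homomorphism on `T ⊗[R] U`. -/
def induceRestrict (f : T ⊗[R] U →ₗ[T] N) :
    U ⟶ (ModuleCat.restrictScalars (rightScalars R T)).obj N :=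
  ModuleCat.ofHom (Y := (ModuleCat.restrictScalars (rightScalars R T)).obj N)
    { toFun := fun u => f (1 ⊗ₜ u)
      map_add' := fun _ _ => (congrArg f (TensorProduct.tmul_add _ _ _)).trans (map_add f _ _)
      map_smul' := fun r u =>
        (congrArg f (rightScalars_smul_one_tmul r u).symm).trans (map_smul f _ _) }

variable (R T) in
/-- Frobenius reciprocity. -/
def induceAdjunction : induce R T ⊣ ModuleCat.restrictScalars (rightScalars R T) :=
  Adjunction.mkOfHomEquiv
    { homEquiv := fun _ N =>
        { toFun := fun f => induceRestrict f.hom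
          invFun := fun h => ModuleCat.ofHom (induceLift h)
          left_inv := fun _ => ModuleCat.hom_ext
            (tensorProduct_hom_ext_one_tmul fun _ => one_smul T _)
          right_inv := fun h => ModuleCat.hom_ext <| LinearMap.ext fun _ =>
            one_smul T (show N from h.hom _) }
      homEquiv_naturality_left_symm := fun _ _ =>
        ModuleCat.hom_ext (tensorProduct_hom_ext_one_tmul fun _ => rfl)
      homEquiv_naturality_right := fun _ _ => rfl }

instance : (induce R T).Additive where
  map_add := ModuleCat.hom_ext <|
    tensorProduct_hom_ext_one_tmul fun _ => TensorProduct.tmul_add _ _ _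

instance preservesHomology_restrictScalars {R S : Type u} [Ring R] [Ring S]
    (f : R →+* S) : (ModuleCat.restrictScalars.{u} f).PreservesHomology := by
  refine ((ModuleCat.restrictScalars.{u} f).exact_tfae.out 1 2 rfl rfl).1 fun T hT => ?_
  rw [ShortComplex.ShortExact.moduleCat_exact_iff_function_exact] at hT ⊢
  exact hT

instance : (induce R T).PreservesProjectiveObjects :=
  Functor.preservesProjectiveObjects_of_adjunction_of_preservesEpimorphisms (induceAdjunction R T)

lemma preservesHomology_induce [Module.Flat R T] : (induce R T).PreservesHomology := by
  refine ((induce R T).exact_tfae.out 1 2 rfl rfl).1 fun T hT => ?_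
  rw [ShortComplex.ShortExact.moduleCat_exact_iff_function_exact] at hT ⊢
  exact Module.Flat.lTensor_exact _ hT

end Induction

section DerivedFunctors

variable {C D E : Type*} [Category* C] [Abelian C] [EnoughProjectives C] [Category* D]
  [Abelian D] [EnoughProjectives D] [Category* E] [Abelian E]

theorem isZero_leftDerived_obj_of_comp_iso (G : C ⥤ D) [G.Additive] [G.PreservesHomology]
    [G.PreservesProjectiveObjects] (F : D ⥤ E) [F.Additive] {H : C ⥤ E} [H.Additive]
    [H.PreservesHomology] (i : G ⋙ F ≅ H) (U : C) (n : ℕ) :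
    Limits.IsZero ((F.leftDerived (n + 1)).obj (G.obj U)) := by
  let Q := ProjectiveResolution.of U
  refine Limits.IsZero.of_iso ?_ ((G.mapProjectiveResolution Q).isoLeftDerivedObj F (n + 1))
  have exactAt : ((H.mapHomologicalComplex _).obj Q.complex).ExactAt (n + 1) :=
    ShortComplex.Exact.map (Q.complex_exactAt_succ n) H
  have iso : (H.mapHomologicalComplex _).obj Q.complex ≅
      (F.mapHomologicalComplex _).obj (G.mapProjectiveResolution Q).complex :=
    ((NatIso.mapHomologicalComplex i _).app Q.complex).symm
  exact (exactAt.of_iso iso).isZero_homology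

end DerivedFunctors

namespace InverseMonoid

variable {K S : Type u} [InverseMonoid S]

instance : CommMonoid (Idem S) where
  mul e f := ⟨e.1 * f.1, idem_mul_idem e.2 f.2⟩
  one := ⟨1, mul_one 1⟩
  mul_assoc e f g := Subtype.ext (mul_assoc e.1 f.1 g.1)
  one_mul e := Subtype.ext (one_mul e.1)
  mul_one e := Subtype.ext (mul_one e.1)
  mul_comm e f := Subtype.ext (idem_comm e.2 f.2)

variable (S) in
/-- The inclusion of the idempotents. -/
def idemVal : Idem S →* S where
  toFun := Subtype.val
  map_one' := rfl
  map_mul' _ _ := rfl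

lemma conj_mul_idem (e : Idem S) (s : S) (f : Idem S) :
    (s * f.1)⁻¹ * e.1 * (s * f.1) = f.1 * (s⁻¹ * e.1 * s) := by
  calc (s * f.1)⁻¹ * e.1 * (s * f.1) = f.1 * (s⁻¹ * e.1 * s * f.1) := by
        rw [mul_inv_rev', inv_of_idem f.2]
        simp only [mul_assoc]
    _ = f.1 * (s⁻¹ * e.1 * s) := by
        rw [idem_comm (conj_idem s e.2) f.2, ← mul_assoc, f.2]

section CommRing

variable [CommRing K]

/-- The right action of `K[E(S)]` on `K[S]`. -/
instance idemModule : Module (MonoidAlgebra K (Idem S)) (MonoidAlgebra K S) where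
  smul c w := w * MonoidAlgebra.mapDomainAlgHom K K (idemVal S) c
  one_smul w := by change w * _ = w; rw [map_one, mul_one]
  mul_smul c d w := by
    change w * _ = w * _ * _
    rw [mul_comm c d, map_mul, mul_assoc]
  smul_zero _ := zero_mul _
  smul_add _ _ _ := add_mul _ _ _
  add_smul _ _ w := by change w * _ = w * _ + w * _; rw [map_add, mul_add]
  zero_smul w := by change w * _ = 0; rw [map_zero, mul_zero]

lemma idem_smul_def (c : MonoidAlgebra K (Idem S)) (w : MonoidAlgebra K S) :
    c • w = w * MonoidAlgebra.mapDomainAlgHom K K (idemVal S) c := rfl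

instance : SMulCommClass (MonoidAlgebra K (Idem S)) (MonoidAlgebra K S) (MonoidAlgebra K S) where
  smul_comm _ r w := mul_assoc r w _

instance : IsScalarTower K (MonoidAlgebra K (Idem S)) (MonoidAlgebra K S) where
  smul_assoc k c w := by
    rw [idem_smul_def, idem_smul_def, map_smul, mul_smul_comm]

lemma of_idem_smul (e : Idem S) (w : MonoidAlgebra K S) :
    MonoidAlgebra.of K (Idem S) e • w = w * MonoidAlgebra.of K S e.1 := by
  rw [idem_smul_def, MonoidAlgebra.of_apply, MonoidAlgebra.mapDomainAlgHom_apply,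
    MonoidAlgebra.mapDomain_single]
  rfl

lemma rightScalars_of (e : Idem S) :
    rightScalars (MonoidAlgebra K (Idem S)) (MonoidAlgebra K S) (MonoidAlgebra.of K _ e) =
      MonoidAlgebra.of K S e.1 :=
  (of_idem_smul e 1).trans (one_mul _)

variable (K) in
/-- The `K[E(S)]`-linear map `s ↦ s⁻¹ e s`. -/
def conjIdem (e : Idem S) :
    MonoidAlgebra K S →ₗ[MonoidAlgebra K (Idem S)] MonoidAlgebra K (Idem S) where
  toFun := MonoidAlgebra.mapDomain fun s => ⟨s⁻¹ * e.1 * s, conj_idem s e.2⟩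
  map_add' := MonoidAlgebra.mapDomain_add _
  map_smul' c w := by
    induction c using MonoidAlgebra.induction_linear with
    | zero => rw [zero_smul, MonoidAlgebra.mapDomain_zero, RingHom.id_apply, zero_smul]
    | add c d hc hd =>
      rw [add_smul, MonoidAlgebra.mapDomain_add, hc, hd, ← add_smul, ← map_add]
    | single f k =>
      induction w using MonoidAlgebra.induction_linear with
      | zero => rw [smul_zero, MonoidAlgebra.mapDomain_zero, smul_zero]
      | add w w' hw hw' =>
        rw [smul_add, MonoidAlgebra.mapDomain_add, MonoidAlgebra.mapDomain_add, hw, hw', smul_add]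
      | single s l =>
        rw [idem_smul_def, MonoidAlgebra.mapDomainAlgHom_apply, MonoidAlgebra.mapDomain_single,
          MonoidAlgebra.single_mul_single, MonoidAlgebra.mapDomain_single,
          MonoidAlgebra.mapDomain_single, RingHom.id_apply, smul_eq_mul,
          MonoidAlgebra.single_mul_single, mul_comm l k]
        refine congrArg (MonoidAlgebra.single · _) (Subtype.ext ?_)
        exact conj_mul_idem e s f

lemma conjIdem_of (e : Idem S) (s : S) :
    conjIdem K e (MonoidAlgebra.of K S s) =
      MonoidAlgebra.of K (Idem S) ⟨s⁻¹ * e.1 * s, conj_idem s e.2⟩ :=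
  MonoidAlgebra.mapDomain_single

lemma conjIdem_oneIdem_one : conjIdem K (BalancedTensor.oneIdem S) (1 : MonoidAlgebra K S) = 1 := by
  rw [MonoidAlgebra.one_def, ← MonoidAlgebra.of_apply, conjIdem_of]
  refine (congrArg (MonoidAlgebra.of K (Idem S)) (Subtype.ext ?_)).trans (map_one _)
  change 1⁻¹ * 1 * 1 = 1
  rw [mul_one, mul_one, inv_of_idem (mul_one 1)]

lemma conjIdem_of_mul (e : Idem S) (s : S) (w : MonoidAlgebra K S) :
    conjIdem K e (MonoidAlgebra.of K S s * w) =
      conjIdem K ⟨s⁻¹ * e.1 * s, conj_idem s e.2⟩ w := by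
  induction w using MonoidAlgebra.induction_linear with
  | zero => rw [mul_zero, map_zero, map_zero]
  | add w w' hw hw' => rw [mul_add, map_add, map_add, hw, hw']
  | single t k =>
    rw [MonoidAlgebra.of_apply, MonoidAlgebra.single_mul_single, one_mul]
    refine (MonoidAlgebra.mapDomain_single).trans (Eq.trans ?_ MonoidAlgebra.mapDomain_single.symm)
    refine congrArg (MonoidAlgebra.single · k) (Subtype.ext ?_)
    change (s * t)⁻¹ * e.1 * (s * t) = t⁻¹ * (s⁻¹ * e.1 * s) * t
    rw [mul_inv_rev']
    simp only [mul_assoc]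

variable (U : ModuleCat.{u} (MonoidAlgebra K (Idem S)))

/-- The map `s ⊗ u ↦ (s⁻¹ e s) • u`. -/
def conjIdemTensor (e : Idem S) : MonoidAlgebra K S ⊗[MonoidAlgebra K (Idem S)] U →ₗ[K]
    (ModuleCat.restrictScalars (algebraMap K (MonoidAlgebra K (Idem S)))).obj U where
  toFun z := TensorProduct.lid (MonoidAlgebra K (Idem S)) U ((conjIdem K e).rTensor U z)
  map_add' z w := by rw [map_add, map_add]; rfl
  map_smul' k z := by
    have h : k • z = algebraMap K (MonoidAlgebra K (Idem S)) k • z := (algebraMap_smul _ _ _).symm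
    rw [h, map_smul, map_smul]
    rfl

lemma conjIdemTensor_tmul (e : Idem S) (w : MonoidAlgebra K S) (u : U) :
    conjIdemTensor U e (w ⊗ₜ u) = (conjIdem K e w • u : U) := rfl

lemma conjIdemTensor_of_smul (e : Idem S) (s : S)
    (z : MonoidAlgebra K S ⊗[MonoidAlgebra K (Idem S)] U) :
    conjIdemTensor U e (MonoidAlgebra.of K S s • z) =
      conjIdemTensor U ⟨s⁻¹ * e.1 * s, conj_idem s e.2⟩ z := by
  induction z with
  | zero => rw [smul_zero, map_zero, map_zero]
  | add z w hz hw => rw [smul_add, map_add, map_add, hz, hw]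
  | tmul w u =>
    rw [TensorProduct.smul_tmul', conjIdemTensor_tmul, conjIdemTensor_tmul, smul_eq_mul,
      conjIdem_of_mul]

/-- The map `e ⊗ (s ⊗ u) ↦ (s⁻¹ e s) • u` on `KE(S) ⊗_{K[S]} (K[S] ⊗_{K[E(S)]} U)`. -/
def coinvariantsInduce : BalancedTensor K (MonoidAlgebra K S) (KE K S)
    (MonoidAlgebra K S ⊗[MonoidAlgebra K (Idem S)] U) →ₗ[K]
      (ModuleCat.restrictScalars (algebraMap K (MonoidAlgebra K (Idem S)))).obj U :=
  BalancedTensor.liftKE (conjIdemTensor U) (conjIdemTensor_of_smul U)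

lemma coinvariantsInduce_mk_one (u : U) :
    coinvariantsInduce U (BalancedTensor.mk K _ (Finsupp.single (BalancedTensor.oneIdem S) 1)
      (1 ⊗ₜ u)) = u := by
  refine (BalancedTensor.liftKE_mk _ (conjIdemTensor_of_smul U) _ _).trans ?_
  rw [conjIdemTensor_tmul, conjIdem_oneIdem_one]
  exact one_smul _ u

lemma exists_eq_mk_one_tmul (t : BalancedTensor K (MonoidAlgebra K S) (KE K S)
    (MonoidAlgebra K S ⊗[MonoidAlgebra K (Idem S)] U)) :
    ∃ u : U, t = BalancedTensor.mk K _ (Finsupp.single (BalancedTensor.oneIdem S) 1)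
      (1 ⊗ₜ u) := by
  obtain ⟨z, rfl⟩ := BalancedTensor.exists_eq_mk_one t
  induction z with
  | zero => exact ⟨0, by rw [TensorProduct.tmul_zero]⟩
  | add z w hz hw =>
    obtain ⟨u, hu⟩ := hz
    obtain ⟨v, hv⟩ := hw
    exact ⟨u + v, by
      rw [BalancedTensor.mk_add, TensorProduct.tmul_add, BalancedTensor.mk_add, hu, hv]⟩
  | tmul w u =>
    induction w using MonoidAlgebra.induction_on generalizing u with
    | of s =>
      refine ⟨MonoidAlgebra.of K (Idem S) ⟨s⁻¹ * 1 * s, conj_idem s (mul_one 1)⟩ • u, ?_⟩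
      rw [← rightScalars_smul_one_tmul, rightScalars_of, ← smul_one_tmul,
        ← BalancedTensor.mk_smul, op_of_smul_single, ← BalancedTensor.mk_single_idem]
      rfl
    | add w w' h h' =>
      obtain ⟨v, hv⟩ := h u
      obtain ⟨v', hv'⟩ := h' u
      exact ⟨v + v', by rw [TensorProduct.add_tmul, BalancedTensor.mk_add,
        TensorProduct.tmul_add, BalancedTensor.mk_add, hv, hv']⟩
    | smul k w h =>
      obtain ⟨v, hv⟩ := h (algebraMap K (MonoidAlgebra K (Idem S)) k • u)
      refine ⟨v, ?_⟩
      rw [← hv, ← TensorProduct.smul_tmul, algebraMap_smul]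

lemma coinvariantsInduce_bijective : Function.Bijective (coinvariantsInduce U) := by
  refine ⟨fun t t' h => ?_, fun u => ⟨_, coinvariantsInduce_mk_one U u⟩⟩
  obtain ⟨u, rfl⟩ := exists_eq_mk_one_tmul U t
  obtain ⟨v, rfl⟩ := exists_eq_mk_one_tmul U t'
  rw [coinvariantsInduce_mk_one, coinvariantsInduce_mk_one] at h
  obtain rfl : u = v := h
  rfl

variable (K S) in
/-- The natural isomorphism `KE(S) ⊗_{K[S]} (K[S] ⊗_{K[E(S)]} U) ≅ U`. -/
def coinvariantsInduceIso : induce (MonoidAlgebra K (Idem S)) (MonoidAlgebra K S) ⋙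
    tensorFunctor K (MonoidAlgebra K S) (KE K S) ≅
      ModuleCat.restrictScalars (algebraMap K (MonoidAlgebra K (Idem S))) :=
  NatIso.ofComponents
    (fun U => (LinearEquiv.ofBijective (coinvariantsInduce U)
      (coinvariantsInduce_bijective U)).toModuleIso)
    (fun {U V} f => ModuleCat.hom_ext <| LinearMap.ext fun t => by
      obtain ⟨u, rfl⟩ := exists_eq_mk_one_tmul U t
      exact (coinvariantsInduce_mk_one V (f.hom u)).trans
        (congrArg f.hom (coinvariantsInduce_mk_one U u).symm))

end CommRing

section Field

variable [Field K]

lemma flat_monoidAlgebra_idem (M : Type*) [AddCommGroup M] [Module (MonoidAlgebra K (Idem S)) M] :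
    Module.Flat (MonoidAlgebra K (Idem S)) M :=
  (isVonNeumannRegular_monoidAlgebra fun e : Idem S => Subtype.ext e.2).flat M

theorem isZero_tor_of_retract_induce {N : ModuleCat.{u} (MonoidAlgebra K S)}
    {U : ModuleCat.{u} (MonoidAlgebra K (Idem S))}
    (r : Retract N ((induce (MonoidAlgebra K (Idem S)) (MonoidAlgebra K S)).obj U)) (n : ℕ) :
    Limits.IsZero (((tensorFunctor K (MonoidAlgebra K S) (KE K S)).leftDerived (n + 1)).obj N) := by
  have := flat_monoidAlgebra_idem (K := K) (S := S) (MonoidAlgebra K S)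
  have := preservesHomology_induce (R := MonoidAlgebra K (Idem S)) (T := MonoidAlgebra K S)
  exact (isZero_leftDerived_obj_of_comp_iso (induce (MonoidAlgebra K (Idem S)) (MonoidAlgebra K S))
    _ (coinvariantsInduceIso K S) U n).of_mono
    (r.map (Functor.leftDerived _ (n + 1))).i

end Field

end InverseMonoid

/-! ### Acyclicity of `F₁` of a free bimodule -/

namespace InverseMonoid

variable {S : Type u} [InverseMonoid S]

lemma idem_mul_eq (s : S) {e : S} (he : e * e = e) : e * s = s * (s⁻¹ * e * s) := by
  rw [← mul_assoc, ← mul_assoc, ← idem_comm he (mul_inv_idem s), mul_assoc, mul_inv_mul_self]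

end InverseMonoid

namespace UnitalAction

variable {K A S : Type u} [CommRing K] [Ring A] [Algebra K A] [InverseMonoid S]
  (α : UnitalAction K A S)

section Lift

variable {E : Type*} [Ring E] [Algebra K E] (f : A →ₐ[K] E) (g : S →* E)
  (covariant : ∀ s a, g s * f a = f (α.act s a) * g s)
  (idem : ∀ e : S, e * e = e → g e = f (α.unit e))

/-- The homomorphism `a δₛ ↦ f a * g s` on `L(A, θ, S)`. -/
def liftL : α.L →ₐ[K] E :=
  AlgHom.ofLinearMap
    ((Finsupp.lsum K fun s => LinearMap.mulRight K (g s) ∘ₗ f.toLinearMap) ∘ₗ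
      α.lSubmodule.subtype)
    ((Finsupp.sum_single_index (by simp)).trans (by simp))
    (fun x y => by
      change Finsupp.lsum K _ (α.lmul x.1 y.1) = Finsupp.lsum K _ x.1 * Finsupp.lsum K _ y.1
      induction x.1 using Finsupp.induction_linear with
      | zero => simp only [map_zero, LinearMap.zero_apply, zero_mul]
      | add x x' hx hx' => simp only [map_add, LinearMap.add_apply, add_mul, hx, hx']
      | single s a =>
        induction y.1 using Finsupp.induction_linear with
        | zero => simp only [map_zero, mul_zero]
        | add y y' hy hy' => simp only [map_add, mul_add, hy, hy']
        | single t b =>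
          simp only [lmul_single, Finsupp.lsum_single, LinearMap.comp_apply,
            LinearMap.mulRight_apply, AlgHom.toLinearMap_apply, map_mul, mul_assoc]
          rw [← mul_assoc (g s), covariant, mul_assoc])

lemma liftL_δ (s : S) (a : A) (h : α.unit s * a = a) :
    α.liftL f g covariant (α.δ s a h) = f a * g s :=
  (Finsupp.lsum_apply K _ (Finsupp.single s a)).trans (Finsupp.sum_single_index (map_zero _))

/-- The universal property of the crossed product: a covariant pair of representations of `A` and
`S` which agree on idempotents induces a representation of `A ⋊_θ S`. -/
def lift : α.CrossedProduct →ₐ[K] E :=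
  Ideal.Quotient.liftₐ _ (α.liftL f g covariant) fun x hx => by
    rw [TwoSidedIdeal.mem_asIdeal] at hx
    refine (TwoSidedIdeal.mem_ker _).1 (TwoSidedIdeal.span_le.2 ?_ hx)
    rintro _ ⟨s, t, a, hs, ht, ⟨e, he, rfl⟩, rfl⟩
    have ha : a * α.unit e = a := by
      rw [← unit_central, ← hs, ← act_unit, ← mul_assoc, unit_mul_act]
    refine (TwoSidedIdeal.mem_ker _).2 ?_
    rw [map_sub, liftL_δ, liftL_δ, map_mul, idem e he, ← mul_assoc, ← map_mul, ha, sub_self]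

lemma lift_ι (a : A) : α.lift f g covariant idem (α.ι a) = f a :=
  (α.liftL_δ f g covariant 1 a (by rw [α.unit_one, one_mul])).trans (by rw [map_one, mul_one])

lemma lift_Γ (s : S) : α.lift f g covariant idem (α.Γ s) = g s :=
  (α.liftL_δ f g covariant s _ (α.unit_idem s)).trans (by
    rw [← act_one, ← covariant, map_one, mul_one])

end Lift

section Coinduced

variable (Y I : Type u) [AddCommGroup Y] [Module K Y] [Module α.CrossedProductᵐᵒᵖ Y]
  [IsScalarTower K α.CrossedProductᵐᵒᵖ Y] [AddCommGroup I] [Module K I]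
  [Module (MonoidAlgebra K S) I] [IsScalarTower K (MonoidAlgebra K S) I]

/-- The maps from a right module over the crossed product to a representation of `S` which are
equivariant with respect to the idempotents of `S`. -/
def idemEquivariant : Submodule K (Y →ₗ[K] I) where
  carrier := {φ | ∀ e, e * e = e → ∀ y, φ (op (α.Γ e) • y) = MonoidAlgebra.of K S e • φ y}
  add_mem' hφ hψ e he y := by
    rw [LinearMap.add_apply, LinearMap.add_apply, hφ e he, hψ e he, smul_add]
  zero_mem' _ _ _ := by simp
  smul_mem' k φ hφ e he y := by
    rw [LinearMap.smul_apply, LinearMap.smul_apply, hφ e he, smul_algebra_smul_comm]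

variable {Y I}

/-- The representation of `A` on equivariant maps by precomposition: `a • φ = φ (_ • a)`. -/
def precompι : A →ₐ[K] Module.End K (α.idemEquivariant Y I) where
  toFun a := (LinearMap.lcomp K I (Algebra.lsmul K K Y (op (α.ι a)))).restrict
    fun φ hφ e he y => by
      change φ (op (α.ι a) • op (α.Γ e) • y) = MonoidAlgebra.of K S e • φ (op (α.ι a) • y)
      rw [← hφ e he, ← mul_smul, ← mul_smul, ← op_mul, ← op_mul, Γ_idem α he, ← map_mul,
        ← map_mul, unit_central]
  map_one' := by
    ext φ y
    change φ.1 (op (α.ι 1) • y) = φ.1 y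
    rw [map_one, op_one, one_smul]
  map_mul' a b := by
    ext φ y
    change φ.1 (op (α.ι (a * b)) • y) = φ.1 (op (α.ι b) • op (α.ι a) • y)
    rw [map_mul, op_mul, mul_smul]
  map_zero' := by
    ext φ y
    change φ.1 (op (α.ι 0) • y) = 0
    rw [map_zero, op_zero, zero_smul, map_zero]
  map_add' a b := by
    ext φ y
    change φ.1 (op (α.ι (a + b)) • y) = φ.1 (op (α.ι a) • y) + φ.1 (op (α.ι b) • y)
    rw [map_add, MulOpposite.op_add, add_smul, map_add]
  commutes' k := by
    ext φ y
    change φ.1 (op (α.ι (algebraMap K A k)) • y) = k • φ.1 y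
    rw [α.ι.commutes, ← map_smul, ← algebraMap_smul α.CrossedProductᵐᵒᵖ k y]
    rfl

/-- The conjugation representation of `S` on equivariant maps: `s • φ = s • φ (_ • s)`. -/
def twist : S →* Module.End K (α.idemEquivariant Y I) where
  toFun s := ((Algebra.lsmul K K I (MonoidAlgebra.of K S s)).compRight K ∘ₗ
      LinearMap.lcomp K I (Algebra.lsmul K K Y (op (α.Γ s)))).restrict fun φ hφ e he y => by
    change MonoidAlgebra.of K S s • φ (op (α.Γ s) • op (α.Γ e) • y) =
      MonoidAlgebra.of K S e • MonoidAlgebra.of K S s • φ (op (α.Γ s) • y)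
    rw [← mul_smul, ← mul_smul, ← op_mul, ← map_mul, ← map_mul, idem_mul_eq s he,
      map_mul α.Γ s, map_mul _ s, op_mul, mul_smul, mul_smul, hφ _ (conj_idem s he)]
  map_one' := by
    ext φ y
    change MonoidAlgebra.of K S 1 • φ.1 (op (α.Γ 1) • y) = φ.1 y
    rw [map_one, map_one, op_one, one_smul, one_smul]
  map_mul' s t := by
    ext φ y
    change MonoidAlgebra.of K S (s * t) • φ.1 (op (α.Γ (s * t)) • y) =
      MonoidAlgebra.of K S s • MonoidAlgebra.of K S t • φ.1 (op (α.Γ t) • op (α.Γ s) • y)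
    rw [map_mul, map_mul, op_mul, mul_smul, mul_smul]

/-- The left module structure over the crossed product on equivariant maps, combining `precompι` and
`twist`. -/
def idemEquivariantRep : α.CrossedProduct →ₐ[K] Module.End K (α.idemEquivariant Y I) :=
  α.lift (E := Module.End K (α.idemEquivariant Y I)) α.precompι α.twist
    (fun s a => by
      ext φ y
      change MonoidAlgebra.of K S s • φ.1 (op (α.ι a) • op (α.Γ s) • y) =
        MonoidAlgebra.of K S s • φ.1 (op (α.Γ s) • op (α.ι (α.act s a)) • y)
      rw [← mul_smul, ← mul_smul, ← op_mul, ← op_mul, Γ_mul_ι])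
    (fun e he => by
      ext φ y
      change MonoidAlgebra.of K S e • φ.1 (op (α.Γ e) • y) = φ.1 (op (α.ι (α.unit e)) • y)
      rw [← φ.2 e he, ← mul_smul, ← op_mul, ← map_mul, he, Γ_idem α he])

lemma idemEquivariantRep_ι (a : A) (φ : α.idemEquivariant Y I) (y : Y) :
    (α.idemEquivariantRep (α.ι a) φ).1 y = φ.1 (op (α.ι a) • y) :=
  congrArg (fun r : Module.End K (α.idemEquivariant Y I) => (r φ).1 y)
    (α.lift_ι (E := Module.End K (α.idemEquivariant Y I)) _ _ _ _ a)

lemma idemEquivariantRep_Γ (s : S) (φ : α.idemEquivariant Y I) (y : Y) :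
    (α.idemEquivariantRep (α.Γ s) φ).1 y =
      MonoidAlgebra.of K S s • φ.1 (op (α.Γ s) • y) :=
  congrArg (fun r : Module.End K (α.idemEquivariant Y I) => (r φ).1 y)
    (α.lift_Γ (E := Module.End K (α.idemEquivariant Y I)) _ _ _ _ s)

lemma idemEquivariantRep_Γ_op_smul (s : S) (φ : α.idemEquivariant Y I) (y : Y) :
    (α.idemEquivariantRep (α.Γ s) φ).1 (op (α.Γ s⁻¹) • y) = MonoidAlgebra.of K S s • φ.1 y := by
  rw [idemEquivariantRep_Γ, ← mul_smul, ← op_mul, ← map_mul α.Γ, φ.2 _ (inv_mul_idem s),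
    ← mul_smul, ← map_mul, ← mul_assoc, mul_inv_mul_self]

end Coinduced

end UnitalAction

namespace UnitalAction

variable {K A S : Type u} [CommRing K] [Ring A] [Algebra K A] [InverseMonoid S]
  (α : UnitalAction K A S)

section Induced

variable (M : ModuleCat.{u} (Env K α.CrossedProduct))

/-- The restriction of `A ⊗_{A^e} M` to `K[E(S)]`. -/
abbrev idemRestrict : ModuleCat.{u} (MonoidAlgebra K (Idem S)) :=
  (ModuleCat.restrictScalars (rightScalars (MonoidAlgebra K (Idem S)) (MonoidAlgebra K S))).obj
    (α.F₁.obj M)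

/-- The representation of `S` induced from the restriction of `A ⊗_{A^e} M` to `K[E(S)]`. -/
abbrev Induced : Type u := MonoidAlgebra K S ⊗[MonoidAlgebra K (Idem S)] α.idemRestrict M

/-- The map `z ↦ 1 ⊗ z`. -/
def oneTmul : α.F₁Obj M →ₗ[K] α.Induced M where
  toFun z := 1 ⊗ₜ[MonoidAlgebra K (Idem S)] (show α.idemRestrict M from z)
  map_add' _ _ := TensorProduct.tmul_add _ _ _
  map_smul' k z := by
    have smul_eq : k • z = rightScalars (MonoidAlgebra K (Idem S)) (MonoidAlgebra K S)
        (algebraMap K _ k) • z :=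
      (algebraMap_smul (MonoidAlgebra K S) k z).symm.trans
        (congrArg (· • z) ((Algebra.algebraMap_eq_smul_one k).trans
          (algebraMap_smul (MonoidAlgebra K (Idem S)) k (1 : MonoidAlgebra K S)).symm))
    rw [smul_eq]
    exact (TensorProduct.tmul_smul (algebraMap K (MonoidAlgebra K (Idem S)) k)
      (1 : MonoidAlgebra K S) (show α.idemRestrict M from z)).trans
        (algebraMap_smul (MonoidAlgebra K (Idem S)) k (M := α.Induced M) _)

lemma of_smul_oneTmul {e : S} (he : e * e = e) (z : α.F₁Obj M) :
    MonoidAlgebra.of K S e • α.oneTmul M z = α.oneTmul M (MonoidAlgebra.of K S e • z) := by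
  rw [← rightScalars_of (K := K) (⟨e, he⟩ : Idem S)]
  exact rightScalars_smul_one_tmul _ _

end Induced

section Free

variable (V : Type u) [AddCommGroup V] [Module K V]

/-- The free bimodule on `V`. -/
abbrev free : ModuleCat.{u} (Env K α.CrossedProduct) :=
  ModuleCat.of _ (Env K α.CrossedProduct ⊗[K] V)

variable {V}

lemma free_induction {p : α.free V → Prop} (z : α.free V)
    (tmul : ∀ (b : α.CrossedProduct) (c : α.CrossedProductᵐᵒᵖ) (v : V), p (b ⊗ₜ[K] c ⊗ₜ[K] v))
    (add : ∀ z w, p z → p w → p (z + w)) : p z := by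
  have zero : p 0 := by
    have h := tmul 0 0 0
    rwa [TensorProduct.tmul_zero] at h
  induction z using TensorProduct.induction_on with
  | zero => exact zero
  | add z w hz hw => exact add z w hz hw
  | tmul r v =>
    induction r using TensorProduct.induction_on with
    | zero =>
      have h := tmul 0 0 v
      rwa [TensorProduct.tmul_zero] at h
    | add r r' hr hr' => exact (TensorProduct.add_tmul (R := K) r r' v).symm ▸ add _ _ hr hr'
    | tmul b c => exact tmul b c v

lemma tmul_smul_tmul_tmul (b b' : α.CrossedProduct) (c c' : α.CrossedProductᵐᵒᵖ) (v : V) :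
    (b ⊗ₜ[K] c : Env K α.CrossedProduct) • (b' ⊗ₜ[K] c' ⊗ₜ[K] v : α.free V) =
      (b * b') ⊗ₜ[K] (c * c') ⊗ₜ[K] v := by
  rw [TensorProduct.smul_tmul', smul_eq_mul, Algebra.TensorProduct.tmul_mul_tmul]

variable (V)

/-- The map `z ↦ 1 ⊗ (1 ⊗ z)` on a free bimodule. -/
def inducedUnit : Env K α.CrossedProduct ⊗[K] V →ₗ[K] α.Induced (α.free V) where
  toFun z := α.oneTmul (α.free V) (α.mkOne (α.free V) z)
  map_add' z w := by rw [map_add, map_add]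
  map_smul' k z := by
    have h : k • z = envLeft K _ (algebraMap K α.CrossedProduct k) • z := by
      rw [AlgHom.commutes, algebraMap_smul]
    rw [h]
    exact (congrArg _ (α.mkOne_envLeft_algebraMap_smul (α.free V) k z)).trans (map_smul _ _ _)

lemma inducedUnit_apply (z : α.free V) :
    α.inducedUnit V z = α.oneTmul (α.free V) (α.mkOne (α.free V) z) := rfl

lemma inducedUnit_envRight_Γ_smul {e : S} (he : e * e = e) (z : α.free V) :
    α.inducedUnit V (envRight K _ (op (α.Γ e)) • z) =
      MonoidAlgebra.of K S e • α.inducedUnit V z := by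
  rw [inducedUnit_apply, inducedUnit_apply, of_smul_oneTmul α _ he, of_idem_smul_mkOne α _ he]

/-- The map `v ↦ (c ↦ 1 ⊗ (1 ⊗ ((1 ⊗ c) ⊗ v)))`. -/
def freeUnit : V →ₗ[K] α.idemEquivariant α.CrossedProductᵐᵒᵖ (α.Induced (α.free V)) :=
  LinearMap.codRestrict _ ((TensorProduct.mk K _ V).compr₂ (α.inducedUnit V) ∘ₗ
    (envRight K α.CrossedProduct).toLinearMap).flip fun v e he c => by
      refine Eq.trans ?_ (α.inducedUnit_envRight_Γ_smul V he (envRight K _ c ⊗ₜ[K] v))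
      change α.inducedUnit V (envRight K _ (op (α.Γ e) * c) ⊗ₜ[K] v) = _
      rw [map_mul]
      rfl

lemma freeUnit_apply (v : V) (c : α.CrossedProductᵐᵒᵖ) :
    (α.freeUnit V v).1 c = α.inducedUnit V (envRight K _ c ⊗ₜ[K] v) := rfl

/-- The map `(b ⊗ c) ⊗ v ↦ (b • freeUnit v) c`. -/
def freeToInduced : Env K α.CrossedProduct ⊗[K] V →ₗ[K] α.Induced (α.free V) :=
  TensorProduct.lift (TensorProduct.lift
    (LinearMap.lflip.toLinearMap ∘ₗ
      (Submodule.subtype _).compRight K ∘ₗ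
      LinearMap.lcomp K _ (α.freeUnit V) ∘ₗ α.idemEquivariantRep.toLinearMap))

lemma freeToInduced_tmul (b : α.CrossedProduct) (c : α.CrossedProductᵐᵒᵖ) (v : V) :
    α.freeToInduced V ((b ⊗ₜ c) ⊗ₜ v) = (α.idemEquivariantRep b (α.freeUnit V v)).1 c := rfl

lemma freeToInduced_envLeft_ι_smul (a : A) (z : α.free V) :
    α.freeToInduced V (envLeft K _ (α.ι a) • z) =
      α.freeToInduced V (envRight K _ (op (α.ι a)) • z) := by
  induction z using α.free_induction with
  | add z w hz hw => rw [smul_add, smul_add, map_add, map_add, hz, hw]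
  | tmul b c v =>
    refine (congrArg (α.freeToInduced V) (α.tmul_smul_tmul_tmul ..)).trans
      (Eq.trans ?_ (congrArg (α.freeToInduced V) (α.tmul_smul_tmul_tmul ..)).symm)
    rw [freeToInduced_tmul, freeToInduced_tmul, one_mul, one_mul, map_mul α.idemEquivariantRep]
    exact α.idemEquivariantRep_ι a _ c

lemma freeToInduced_conj_smul (s : S) (z : α.free V) :
    α.freeToInduced V (α.conj s • z) = MonoidAlgebra.of K S s • α.freeToInduced V z := by
  induction z using α.free_induction with
  | add z w hz hw => rw [smul_add, map_add, map_add, smul_add, hz, hw]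
  | tmul b c v =>
    refine (congrArg (α.freeToInduced V) (α.tmul_smul_tmul_tmul ..)).trans ?_
    rw [freeToInduced_tmul, freeToInduced_tmul, map_mul α.idemEquivariantRep]
    exact α.idemEquivariantRep_Γ_op_smul s _ c

lemma freeToInduced_envLeft_algebraMap_smul (k : K) (z : α.free V) :
    α.freeToInduced V (envLeft K _ (algebraMap K α.CrossedProduct k) • z) =
      k • α.freeToInduced V z := by
  rw [AlgHom.commutes, algebraMap_smul]
  exact (α.freeToInduced V).map_smul k z

/-- The map on `A ⊗_{A^e} F` induced by `freeToInduced`, where `F` is the free bimodule on `V`. -/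
def F₁FreeToInduced : α.F₁Obj (α.free V) →ₗ[K] α.Induced (α.free V) :=
  α.F₁Lift (M := α.free V) (α.freeToInduced V).toAddMonoidHom
    (α.freeToInduced_envLeft_ι_smul V) (α.freeToInduced_envLeft_algebraMap_smul V)

lemma F₁FreeToInduced_mkOne (z : α.free V) :
    α.F₁FreeToInduced V (α.mkOne (α.free V) z) = α.freeToInduced V z :=
  α.F₁Lift_mkOne (M := α.free V) (α.freeToInduced V).toAddMonoidHom
    (α.freeToInduced_envLeft_ι_smul V) (α.freeToInduced_envLeft_algebraMap_smul V) z

lemma F₁FreeToInduced_of_smul (s : S) (z : α.F₁Obj (α.free V)) :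
    α.F₁FreeToInduced V (MonoidAlgebra.of K S s • z) =
      MonoidAlgebra.of K S s • α.F₁FreeToInduced V z := by
  obtain ⟨z, rfl⟩ := α.mkOne_surjective _ z
  rw [of_smul_mkOne, F₁FreeToInduced_mkOne, F₁FreeToInduced_mkOne, freeToInduced_conj_smul]

/-- The counit `Induced M → A ⊗_{A^e} M` of Frobenius reciprocity. -/
def inducedCounit (M : ModuleCat.{u} (Env K α.CrossedProduct)) :
    α.Induced M →ₗ[MonoidAlgebra K S] α.F₁Obj M :=
  induceLift (N := α.F₁.obj M) (𝟙 (α.idemRestrict M))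

lemma inducedCounit_oneTmul (M : ModuleCat.{u} (Env K α.CrossedProduct)) (z : α.F₁Obj M) :
    α.inducedCounit M (α.oneTmul M z) = z :=
  one_smul (MonoidAlgebra K S) z

lemma inducedCounit_freeToInduced_tmul (b : α.CrossedProduct) (c : α.CrossedProductᵐᵒᵖ) (v : V) :
    α.inducedCounit _ (α.freeToInduced V (b ⊗ₜ c ⊗ₜ v)) = α.mkOne (α.free V) (b ⊗ₜ c ⊗ₜ v) := by
  induction b using α.crossedProduct_induction with
  | zero =>
    rw [TensorProduct.zero_tmul, TensorProduct.zero_tmul, map_zero]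
    exact (map_zero (α.inducedCounit _)).trans (map_zero (α.mkOne _)).symm
  | add b b' hb hb' =>
    rw [TensorProduct.add_tmul, TensorProduct.add_tmul, map_add]
    exact (map_add (α.inducedCounit _) _ _).trans ((congrArg₂ _ hb hb').trans
      (map_add (α.mkOne (α.free V)) _ _).symm)
  | single a s =>
    rw [freeToInduced_tmul, map_mul α.idemEquivariantRep, Module.End.mul_apply,
      idemEquivariantRep_ι, idemEquivariantRep_Γ, ← mul_smul, ← op_mul, freeUnit_apply,
      inducedUnit_apply]
    refine ((α.inducedCounit _).map_smul _ _).trans ?_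
    rw [inducedCounit_oneTmul]
    have smul_envRight : (envRight K _ (op (α.ι a * α.Γ s) • c) ⊗ₜ[K] v : α.free V) =
        envRight K _ (op (α.ι a * α.Γ s)) • ((1 ⊗ₜ[K] c) ⊗ₜ[K] v : α.free V) :=
      ((α.tmul_smul_tmul_tmul _ _ _ _ v).trans (by rw [one_mul, smul_eq_mul]; rfl)).symm
    have smul_envLeft : ((α.ι a * α.Γ s) ⊗ₜ[K] c ⊗ₜ[K] v : α.free V) =
        envLeft K _ (α.ι a * α.Γ s) • ((1 ⊗ₜ[K] c) ⊗ₜ[K] v : α.free V) :=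
      ((α.tmul_smul_tmul_tmul _ _ _ _ v).trans (by rw [mul_one, one_mul])).symm
    rw [smul_envLeft, ← of_smul_mkOne_envRight_smul]
    exact congrArg (fun z => MonoidAlgebra.of K S s • α.mkOne (α.free V) z) smul_envRight

lemma inducedCounit_F₁FreeToInduced (z : α.F₁Obj (α.free V)) :
    α.inducedCounit _ (α.F₁FreeToInduced V z) = z := by
  obtain ⟨z, rfl⟩ := α.mkOne_surjective _ z
  rw [F₁FreeToInduced_mkOne]
  induction z using α.free_induction with
  | add z w hz hw =>
    rw [map_add, map_add (α.mkOne _)]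
    exact ((α.inducedCounit _).map_add _ _).trans (congrArg₂ _ hz hw)
  | tmul b c v => exact α.inducedCounit_freeToInduced_tmul V b c v

/-- `A ⊗_{A^e} F` for a free bimodule `F` is a retract of an induced representation. -/
def F₁FreeRetract : Retract (α.F₁.obj (α.free V))
    ((induce (MonoidAlgebra K (Idem S)) (MonoidAlgebra K S)).obj (α.idemRestrict (α.free V))) where
  i := ModuleCat.ofHom (MonoidAlgebra.equivariantOfLinearOfComm (α.F₁FreeToInduced V)
    fun s z => α.F₁FreeToInduced_of_smul V s z)
  r := ModuleCat.ofHom (α.inducedCounit (α.free V))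
  retract := by
    ext z
    exact α.inducedCounit_F₁FreeToInduced V z

end Free

end UnitalAction

theorem UnitalAction.isZero_tor_F₁_free {K A S : Type u} [Field K] [Ring A] [Algebra K A]
    [InverseMonoid S] (α : UnitalAction K A S) (V : Type u) [AddCommGroup V] [Module K V] (n : ℕ) :
    Limits.IsZero (((tensorFunctor K (MonoidAlgebra K S) (KE K S)).leftDerived (n + 1)).obj
      (α.F₁.obj (α.free V))) :=
  InverseMonoid.isZero_tor_of_retract_induce (α.F₁FreeRetract V) n

open scoped ModuleCat in
theorem UnitalAction.isZero_tor_F₁_cover {K A S : Type u} [Field K] [Ring A] [Algebra K A]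
    [InverseMonoid S] (α : UnitalAction K A S) (V : ModuleCat.{u} (Env K α.CrossedProduct))
    (n : ℕ) :
    Limits.IsZero (((tensorFunctor K (MonoidAlgebra K S) (KE K S)).leftDerived (n + 1)).obj
      (α.F₁.obj ((FreeCover.cover K _).obj V))) :=
  α.isZero_tor_F₁_free V n

end

theorem mainTheorem1 {K A S : Type u} [Field K] [Ring A] [Algebra K A] [InverseMonoid S]
    (θ : UnitalAction K A S) (M : ModuleCat.{u} (Env K θ.CrossedProduct)) :
    ∃ E : FirstQuadrantHomologySS K,
      (∀ p q : ℕ, Nonempty ((E.page 2 le_rfl).X (p, q) ≅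
        inverseMonoidHomology K S p ((θ.F₁.leftDerived q).obj M))) ∧
      E.ConvergesTo (fun n => hochschildHomology K θ.CrossedProduct n M) := by
  let P := FreeCover.resolution K M
  obtain ⟨E, pageIso, converges⟩ := FreeCover.exists_spectralSequence K
    (tensorFunctor K (MonoidAlgebra K S) (KE K S))
    (C := (θ.F₁.mapHomologicalComplex _).obj P.complex)
    (fun p q => θ.isZero_tor_F₁_cover ((FreeCover.syzygies K _ q).obj M) p)
  refine ⟨E, fun p q => ?_, converges.of_equiv fun n => ?_⟩
  · obtain ⟨i⟩ := pageIso p q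
    exact ⟨i ≪≫ ((tensorFunctor K (MonoidAlgebra K S) (KE K S)).leftDerived p).mapIso
      (P.isoLeftDerivedObj θ.F₁ q).symm⟩
  · exact ((HomologicalComplex.homologyFunctor _ _ n).mapIso
      ((NatIso.mapHomologicalComplex θ.compositeIso _).app P.complex) ≪≫
        (P.isoLeftDerivedObj (tensorFunctor K (Env K θ.CrossedProduct) θ.CrossedProduct)
          n).symm).toLinearEquiv
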